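/- Let $p$ be a prime, $\mathbb F$ a perfect field of characteristic $p$, $\mathfrak S=W(\mathbb F)[[u]]$, and let $\varphi:\mathfrak S\to\mathfrak S$ be the Frobenius (the Witt vector Frobenius on $W(\mathbb F)$, and $u\mapsto u^p$). Let $E\in W(\mathbb F)[u]$ be a monic Eisenstein polynomial of degree $e\ge 1$, i.e. the minimal polynomial of a uniformizer of a finite totally ramified extension of $\operatorname{Frac}W(\mathbb F)$. Let $\mathrm{Mod}_{\mathfrak S}^{\varphi}$ be the category of pairs $(M,\varphi_M)$ of a finitely generated $\mathfrak S$-module $M$ and an isomorphism $\varphi_M:(\varphi^*M)[\tfrac1E]\xrightarrow{\sim}M[\tfrac1E]$, with the $\mathfrak S$-linear maps compatible with the Frobenii as morphisms. A *Kisin module* is an object with $M$ free over $\mathfrak S$; a *torsion Kisin module* is an object with $M$ killed by a power of $p$ and without $u$-torsion. A morphism is an *isogeny* if its kernel and cokernel are killed by a power of $p$; two objects are *isogenous* if there is an isogeny between them. For submodules $L_1,L_2$ of a module write $\nu(L_1,L_2)=\operatorname{length}(L_2/L_1\cap L_2)-\operatorname{length}(L_1/L_1\cap L_2)$. * A torsion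 Kisin module $M\neq0$ has rank $\operatorname{length}_{W(\mathbb F)}(M/uM)$, degree $\tfrac1e\,\nu(M,\varphi_M(\varphi^*M))$ (lengths over $\mathfrak S$, inside $M[\tfrac1E]$), and slope $\mu(M)=\deg M/\operatorname{rank}M$. It is *semi-stable* if $\mu(N)\le\mu(M)$ for every subobject $N\ne0$ of $M$ such that $M/N$ has no $u$-torsion. * A Kisin module $M\ne0$ has degree $\deg M=\nu\big(M_{(E)},\varphi_M(\varphi^*M)_{(E)}\big)$ (lengths over the discrete valuation ring $\mathfrak S_{(E)}$), and slope $\mu_M=\deg M/\operatorname{rank}_{\mathfrak S}M$. It is *semi-stable* if the torsion Kisin module $M/pM$ is semi-stable. * A Kisin module $M$ is *HN-type* if it has a flag of Kisin submodules $0=M_0\subset M_1\subset\dots\subset M_r=M$, $r\geq 0$, such that every $M_i/M_{i-1}$, $1\le i\le r$, is a semi-stable (in particular free and nonzero) Kisin module and the slopes $\mu_i$ of $M_i/M_{i-1}$ satisfy $\mu_1>\dots>\mu_r$. **Theorem.** Every Kisin module is isogenous to an HN-type Kisin module. -/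

import Mathlib

open scoped TensorProduct

universe u v

namespace Kisin

section Ring

variable (p : ℕ) [Fact p.Prime] (F : Type u) [Field F]

/-- The ring `𝔖 = W(F)⟦u⟧`; the variable `u` is `PowerSeries.X`. -/
abbrev S : Type u := PowerSeries (WittVector p F)

/-- The Frobenius of `𝔖`: the Witt vector Frobenius on coefficients, and `u ↦ u ^ p`. -/
noncomputable def frobS : S p F →+* S p F :=
  (PowerSeries.expand (R := WittVector p F) p (Fact.out : p.Prime).ne_zero).toRingHom.comp
    (PowerSeries.map WittVector.frobenius)

/-- The ring `𝔖`, regarded as an `𝔖`-algebra through its Frobenius. -/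
def Tw : Type u := S p F

noncomputable instance : CommRing (Tw p F) := inferInstanceAs (CommRing (S p F))

noncomputable instance : Algebra (S p F) (Tw p F) := (frobS p F).toAlgebra

/-- `∑ i < p, u ^ i * φ (g i)`, as an `𝔖`-linear map in `g`. -/
noncomputable def twSum : (Fin p → S p F) →ₗ[S p F] Tw p F where
  toFun g := (∑ i : Fin p, PowerSeries.X ^ (i : ℕ) * frobS p F (g i) : S p F)
  map_add' g h := by
    change _ = ((_ : S p F) + (_ : S p F))
    simp only [Pi.add_apply, map_add, mul_add, Finset.sum_add_distrib]
  map_smul' a g := by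
    change _ = (frobS p F a * _ : S p F)
    simp only [Pi.smul_apply, smul_eq_mul, map_mul, Finset.mul_sum]
    exact Finset.sum_congr rfl fun i _ => by ring

theorem coeff_twSum (g : Fin p → S p F) (n : ℕ) (i : Fin p) :
    PowerSeries.coeff (p * n + i) (twSum p F g : S p F) =
      WittVector.frobenius (PowerSeries.coeff n (g i)) := by
  have hp0 : p ≠ 0 := (Fact.out : p.Prime).ne_zero
  change PowerSeries.coeff (p * n + i)
    (∑ j : Fin p, PowerSeries.X ^ (j : ℕ) * frobS p F (g j) : S p F) = _
  rw [map_sum, Finset.sum_eq_single i]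
  · rw [PowerSeries.coeff_X_pow_mul]
    change PowerSeries.coeff (p * n) (PowerSeries.expand p hp0 _) = _
    rw [PowerSeries.coeff_expand_mul, PowerSeries.coeff_map]
  · intro j _ hj
    rw [PowerSeries.coeff_X_pow_mul']
    split_ifs with h
    · change PowerSeries.coeff (p * n + i - j) (PowerSeries.expand p hp0 _) = _
      refine PowerSeries.coeff_expand_of_not_dvd _ _ _ fun hd => hj ?_
      have h1 : p * n + i ≡ j [MOD p] := ((Nat.modEq_iff_dvd' h).2 hd).symm
      have h2 : (i : ℕ) ≡ j [MOD p] := by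
        have : p * n + i ≡ i [MOD p] := by simp [Nat.ModEq]
        exact this.symm.trans h1
      exact Fin.ext (h2.symm.eq_of_lt_of_lt j.2 i.2)
    · rfl
  · simp

variable [CharP F p] [PerfectRing F p]

theorem twSum_bijective : Function.Bijective (twSum p F) := by
  have hp : 0 < p := (Fact.out : p.Prime).pos
  constructor
  · intro g h hgh
    funext i
    ext n : 1
    apply (WittVector.frobeniusEquiv p F).injective
    simp only [WittVector.frobeniusEquiv_apply]
    rw [← coeff_twSum, ← coeff_twSum, hgh]
  · intro f
    refine ⟨fun i => PowerSeries.mk fun n => (WittVector.frobeniusEquiv p F).symm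
      (PowerSeries.coeff (p * n + i) (f : S p F)), ?_⟩
    refine PowerSeries.ext (R := WittVector p F) fun m => ?_
    have := coeff_twSum p F (fun i => PowerSeries.mk fun n => (WittVector.frobeniusEquiv p F).symm
      (PowerSeries.coeff (p * n + i) (f : S p F))) (m / p) ⟨m % p, Nat.mod_lt _ hp⟩
    rw [PowerSeries.coeff_mk, ← WittVector.frobeniusEquiv_apply, RingEquiv.apply_symm_apply] at this
    simpa only [Nat.div_add_mod] using this

/-- The Frobenius of `𝔖` makes `𝔖` free over itself. -/
instance tw_free : Module.Free (S p F) (Tw p F) :=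
  Module.Free.of_equiv (LinearEquiv.ofBijective (twSum p F) (twSum_bijective p F))

/-- A monic Eisenstein polynomial over `W(F)`. These are the minimal polynomials `E` over `Frac W(F)`
of the uniformizers `π` of the finite totally ramified extensions `K` of `Frac W(F)`; one has
`𝔖/(E) ≃ 𝒪_K` through `u ↦ π`. -/
structure EisensteinPoly where
  poly : Polynomial (WittVector p F)
  monic : poly.Monic
  natDegree_pos : 0 < poly.natDegree
  isEisensteinAt : poly.IsEisensteinAt (Ideal.span {(p : WittVector p F)})

variable {p F} in
/-- `E`, as an element of `𝔖`. -/
noncomputable def EisensteinPoly.toS (E : EisensteinPoly p F) : S p F := (E.poly : S p F)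

/-- `E` is a prime element of `𝔖`. -/
instance (E : EisensteinPoly p F) : (Ideal.span {E.toS}).IsPrime := by
  have hp : (Ideal.span {(p : WittVector p F)}).IsPrime := by
    rw [← WittVector.ker_constantCoeff]
    exact RingHom.ker_isPrime _
  have hirr := E.isEisensteinAt.irreducible hp E.monic.isPrimitive E.natDegree_pos
  have hd : E.poly.IsDistinguishedAt (Ideal.span {(p : WittVector p F)}) :=
    { mem := E.isEisensteinAt.mem, monic := E.monic }
  have hprime : (Ideal.span {E.poly}).IsPrime :=
    (Ideal.span_singleton_prime hirr.ne_zero).2 hirr.prime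
  have : IsDomain (Polynomial (WittVector p F) ⧸ Ideal.span {E.poly}) := inferInstance
  have : IsDomain (S p F ⧸ Ideal.span {(E.poly : S p F)}) :=
    hd.algEquivQuotient.symm.toMulEquiv.isDomain
  exact (Ideal.Quotient.isDomain_iff_prime _).1 this

end Ring

section RelPos

/-- The relative position `ν(L₁, L₂)` of two submodules `L₁`, `L₂` of `V`, the difference of the
lengths of `L₂/(L₁ ∩ L₂)` and `L₁/(L₁ ∩ L₂)` (both lengths are finite in all uses). If `R` is a
discrete valuation ring with uniformizer `π` and `L₁ = ⨁ R e_i`, `L₂ = ⨁ R π^{-a_i} e_i` are lattices,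
then it is `∑ a_i`. If `L₂ ⊆ L₁`, then it is `-length(L₁/L₂)`. -/
noncomputable def relPos {R : Type*} {V : Type*} [CommRing R] [AddCommGroup V] [Module R V]
    (L₁ L₂ : Submodule R V) : ℤ :=
  ((Module.length R (L₂ ⧸ L₁.submoduleOf L₂)).toNat : ℤ) -
    ((Module.length R (L₁ ⧸ L₂.submoduleOf L₁)).toNat : ℤ)

end RelPos

section Modules

variable {p : ℕ} [Fact p.Prime] {F : Type u} [Field F]

section Pullback

variable (p F)
variable (M : Type v) [AddCommGroup M] [Module (S p F) M]

/-- The Frobenius pullback `φ^*M = 𝔖 ⊗_{φ, 𝔖} M`. -/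
def Pullback : Type (max u v) := Tw p F ⊗[S p F] M

noncomputable instance : AddCommGroup (Pullback p F M) :=
  inferInstanceAs (AddCommGroup (Tw p F ⊗[S p F] M))

/-- `𝔖` acts on `φ^*M = 𝔖 ⊗_{φ, 𝔖} M` through the left-hand factor. -/
noncomputable instance : Module (S p F) (Pullback p F M) :=
  inferInstanceAs (Module (Tw p F) (Tw p F ⊗[S p F] M))

variable {p F M} {N P : Type v} [AddCommGroup N] [Module (S p F) N]
  [AddCommGroup P] [Module (S p F) P]

/-- `φ^*f : φ^*M → φ^*N`. -/
noncomputable def Pullback.map (f : M →ₗ[S p F] N) : Pullback p F M →ₗ[S p F] Pullback p F N :=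
  (f.baseChange (Tw p F) : Tw p F ⊗[S p F] M →ₗ[Tw p F] Tw p F ⊗[S p F] N)

theorem Pullback.map_comp (f : M →ₗ[S p F] N) (g : N →ₗ[S p F] P) :
    Pullback.map (g ∘ₗ f) = Pullback.map g ∘ₗ Pullback.map f :=
  LinearMap.baseChange_comp (A := Tw p F) f g

theorem Pullback.map_id : Pullback.map (LinearMap.id : M →ₗ[S p F] M) = LinearMap.id :=
  LinearMap.baseChange_id (A := Tw p F)

theorem Pullback.map_zero : Pullback.map (0 : M →ₗ[S p F] N) = 0 :=
  LinearMap.baseChange_zero (A := Tw p F)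

theorem Pullback.map_add (f g : M →ₗ[S p F] N) :
    Pullback.map (f + g) = Pullback.map f + Pullback.map g :=
  LinearMap.baseChange_add (A := Tw p F) f g

theorem Pullback.map_nsmul (a : ℕ) (f : M →ₗ[S p F] N) :
    Pullback.map (a • f) = a • Pullback.map f := by
  induction a with
  | zero => rw [zero_smul, zero_smul, Pullback.map_zero]
  | succ a ih => rw [succ_nsmul, Pullback.map_add, ih, succ_nsmul]

theorem Pullback.map_coe (f : M →ₗ[S p F] N) :
    (Pullback.map f : Pullback p F M → Pullback p F N) =
      (f.lTensor (Tw p F) : Tw p F ⊗[S p F] M → Tw p F ⊗[S p F] N) := rfl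

theorem Pullback.map_surjective {f : M →ₗ[S p F] N} (hf : Function.Surjective f) :
    Function.Surjective (Pullback.map f) := by
  rw [Pullback.map_coe]
  exact LinearMap.lTensor_surjective (Tw p F) hf

theorem Pullback.map_exact {f : M →ₗ[S p F] N} {g : N →ₗ[S p F] P} (h : Function.Exact f g)
    (hg : Function.Surjective g) : Function.Exact (Pullback.map f) (Pullback.map g) := by
  rw [Pullback.map_coe, Pullback.map_coe]
  exact lTensor_exact (Tw p F) h hg

theorem Pullback.map_injective [CharP F p] [PerfectRing F p] {f : M →ₗ[S p F] N}
    (hf : Function.Injective f) : Function.Injective (Pullback.map f) := by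
  rw [Pullback.map_coe]
  exact Module.Flat.lTensor_preserves_injective_linearMap (M := Tw p F) f hf

end Pullback

section Loc

variable (E : EisensteinPoly p F)

/-- `M[1/E]`. -/
abbrev Loc (M : Type v) [AddCommGroup M] [Module (S p F) M] : Type (max u v) :=
  LocalizedModule (Submonoid.powers E.toS) M

variable {M N P : Type v} [AddCommGroup M] [Module (S p F) M] [AddCommGroup N] [Module (S p F) N]
  [AddCommGroup P] [Module (S p F) P]

/-- `M → M[1/E]`. -/
noncomputable abbrev toLoc (M : Type v) [AddCommGroup M] [Module (S p F) M] : M →ₗ[S p F] Loc E M :=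
  LocalizedModule.mkLinearMap (Submonoid.powers E.toS) M

/-- `f[1/E] : M[1/E] → N[1/E]`. -/
noncomputable def locMap (f : M →ₗ[S p F] N) : Loc E M →ₗ[S p F] Loc E N :=
  IsLocalizedModule.map (Submonoid.powers E.toS) (toLoc E M) (toLoc E N) f

theorem locMap_comp (f : M →ₗ[S p F] N) (g : N →ₗ[S p F] P) :
    locMap E (g ∘ₗ f) = locMap E g ∘ₗ locMap E f :=
  IsLocalizedModule.map_comp' _ _ _ _ f g

theorem locMap_injective {f : M →ₗ[S p F] N} (hf : Function.Injective f) :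
    Function.Injective (locMap E f) :=
  IsLocalizedModule.map_injective _ _ _ f hf

theorem locMap_surjective {f : M →ₗ[S p F] N} (hf : Function.Surjective f) :
    Function.Surjective (locMap E f) :=
  IsLocalizedModule.map_surjective _ _ _ f hf

theorem locMap_exact {f : M →ₗ[S p F] N} {g : N →ₗ[S p F] P} (h : Function.Exact f g) :
    Function.Exact (locMap E f) (locMap E g) :=
  IsLocalizedModule.map_exact _ _ _ _ f g h

/-- `(φ^*f)[1/E] : (φ^*M)[1/E] → (φ^*N)[1/E]`. -/
noncomputable def pullLocMap (f : M →ₗ[S p F] N) :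
    Loc E (Pullback p F M) →ₗ[S p F] Loc E (Pullback p F N) :=
  locMap E (Pullback.map f)

theorem pullLocMap_comp (f : M →ₗ[S p F] N) (g : N →ₗ[S p F] P) :
    pullLocMap E (g ∘ₗ f) = pullLocMap E g ∘ₗ pullLocMap E f := by
  rw [pullLocMap, Pullback.map_comp, locMap_comp]; rfl

end Loc

/-- An object `(M, φ_M)` of `Mod_𝔖^φ`: a finitely generated `𝔖`-module `M` with an isomorphism
`φ_M : (φ^*M)[1/E] ≃ M[1/E]` (an `𝔖`-linear isomorphism between `𝔖[1/E]`-modules is automatically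
`𝔖[1/E]`-linear). -/
structure PhiModule (E : EisensteinPoly p F) where
  carrier : Type v
  [addCommGroup : AddCommGroup carrier]
  [module : Module (S p F) carrier]
  [finite : Module.Finite (S p F) carrier]
  frob : Loc E (Pullback p F carrier) ≃ₗ[S p F] Loc E carrier

namespace PhiModule

attribute [instance] addCommGroup module finite

variable {E : EisensteinPoly p F}

/-- A morphism of `Mod_𝔖^φ`. -/
structure Hom (M N : PhiModule.{u, v} E) where
  toLin : M.carrier →ₗ[S p F] N.carrier
  comm : N.frob.toLinearMap ∘ₗ pullLocMap E toLin = locMap E toLin ∘ₗ M.frob.toLinearMap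

/-- The submodule `N ⊆ M` is a subobject: `φ_M` carries the image of `(φ^*N)[1/E]` in
`(φ^*M)[1/E]` onto the image of `N[1/E]` in `M[1/E]`. -/
def IsSub (M : PhiModule.{u, v} E) (N : Submodule (S p F) M.carrier) : Prop :=
  (LinearMap.range (pullLocMap E N.subtype)).map M.frob.toLinearMap =
    LinearMap.range (locMap E N.subtype)

/-- The range of a morphism is a subobject. -/
theorem Hom.isSub_range {M N : PhiModule.{u, v} E} (f : Hom M N) :
    N.IsSub (LinearMap.range f.toLin) := by
  have hf : f.toLin = (LinearMap.range f.toLin).subtype ∘ₗ f.toLin.rangeRestrict := rfl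
  have h1 : LinearMap.range (pullLocMap E (LinearMap.range f.toLin).subtype) =
      LinearMap.range (pullLocMap E f.toLin) := by
    conv_rhs => rw [hf, pullLocMap_comp]
    exact (LinearMap.range_comp_of_range_eq_top _ (LinearMap.range_eq_top.2
      (locMap_surjective E (Pullback.map_surjective f.toLin.surjective_rangeRestrict)))).symm
  have h2 : LinearMap.range (locMap E (LinearMap.range f.toLin).subtype) =
      LinearMap.range (locMap E f.toLin) := by
    conv_rhs => rw [hf, locMap_comp]
    exact (LinearMap.range_comp_of_range_eq_top _ (LinearMap.range_eq_top.2
      (locMap_surjective E f.toLin.surjective_rangeRestrict))).symm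
  rw [IsSub, h1, h2, ← LinearMap.range_comp, f.comm]
  exact LinearMap.range_comp_of_range_eq_top _ (LinearMap.range_eq_top.2 M.frob.surjective)

/-- Multiplication by `a` as a morphism, for `a : ℕ`. -/
noncomputable def natMul (M : PhiModule.{u, v} E) (a : ℕ) : Hom M M where
  toLin := a • LinearMap.id
  comm := by
    have h1 : pullLocMap E (a • (LinearMap.id : M.carrier →ₗ[S p F] M.carrier)) =
        a • LinearMap.id := by
      rw [pullLocMap, Pullback.map_nsmul, Pullback.map_id, locMap, map_nsmul, IsLocalizedModule.map_id]
    have h2 : locMap E (a • (LinearMap.id : M.carrier →ₗ[S p F] M.carrier)) =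
        a • LinearMap.id := by
      rw [locMap, map_nsmul, IsLocalizedModule.map_id]
    rw [h1, h2]
    ext x
    simp

section Quot

variable (M : PhiModule.{u, v} E) (N : Submodule (S p F) M.carrier)

theorem ker_pullLocMap_mkQ :
    LinearMap.ker (pullLocMap E N.mkQ) = LinearMap.range (pullLocMap E N.subtype) :=
  LinearMap.exact_iff.1 (locMap_exact E
    (Pullback.map_exact (LinearMap.exact_subtype_mkQ N) N.mkQ_surjective))

theorem ker_locMap_mkQ :
    LinearMap.ker (locMap E N.mkQ) = LinearMap.range (locMap E N.subtype) :=
  LinearMap.exact_iff.1 (locMap_exact E (LinearMap.exact_subtype_mkQ N))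

/-- The quotient object `M/N`: the Frobenius is the one induced by `φ_M`. -/
noncomputable def quot (hN : M.IsSub N) : PhiModule.{u, v} E where
  carrier := M.carrier ⧸ N
  frob :=
    ((pullLocMap E N.mkQ).quotKerEquivOfSurjective
      (locMap_surjective E (Pullback.map_surjective N.mkQ_surjective))).symm ≪≫ₗ
    Submodule.Quotient.equiv _ _ M.frob (by
      rw [ker_pullLocMap_mkQ, ker_locMap_mkQ]; exact hN) ≪≫ₗ
    (locMap E N.mkQ).quotKerEquivOfSurjective (locMap_surjective E N.mkQ_surjective)

end Quot

/-- The preimage of a subobject `N ⊆ range f` under an injective morphism `f` is a subobject. -/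
theorem IsSub.comap {A M : PhiModule.{u, v} E} {N : Submodule (S p F) M.carrier} (hN : M.IsSub N)
    (f : Hom A M) (hf : Function.Injective f.toLin) (h : N ≤ LinearMap.range f.toLin) :
    A.IsSub (N.comap f.toLin) := by
  let e : N.comap f.toLin →ₗ[S p F] N := f.toLin.restrict fun _ hx => hx
  have hes : Function.Surjective e := by
    rintro ⟨y, hy⟩
    obtain ⟨x, rfl⟩ := h hy
    exact ⟨⟨x, hy⟩, rfl⟩
  have he : f.toLin ∘ₗ (N.comap f.toLin).subtype = N.subtype ∘ₗ e := rfl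
  have hp : (LinearMap.range (pullLocMap E (N.comap f.toLin).subtype)).map
      (pullLocMap E f.toLin) = LinearMap.range (pullLocMap E N.subtype) := by
    rw [← LinearMap.range_comp, ← pullLocMap_comp, he, pullLocMap_comp]
    exact LinearMap.range_comp_of_range_eq_top _ (LinearMap.range_eq_top.2
      (locMap_surjective E (Pullback.map_surjective hes)))
  have hl : (LinearMap.range (locMap E (N.comap f.toLin).subtype)).map
      (locMap E f.toLin) = LinearMap.range (locMap E N.subtype) := by
    rw [← LinearMap.range_comp, ← locMap_comp, he, locMap_comp]
    exact LinearMap.range_comp_of_range_eq_top _ (LinearMap.range_eq_top.2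
      (locMap_surjective E hes))
  refine Submodule.map_injective_of_injective (locMap_injective E hf) ?_
  rw [hl, ← Submodule.map_comp, ← f.comm, Submodule.map_comp, hp]
  exact hN

section Perfect

variable [CharP F p] [PerfectRing F p]

/-- The subobject `N` as an object: the Frobenius is the restriction of `φ_M`. -/
noncomputable def sub (M : PhiModule.{u, v} E) (N : Submodule (S p F) M.carrier)
    (hN : M.IsSub N) : PhiModule.{u, v} E where
  carrier := N
  frob :=
    LinearEquiv.ofInjective (pullLocMap E N.subtype)
      (locMap_injective E (Pullback.map_injective N.injective_subtype)) ≪≫ₗ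
    M.frob.submoduleMap _ ≪≫ₗ LinearEquiv.ofEq _ _ hN ≪≫ₗ
    (LinearEquiv.ofInjective (locMap E N.subtype)
      (locMap_injective E N.injective_subtype)).symm

/-- The inclusion of a subobject. -/
noncomputable def subHom (M : PhiModule.{u, v} E) (N : Submodule (S p F) M.carrier)
    (hN : M.IsSub N) : Hom (M.sub N hN) M where
  toLin := N.subtype
  comm := by
    refine LinearMap.ext fun x => ?_
    have := congrArg Subtype.val (LinearEquiv.apply_symm_apply
      (LinearEquiv.ofInjective (locMap E N.subtype) (locMap_injective E N.injective_subtype))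
      (LinearEquiv.ofEq _ _ hN (M.frob.submoduleMap _
        (LinearEquiv.ofInjective (pullLocMap E N.subtype)
          (locMap_injective E (Pullback.map_injective N.injective_subtype)) x))))
    exact this.symm

/-- The subquotient `N₂/N₁` of `M`, for subobjects `N₁ ⊆ N₂` of `M`. -/
noncomputable def subquot (M : PhiModule.{u, v} E) (N₁ N₂ : Submodule (S p F) M.carrier)
    (h₁ : M.IsSub N₁) (h₂ : M.IsSub N₂) (h : N₁ ≤ N₂) : PhiModule.{u, v} E :=
  (M.sub N₂ h₂).quot (N₁.comap (M.subHom N₂ h₂).toLin)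
    (h₁.comap (M.subHom N₂ h₂) N₂.injective_subtype (h.trans_eq N₂.range_subtype.symm))

end Perfect

/-- For `a : ℕ`, the quotient `M/aM`. -/
noncomputable def modNat (M : PhiModule.{u, v} E) (a : ℕ) : PhiModule.{u, v} E :=
  M.quot (LinearMap.range (M.natMul a).toLin) (M.natMul a).isSub_range

/-- `M` is a Kisin module, i.e. an object of `Mod_{𝔖,fr}^φ`: the underlying module is free. -/
def IsKisin (M : PhiModule.{u, v} E) : Prop := Module.Free (S p F) M.carrier

/-- `M` is a `p^∞`-torsion Kisin module, i.e. an object of `Mod_{𝔖,t}^φ`: it is killed by a power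
of `p` and has no `u`-torsion. -/
def IsTorsionKisin (M : PhiModule.{u, v} E) : Prop :=
  (∃ n : ℕ, ∀ x : M.carrier, (p : S p F) ^ n • x = 0) ∧
    ∀ x : M.carrier, (PowerSeries.X : S p F) • x = 0 → x = 0

/-- The image of `M` in `M[1/E]`. -/
noncomputable def lattice (M : PhiModule.{u, v} E) : Submodule (S p F) (Loc E M.carrier) :=
  LinearMap.range (toLoc E M.carrier)

/-- The submodule `φ_M(φ^*M)` of `M[1/E]`. -/
noncomputable def frobLattice (M : PhiModule.{u, v} E) : Submodule (S p F) (Loc E M.carrier) :=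
  (LinearMap.range (toLoc E (Pullback p F M.carrier))).map M.frob.toLinearMap

/-- The rank of a `p^∞`-torsion Kisin module, the length of `M/uM` over `W(F)`. (As `u` acts by zero
on `M/uM`, its `W(F)`-submodules are its `𝔖`-submodules, so that the length may be taken
over `𝔖`.) -/
noncomputable def torsionRank (M : PhiModule.{u, v} E) : ℕ :=
  (Module.length (S p F) (M.carrier ⧸
    (Ideal.span {(PowerSeries.X : S p F)} • (⊤ : Submodule (S p F) M.carrier)))).toNat

/-- The degree of a `p^∞`-torsion Kisin module, normalized by `e = deg E`: `1/e` times the relative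
position of `M` and `φ_M(φ^*M)`. It is `-(1/e) length(M/φ_M(φ^*M))` if `φ_M(φ^*M) ⊆ M`, and in
general `(1/e) (i rank(M) - length(M/u^i φ_M(φ^*M)))` for all large `i`. -/
noncomputable def torsionDeg (M : PhiModule.{u, v} E) : ℚ :=
  (relPos M.lattice M.frobLattice : ℚ) / E.poly.natDegree

/-- The slope of a nonzero `p^∞`-torsion Kisin module. -/
noncomputable def torsionSlope (M : PhiModule.{u, v} E) : ℚ := M.torsionDeg / M.torsionRank

/-- `f` is an isogeny: its kernel and its cokernel are killed by a power of `p`. -/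
def Hom.IsIsogeny {M N : PhiModule.{u, v} E} (f : Hom M N) : Prop :=
  ∃ n : ℕ, (∀ x : M.carrier, f.toLin x = 0 → (p : S p F) ^ n • x = 0) ∧
    ∀ y : N.carrier, ∃ x : M.carrier, f.toLin x = (p : S p F) ^ n • y

/-- `M` and `N` are isogenous: there is an isogeny between them. -/
def IsIsogenous (M N : PhiModule.{u, v} E) : Prop := ∃ f : Hom M N, f.IsIsogeny

section Semistable

variable [CharP F p] [PerfectRing F p]

/-- The degree `ν(M_(E), φ_M(φ^*M)_(E))` of a Kisin module: the relative position of the two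
`𝔖_(E)`-lattices generated by `M` and by `φ_M(φ^*M)` in `M[1/E]_(E)`, where `𝔖_(E)` is
the localization of `𝔖` at the prime ideal `(E)`, a discrete valuation ring. -/
noncomputable def deg (M : PhiModule.{u, v} E) : ℤ :=
  relPos (M.lattice.localized (Ideal.span {E.toS}).primeCompl)
    (M.frobLattice.localized (Ideal.span {E.toS}).primeCompl)

/-- The rank of a Kisin module. -/
noncomputable def rank (M : PhiModule.{u, v} E) : ℕ := Module.finrank (S p F) M.carrier

/-- The slope `μ_M = deg M / rank M` of a nonzero Kisin module. -/
noncomputable def slope (M : PhiModule.{u, v} E) : ℚ := M.deg / M.rank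

/-- Semi-stability in the quasi-abelian category `Mod_{𝔖,t}^φ`: `M` is nonzero, and every nonzero
strict subobject `N` has slope at most that of `M`. The strict subobjects are the subobjects
`N` for which `M/N` has no `u`-torsion. -/
def IsTorsionSemistable (M : PhiModule.{u, v} E) : Prop :=
  M.IsTorsionKisin ∧ Nontrivial M.carrier ∧
    ∀ (N : Submodule (S p F) M.carrier) (hN : M.IsSub N),
      (∀ x : M.carrier, (PowerSeries.X : S p F) • x ∈ N → x ∈ N) → N ≠ ⊥ →
        (M.sub N hN).torsionSlope ≤ M.torsionSlope

/-- A Kisin module `M` is semi-stable if `M/pM` is semi-stable as a torsion Kisin module. -/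
def IsSemistable (M : PhiModule.{u, v} E) : Prop :=
  M.IsKisin ∧ (M.modNat p).IsTorsionSemistable

/-- A Kisin module `M` is HN-type: it has a flag `0 = M₀ ⊂ M₁ ⊂ ⋯ ⊂ M_r = M` of Kisin submodules
such that the `M_{i+1}/M_i` are free and semi-stable, of slopes `μ₁ > ⋯ > μ_r`. -/
def IsHNType (M : PhiModule.{u, v} E) : Prop :=
  M.IsKisin ∧
  ∃ (r : ℕ) (fil : Fin (r + 1) → Submodule (S p F) M.carrier) (hsub : ∀ i, M.IsSub (fil i))
    (μ : Fin r → ℚ),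
    fil 0 = ⊥ ∧ fil (Fin.last r) = ⊤ ∧
    (∀ i, (M.sub (fil i) (hsub i)).IsKisin) ∧
    (∀ i : Fin r, ∃ h : fil i.castSucc ≤ fil i.succ,
      (M.subquot (fil i.castSucc) (fil i.succ) (hsub _) (hsub _) h).IsKisin ∧
      (M.subquot (fil i.castSucc) (fil i.succ) (hsub _) (hsub _) h).IsSemistable ∧
      (M.subquot (fil i.castSucc) (fil i.succ) (hsub _) (hsub _) h).slope = μ i) ∧
    StrictAnti μ

end Semistable

end PhiModule
end Modules
end Kisin

/-!
# Kisin modules are isogenous to HN-type ones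

The argument is Langton's method of elementary modifications, applied `p`-adically. Everything is
measured modulo `p`. For subobjects `A ⊆ B` of a fixed object `M` such that `B/A` is killed by `p`
and has no `u`-torsion (`ModPPair`), `pairRank` and `pairDeg` are the rank and `e * deg` of `B/A`.
Both are additive, since they come from lengths of lattices in `M[1/E]`; and since `φ` multiplies
lengths by `p` (`length_pullback`), saturating a subobject with respect to `u` keeps the rank and
can only raise the degree (`IsModP.eDeg_of_isTorsion`). Hence slopes of subobjects are bounded, and
the subobjects of a nonzero `B/A` contain one, saturated, for which (slope, rank) is
lexicographically maximal (`IsMaxDest`, `ModPPair.exists_isMaxDest`).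

A Kisin module is the same thing as an object on which `p, u` is a regular sequence (`IsRegular`,
`IsKisin.isRegular`, `IsRegular.isKisin`), because `p, u` generate the maximal ideal of `𝔖`. Its
rank is that of its reduction modulo `p` and so is its degree (`IsKisin.slope_eq`): for a finite `Q`
killed by a power of `E` and without `p`-torsion, the length of `Q/pQ` is `e` times the length of
`Q_(E)` (`LengthFormula`), by dévissage to modules over the discrete valuation ring `𝔖/(E)`, in
which `p` is a unit times the `e`-th power of the uniformizer `u`.

Let `B/pM` be the maximal destabilizing subobject of `M/pM`, of slope `μ` and rank `ρ`. The
modification `B ⊆ M` is isogenous to `M`, of the same rank and degree, and `B/pB` is an extension of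
`B/pM` by `M/B`, whose subobjects have slopes less than `μ`. So the pair `(μ', ρ')` for `B` is at
most `(μ, ρ)`, and in the case of equality the maximal destabilizing subobject of `B/pB` splits this
extension (`IsMaxDest.next_lex`). If `(μ, ρ)` can be lowered on a saturated subobject isogenous to
`M`, with the same rank and degree, then `M` is replaced by that; since the slopes are bounded below
by the slope of `M/pM` and have bounded denominators, this happens finitely often
(`hasHNFlag_of_lt`). Otherwise the modifications form an infinite chain with the splitting property,
and by `p`-adic completeness their intersection `N` is a subobject with `M/N` without `p`-torsion
that lifts the maximal destabilizing subobject: `N + pM = B` (`chain_limit`,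
`IsMaxDest.exists_limit`). Then `N` is semi-stable of slope `μ` (`IsMaxDest.semistablePair`), while
`M/N` is a Kisin module of smaller rank with all slopes of subobjects modulo `p` less than `μ`
(`IsMaxDest.quot_pair`). By induction on the rank, `M/N` contains an isogenous subobject with a
Harder–Narasimhan flag of slopes less than `μ`; its preimage in `M`, with `N` as first step, is the
object sought. The isogeny from `M` is the multiplication by a power of `p`.
-/

open scoped Pointwise

/-! ### Relative lengths and relative positions of submodules -/

namespace Kisin

section RelLen

variable {R V V' V'' : Type*} [CommRing R] [AddCommGroup V] [Module R V]
  [AddCommGroup V'] [Module R V'] [AddCommGroup V''] [Module R V'']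

/-- The length of `B / (A ∩ B)`, for two submodules `A`, `B` of a module, as an extended natural
number. -/
noncomputable def relLen (A B : Submodule R V) : ℕ∞ := Module.length R (B ⧸ A.submoduleOf B)

theorem relPos_def (A B : Submodule R V) :
    relPos A B = ((relLen A B).toNat : ℤ) - ((relLen B A).toNat : ℤ) := rfl

theorem relLen_eq_length_map_mkQ (A B : Submodule R V) :
    relLen A B = Module.length R (B.map A.mkQ) := by
  let f : B →ₗ[R] V ⧸ A := A.mkQ ∘ₗ B.subtype
  have hk : LinearMap.ker f = A.submoduleOf B := by
    rw [LinearMap.ker_comp, Submodule.ker_mkQ]; rfl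
  have hr : LinearMap.range f = B.map A.mkQ := by
    rw [LinearMap.range_comp, Submodule.range_subtype]
  rw [relLen, ← hk, ← hr]
  exact f.quotKerEquivRange.length_eq

theorem relLen_eq_zero {A B : Submodule R V} : relLen A B = 0 ↔ B ≤ A := by
  rw [relLen, Module.length_eq_zero_iff, Submodule.Quotient.subsingleton_iff,
    Submodule.submoduleOf, Submodule.comap_subtype_eq_top]

theorem relLen_inf_left (A B : Submodule R V) : relLen (A ⊓ B) B = relLen A B := by
  have : (A ⊓ B).submoduleOf B = A.submoduleOf B := by
    ext x; simp [Submodule.submoduleOf]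
  rw [relLen, this, relLen]

theorem relLen_top (A : Submodule R V) : relLen A ⊤ = Module.length R (V ⧸ A) := by
  rw [relLen_eq_length_map_mkQ, Submodule.map_top, Submodule.range_mkQ, Module.length_top]

/-- Length of subquotients is additive along an exact sequence `0 → V' → V → V''`. -/
theorem relLen_of_exact {f : V' →ₗ[R] V} {g : V →ₗ[R] V''}
    (h : Function.Exact f g) {A B : Submodule R V} (hAB : A ≤ B) :
    relLen A B = relLen (A.comap f) (B.comap f) + relLen (A.map g) (B.map g) := by
  let i : (B.comap f) →ₗ[R] B := f.restrict fun _ hx => hx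
  let q : B →ₗ[R] (B.map g) := g.restrict fun _ hx => Submodule.mem_map_of_mem hx
  have hq : Function.Surjective q := by
    rintro ⟨_, x, hx, rfl⟩
    exact ⟨⟨x, hx⟩, rfl⟩
  have hi' : (A.comap f).submoduleOf (B.comap f) = (A.submoduleOf B).comap i := rfl
  refine Module.length_eq_add_of_exact
    (Submodule.mapQ ((A.comap f).submoduleOf (B.comap f)) (A.submoduleOf B) i hi'.le)
    (Submodule.mapQ (A.submoduleOf B) ((A.map g).submoduleOf (B.map g)) q
      fun _ hx => Submodule.mem_map_of_mem hx) ?_ ?_ ?_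
  · rw [← LinearMap.ker_eq_bot, Submodule.mapQ, Submodule.ker_liftQ, LinearMap.ker_comp,
      Submodule.ker_mkQ, ← hi', Submodule.mkQ_map_self]
  · rintro ⟨y⟩
    obtain ⟨x, rfl⟩ := hq y
    exact ⟨Submodule.Quotient.mk x, rfl⟩
  · rintro ⟨⟨x, hx⟩⟩
    constructor
    · intro hx0
      obtain ⟨a, ha, hga⟩ := (Submodule.Quotient.mk_eq_zero _).1 hx0
      have hga : g a = g x := hga
      obtain ⟨y, hy⟩ := (h (x - a)).1 (by rw [map_sub, hga, sub_self])
      have hyB : y ∈ B.comap f := by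
        rw [Submodule.mem_comap, hy]; exact B.sub_mem hx (hAB ha)
      refine ⟨Submodule.Quotient.mk ⟨y, hyB⟩, (Submodule.Quotient.eq _).2 ?_⟩
      change f y - x ∈ A
      rw [hy]
      simpa using ha
    · rintro ⟨⟨y, hy⟩, hyx⟩
      have : f y - x ∈ A := (Submodule.Quotient.eq (A.submoduleOf B) (x := i ⟨y, hy⟩)).1 hyx
      refine (Submodule.Quotient.mk_eq_zero _).2 ⟨x - f y, ?_, ?_⟩
      · rw [← neg_sub]; exact A.neg_mem this
      · rw [map_sub, h.apply_apply_eq_zero, sub_zero]; rfl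

theorem relLen_add {A B C : Submodule R V} (hAB : A ≤ B) (hBC : B ≤ C) :
    relLen A C = relLen A B + relLen B C := by
  let i : B →ₗ[R] C := Submodule.inclusion hBC
  have hi' : A.submoduleOf B = (A.submoduleOf C).comap i := rfl
  have hAC : A.submoduleOf C ≤ B.submoduleOf C := fun _ hx => hAB hx
  refine Module.length_eq_add_of_exact
    (Submodule.mapQ (A.submoduleOf B) (A.submoduleOf C) i hi'.le)
    (Submodule.factor hAC) ?_ (Submodule.factor_surjective hAC) ?_
  · rw [← LinearMap.ker_eq_bot, Submodule.mapQ, Submodule.ker_liftQ, LinearMap.ker_comp,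
      Submodule.ker_mkQ, ← hi', Submodule.mkQ_map_self]
  · rintro ⟨x⟩
    constructor
    · intro hx
      exact ⟨Submodule.Quotient.mk ⟨x, (Submodule.Quotient.mk_eq_zero (B.submoduleOf C)).1 hx⟩, rfl⟩
    · rintro ⟨⟨y⟩, hy⟩
      rw [← hy]
      exact (Submodule.Quotient.mk_eq_zero (B.submoduleOf C)).2 y.2

theorem relLen_le_of_le_left {A A' B : Submodule R V} (h : A ≤ A') : relLen A' B ≤ relLen A B := by
  rw [← relLen_inf_left A, ← relLen_inf_left A',
    relLen_add (inf_le_inf_right B h) (inf_le_right : A' ⊓ B ≤ B)]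
  exact le_add_self

theorem relLen_map_of_injective {f : V' →ₗ[R] V} (hf : Function.Injective f)
    {A B : Submodule R V'} (h : A ≤ B) : relLen (A.map f) (B.map f) = relLen A B := by
  rw [relLen_of_exact (LinearMap.exact_map_mkQ_range f) (Submodule.map_mono h),
    Submodule.comap_map_eq_of_injective hf, Submodule.comap_map_eq_of_injective hf]
  have : relLen ((A.map f).map (LinearMap.range f).mkQ) ((B.map f).map (LinearMap.range f).mkQ) =
      0 := by
    rw [relLen_eq_zero, ← Submodule.map_comp, LinearMap.range_mkQ_comp, Submodule.map_zero]
    exact bot_le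
  rw [this, add_zero]

theorem relLen_map_mkQ {N A B : Submodule R V} (hN : N ≤ A) (h : A ≤ B) :
    relLen (A.map N.mkQ) (B.map N.mkQ) = relLen A B := by
  rw [relLen_of_exact (LinearMap.exact_subtype_mkQ N) h]
  have : relLen (A.comap N.subtype) (B.comap N.subtype) = 0 := by
    rw [relLen_eq_zero]
    exact fun x _ => hN x.2
  rw [this, zero_add]

/-- The relative position can be computed from any common submodule of finite colength. -/
theorem relPos_eq {L₀ L₁ L₂ : Submodule R V} (h₁ : L₀ ≤ L₁) (h₂ : L₀ ≤ L₂)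
    (f₁ : relLen L₀ L₁ ≠ ⊤) (f₂ : relLen L₀ L₂ ≠ ⊤) :
    relPos L₁ L₂ = ((relLen L₀ L₂).toNat : ℤ) - ((relLen L₀ L₁).toNat : ℤ) := by
  have e₁ := relLen_add (le_inf h₁ h₂) (inf_le_left : L₁ ⊓ L₂ ≤ L₁)
  have e₂ := relLen_add (le_inf h₁ h₂) (inf_le_right : L₁ ⊓ L₂ ≤ L₂)
  rw [relPos_def, ← relLen_inf_left L₁ L₂, ← relLen_inf_left L₂ L₁, inf_comm L₂ L₁]
  rw [e₁, ne_eq, ENat.add_eq_top, not_or] at f₁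
  rw [e₂, ne_eq, ENat.add_eq_top, not_or] at f₂
  rw [e₁, e₂, ENat.toNat_add f₁.1 f₁.2, ENat.toNat_add f₂.1 f₂.2]
  push_cast
  ring

theorem relLen_smul {a : R} (ha : ∀ x : V, a • x = 0 → x = 0) {A B : Submodule R V} (h : A ≤ B) :
    relLen (a • A) (a • B) = relLen A B :=
  relLen_map_of_injective (f := DistribSMul.toLinearMap R V a)
    ((injective_iff_map_eq_zero _).2 ha) h

theorem smul_le_self (a : R) (A : Submodule R V) : a • A ≤ A := by
  rintro _ ⟨x, hx, rfl⟩
  exact A.smul_mem a hx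

theorem smul_mono (a : R) {A B : Submodule R V} (h : A ≤ B) : a • A ≤ a • B :=
  Submodule.map_mono h

theorem relLen_pow_smul {a : R} (ha : ∀ x : V, a • x = 0 → x = 0) (n : ℕ) (A : Submodule R V) :
    relLen (a ^ n • A) A = n * relLen (a • A) A := by
  induction n with
  | zero => simp [relLen_eq_zero]
  | succ n ih =>
    rw [relLen_add (B := a • A) _ (smul_le_self a A), pow_succ', mul_smul,
      relLen_smul ha (smul_le_self _ A), ih]
    · push_cast
      ring
    · rw [pow_succ', mul_smul]
      exact smul_mono a (smul_le_self _ A)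

theorem relPos_map_of_injective {f : V' →ₗ[R] V} (hf : Function.Injective f)
    (A B : Submodule R V') : relPos (A.map f) (B.map f) = relPos A B := by
  rw [relPos_def, relPos_def, ← relLen_inf_left, ← relLen_inf_left (B.map f),
    ← Submodule.map_inf f hf, ← Submodule.map_inf f hf, relLen_map_of_injective hf inf_le_right,
    relLen_map_of_injective hf inf_le_right, relLen_inf_left, relLen_inf_left]

/-- The relative position is additive along an exact sequence `0 → V' → V → V''`. -/
theorem relPos_of_exact {f : V' →ₗ[R] V} {g : V →ₗ[R] V''} (h : Function.Exact f g)
    {L₀ L₁ L₂ : Submodule R V} (h₁ : L₀ ≤ L₁) (h₂ : L₀ ≤ L₂)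
    (f₁ : relLen L₀ L₁ ≠ ⊤) (f₂ : relLen L₀ L₂ ≠ ⊤) :
    relPos L₁ L₂ = relPos (L₁.comap f) (L₂.comap f) + relPos (L₁.map g) (L₂.map g) := by
  have e₁ := relLen_of_exact h h₁
  have e₂ := relLen_of_exact h h₂
  have f₁' := f₁
  have f₂' := f₂
  rw [e₁, ne_eq, ENat.add_eq_top, not_or] at f₁'
  rw [e₂, ne_eq, ENat.add_eq_top, not_or] at f₂'
  rw [relPos_eq h₁ h₂ f₁ f₂, e₁, e₂, ENat.toNat_add f₁'.1 f₁'.2, ENat.toNat_add f₂'.1 f₂'.2,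
    relPos_eq (Submodule.comap_mono h₁) (Submodule.comap_mono h₂) f₁'.1 f₂'.1,
    relPos_eq (Submodule.map_mono h₁) (Submodule.map_mono h₂) f₁'.2 f₂'.2]
  push_cast
  ring

end RelLen
end Kisin

/-! ### The ring `𝔖` and the element `E` -/

namespace Kisin

section FrobeniusRing

variable {p : ℕ} [Fact p.Prime] {F : Type u} [Field F]

theorem frobS_X : frobS p F PowerSeries.X = PowerSeries.X ^ p := by
  simp [frobS, PowerSeries.map_X]

variable (E : EisensteinPoly p F)

theorem natCast_dvd_of_coeff {a : ℕ} {f : S p F}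
    (h : ∀ n, (a : WittVector p F) ∣ PowerSeries.coeff n f) : (a : S p F) ∣ f := by
  choose g hg using h
  refine ⟨PowerSeries.mk g, ?_⟩
  ext n : 1
  rw [hg, ← map_natCast (PowerSeries.C (R := WittVector p F)), PowerSeries.coeff_C_mul,
    PowerSeries.coeff_mk]

/-- Modulo `p`, the element `E` is `u ^ e`. -/
theorem EisensteinPoly.toS_eq :
    ∃ g : S p F, E.toS = PowerSeries.X ^ E.poly.natDegree + (p : S p F) * g := by
  have : (p : S p F) ∣ E.toS - PowerSeries.X ^ E.poly.natDegree := by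
    refine natCast_dvd_of_coeff fun n => ?_
    rw [map_sub, EisensteinPoly.toS, Polynomial.coeff_coe, PowerSeries.coeff_X_pow]
    rcases lt_trichotomy n E.poly.natDegree with h | h | h
    · rw [if_neg h.ne, sub_zero]
      exact Ideal.mem_span_singleton.1 (E.isEisensteinAt.mem h)
    · rw [if_pos h, h, E.monic.coeff_natDegree, sub_self]; exact dvd_zero _
    · rw [if_neg h.ne', Polynomial.coeff_eq_zero_of_natDegree_lt h, sub_zero]; exact dvd_zero _
  obtain ⟨g, hg⟩ := this
  exact ⟨g, by rw [← hg]; ring⟩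

end FrobeniusRing

/-! ### Modules without `u`-torsion -/

section Torsion

variable {p : ℕ} [Fact p.Prime] {F : Type u} [Field F]
variable {M : Type v} [AddCommGroup M] [Module (S p F) M]

variable (M) in
/-- The module `M` has no `u`-torsion. -/
def UTorsionFree : Prop := ∀ x : M, (PowerSeries.X : S p F) • x = 0 → x = 0

theorem UTorsionFree.pow {M : Type v} [AddCommGroup M] [Module (S p F) M]
    (h : UTorsionFree (p := p) (F := F) M) (n : ℕ) {x : M}
    (hx : (PowerSeries.X : S p F) ^ n • x = 0) : x = 0 := by
  induction n with
  | zero => simpa using hx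
  | succ n ih =>
    rw [pow_succ', mul_smul] at hx
    exact ih (h _ hx)

variable (E : EisensteinPoly p F)

/-- On elements killed by `p`, the action of `E` is that of `u ^ e`. -/
theorem toS_pow_smul {x : M} (hx : (p : S p F) • x = 0) (k : ℕ) :
    E.toS ^ k • x = (PowerSeries.X : S p F) ^ (E.poly.natDegree * k) • x := by
  obtain ⟨g, hg⟩ := E.toS_eq
  have h1 : ∀ y : M, (p : S p F) • y = 0 →
      E.toS • y = (PowerSeries.X : S p F) ^ E.poly.natDegree • y := by
    intro y hy
    rw [hg, add_smul, mul_comm, mul_smul, hy, smul_zero, add_zero]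
  induction k with
  | zero => simp
  | succ k ih =>
    rw [pow_succ', mul_smul, ih, h1 _ (by rw [smul_comm, hx, smul_zero]), smul_smul]
    congr 1
    ring

theorem UTorsionFree.eq_zero_of_toS_smul (h : UTorsionFree (p := p) (F := F) M) {n : ℕ}
    {x : M} (hx : (p : S p F) ^ n • x = 0) (hE : E.toS • x = 0) : x = 0 := by
  induction n generalizing x with
  | zero => simpa using hx
  | succ n ih =>
    refine ih (h.pow E.poly.natDegree ?_) hE
    have h0 : (p : S p F) • (p : S p F) ^ n • x = 0 := by rw [smul_smul, ← pow_succ', hx]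
    have := toS_pow_smul E h0 1
    rw [pow_one, mul_one] at this
    rw [← this, smul_comm, hE, smul_zero]

/-- A module killed by a power of `p` and without `u`-torsion embeds into its localization at `E`.
-/
theorem toLoc_injective (h : UTorsionFree (p := p) (F := F) M)
    {n : ℕ} (hp : ∀ x : M, (p : S p F) ^ n • x = 0) : Function.Injective (toLoc E M) := by
  rw [injective_iff_map_eq_zero]
  intro x hx
  obtain ⟨⟨_, k, rfl⟩, hk'⟩ := (IsLocalizedModule.eq_zero_iff (Submonoid.powers E.toS) _).1 hx
  have hk : E.toS ^ k • x = 0 := hk'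
  clear hk' hx
  induction k with
  | zero => simpa using hk
  | succ k ih =>
    rw [pow_succ', mul_smul] at hk
    exact ih (h.eq_zero_of_toS_smul E (hp _) hk)

end Torsion

/-! ### The Frobenius pullback -/

section Pullback

variable {p : ℕ} [Fact p.Prime] {F : Type u} [Field F]
variable {M : Type v} [AddCommGroup M] [Module (S p F) M]

instance [Module.Finite (S p F) M] : Module.Finite (S p F) (Pullback p F M) :=
  inferInstanceAs (Module.Finite (Tw p F) (Tw p F ⊗[S p F] M))

instance [Module.Free (S p F) M] : Module.Free (S p F) (Pullback p F M) :=
  inferInstanceAs (Module.Free (Tw p F) (Tw p F ⊗[S p F] M))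

theorem Pullback.map_smul_id (a : S p F) :
    Pullback.map (a • (LinearMap.id : M →ₗ[S p F] M)) = frobS p F a • LinearMap.id := by
  refine LinearMap.ext fun t => ?_
  have h : LinearMap.baseChange (Tw p F) (a • (LinearMap.id : M →ₗ[S p F] M)) =
      a • LinearMap.id := by
    rw [LinearMap.baseChange_smul, LinearMap.baseChange_id]
  exact (LinearMap.congr_fun h t).trans
    (algebraMap_smul (M := Tw p F ⊗[S p F] M) (Tw p F) a t).symm

/-- The Frobenius pullback is Frobenius-semilinear on morphisms. -/
theorem Pullback.map_smul {N : Type v} [AddCommGroup N] [Module (S p F) N] (a : S p F)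
    (f : M →ₗ[S p F] N) : Pullback.map (a • f) = frobS p F a • Pullback.map f := by
  rw [← LinearMap.comp_id (a • f), LinearMap.smul_comp, ← LinearMap.comp_smul, Pullback.map_comp,
    Pullback.map_smul_id, LinearMap.comp_smul, LinearMap.comp_id]

theorem Pullback.natCast_smul_eq_zero {a : ℕ} (h : ∀ x : M, (a : S p F) • x = 0)
    (t : Pullback p F M) : (a : S p F) • t = 0 := by
  have h0 : (a : S p F) • (LinearMap.id : M →ₗ[S p F] M) = 0 := LinearMap.ext h
  have := Pullback.map_smul_id (M := M) (a : S p F)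
  rw [h0, Pullback.map_zero, map_natCast] at this
  exact (LinearMap.congr_fun this t).symm

variable [CharP F p] [PerfectRing F p]

/-- The Frobenius pullback preserves the absence of `u`-torsion, as `φ` is flat and `φ(u) = u ^ p`.
-/
theorem UTorsionFree.pullback (h : UTorsionFree (p := p) (F := F) M) :
    UTorsionFree (p := p) (F := F) (Pullback p F M) := by
  intro t ht
  have hinj : Function.Injective ((PowerSeries.X : S p F) • (LinearMap.id : M →ₗ[S p F] M)) :=
    (injective_iff_map_eq_zero _).2 h
  have h2 := Pullback.map_injective hinj
  rw [Pullback.map_smul_id, injective_iff_map_eq_zero] at h2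
  apply h2
  obtain ⟨k, hk⟩ := Nat.exists_eq_succ_of_ne_zero (Fact.out : p.Prime).ne_zero
  have h3 : ((PowerSeries.X : S p F) ^ p) • t = 0 := by
    conv_lhs => arg 1; arg 2; rw [hk]
    rw [pow_succ, mul_smul, ht, smul_zero]
  rw [LinearMap.smul_apply, frobS_X]
  exact h3

end Pullback

end Kisin

/-! ### Morphisms and subobjects -/

namespace Kisin
namespace PhiModule

variable {p : ℕ} [Fact p.Prime] {F : Type u} [Field F] {E : EisensteinPoly p F}

theorem locMap_toLoc {M N : Type v} [AddCommGroup M] [Module (S p F) M] [AddCommGroup N]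
    [Module (S p F) N] (f : M →ₗ[S p F] N) (x : M) :
    locMap E f (toLoc E M x) = toLoc E N (f x) :=
  IsLocalizedModule.map_apply _ _ _ f x

variable {M N P X Y Z : PhiModule.{u, v} E}

theorem Hom.comm_apply (f : Hom M N) (t : Loc E (Pullback p F M.carrier)) :
    N.frob (pullLocMap E f.toLin t) = locMap E f.toLin (M.frob t) :=
  LinearMap.congr_fun f.comm t

/-- The composition of two morphisms. -/
noncomputable def Hom.comp (g : Hom N P) (f : Hom M N) : Hom M P where
  toLin := g.toLin ∘ₗ f.toLin
  comm := by
    refine LinearMap.ext fun t => ?_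
    rw [pullLocMap_comp, locMap_comp]
    change P.frob (pullLocMap E g.toLin (pullLocMap E f.toLin t)) =
      locMap E g.toLin (locMap E f.toLin (M.frob t))
    rw [g.comm_apply, f.comm_apply]

/-- A linear map whose composition with an injective morphism is a morphism is itself a
morphism. -/
noncomputable def Hom.ofCompLeft (f : M.carrier →ₗ[S p F] N.carrier) (g : Hom N P) (h : Hom M P)
    (hg : Function.Injective g.toLin) (e : h.toLin = g.toLin ∘ₗ f) : Hom M N where
  toLin := f
  comm := by
    refine LinearMap.ext fun t => locMap_injective E hg ?_
    have h1 := h.comm_apply t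
    rw [e, pullLocMap_comp, locMap_comp] at h1
    change locMap E g.toLin (N.frob (pullLocMap E f t)) =
      locMap E g.toLin (locMap E f (M.frob t))
    rw [← g.comm_apply]
    exact h1

/-- A linear map whose composition with a surjective morphism is a morphism is itself a
morphism. -/
noncomputable def Hom.ofCompRight (f : Hom M N) (g : N.carrier →ₗ[S p F] P.carrier) (h : Hom M P)
    (hf : Function.Surjective f.toLin) (e : h.toLin = g ∘ₗ f.toLin) : Hom N P where
  toLin := g
  comm := by
    refine LinearMap.ext fun t => ?_
    obtain ⟨t, rfl⟩ := locMap_surjective E (Pullback.map_surjective hf) t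
    have h1 := h.comm_apply t
    rw [e, pullLocMap_comp, locMap_comp] at h1
    refine h1.trans ?_
    change locMap E g (locMap E f.toLin (M.frob t)) = locMap E g (N.frob (pullLocMap E f.toLin t))
    rw [f.comm_apply]

/-- The projection onto a quotient. -/
noncomputable def mkQHom (M : PhiModule.{u, v} E) (N : Submodule (S p F) M.carrier)
    (hN : M.IsSub N) : Hom M (M.quot N hN) where
  toLin := N.mkQ
  comm := by
    refine LinearMap.ext fun t => ?_
    have h := (pullLocMap E N.mkQ).quotKerEquivOfSurjective_symm_apply
      (locMap_surjective E (Pullback.map_surjective N.mkQ_surjective)) t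
    change ((locMap E N.mkQ).quotKerEquivOfSurjective (locMap_surjective E N.mkQ_surjective))
      (Submodule.Quotient.equiv _ _ M.frob (by rw [ker_pullLocMap_mkQ, ker_locMap_mkQ]; exact hN)
        (((pullLocMap E N.mkQ).quotKerEquivOfSurjective
        (locMap_surjective E (Pullback.map_surjective N.mkQ_surjective))).symm
          (pullLocMap E N.mkQ t))) = locMap E N.mkQ (M.frob t)
    rw [h]
    rfl

/-- The morphism induced on a quotient. -/
noncomputable def Hom.liftQ (f : Hom M P) (N : Submodule (S p F) M.carrier) (hN : M.IsSub N)
    (h : N ≤ LinearMap.ker f.toLin) : Hom (M.quot N hN) P :=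
  Hom.ofCompRight (M.mkQHom N hN) (N.liftQ f.toLin h) f N.mkQ_surjective
    (N.liftQ_mkQ f.toLin h).symm

theorem isSub_bot (M : PhiModule.{u, v} E) : M.IsSub ⊥ := by
  have := (M.natMul 0).isSub_range
  rwa [show (M.natMul 0).toLin = 0 from zero_smul _ _, LinearMap.range_zero] at this

theorem isSub_top (M : PhiModule.{u, v} E) : M.IsSub ⊤ := by
  have := (M.natMul 1).isSub_range
  rwa [show (M.natMul 1).toLin = LinearMap.id from one_smul _ _, LinearMap.range_id] at this

theorem natMul_apply (M : PhiModule.{u, v} E) (a : ℕ) (x : M.carrier) :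
    (M.natMul a).toLin x = (a : S p F) • x := by
  change a • x = _
  rw [Nat.cast_smul_eq_nsmul]

theorem map_natMul (M : PhiModule.{u, v} E) (a : ℕ) (A : Submodule (S p F) M.carrier) :
    A.map (M.natMul a).toLin = (a : S p F) • A := by
  ext x
  simp only [Submodule.mem_map, Submodule.mem_smul_pointwise_iff_exists, natMul_apply]

theorem range_natMul (M : PhiModule.{u, v} E) (a : ℕ) :
    LinearMap.range (M.natMul a).toLin = (a : S p F) • ⊤ := by
  rw [LinearMap.range_eq_map, map_natMul]

/-- Two quotients of the same object by the same subobject are isomorphic. -/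
theorem exists_bijective_of_ker_eq (f : Hom P X) (g : Hom P Y) (hf : Function.Surjective f.toLin)
    (hg : Function.Surjective g.toLin) (h : LinearMap.ker f.toLin = LinearMap.ker g.toLin) :
    ∃ i : Hom X Y, Function.Bijective i.toLin ∧ i.toLin ∘ₗ f.toLin = g.toLin := by
  let e : X.carrier ≃ₗ[S p F] Y.carrier :=
    (f.toLin.quotKerEquivOfSurjective hf).symm ≪≫ₗ Submodule.quotEquivOfEq _ _ h ≪≫ₗ
      g.toLin.quotKerEquivOfSurjective hg
  have he : e.toLinearMap ∘ₗ f.toLin = g.toLin := by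
    refine LinearMap.ext fun x => ?_
    have h0 := f.toLin.quotKerEquivOfSurjective_symm_apply hf x
    change g.toLin.quotKerEquivOfSurjective hg (Submodule.quotEquivOfEq _ _ h
      ((f.toLin.quotKerEquivOfSurjective hf).symm (f.toLin x))) = _
    rw [h0]
    rfl
  exact ⟨Hom.ofCompRight f e.toLinearMap g hf he.symm, e.bijective, he⟩

section Perfect

variable [CharP F p] [PerfectRing F p]

/-- The kernel of a morphism is a subobject; this uses the flatness of `φ`. -/
theorem Hom.isSub_ker (f : Hom M N) : M.IsSub (LinearMap.ker f.toLin) := by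
  have h1 : LinearMap.range (pullLocMap E (LinearMap.ker f.toLin).subtype) =
      LinearMap.ker (pullLocMap E f.toLin) := by
    have hf : f.toLin = (LinearMap.range f.toLin).subtype ∘ₗ f.toLin.rangeRestrict := rfl
    have hex : Function.Exact (LinearMap.ker f.toLin).subtype f.toLin.rangeRestrict := by
      rw [LinearMap.exact_iff, LinearMap.ker_rangeRestrict, Submodule.range_subtype]
    conv_rhs => rw [hf, pullLocMap_comp]
    rw [LinearMap.ker_comp_of_ker_eq_bot]
    · exact (LinearMap.exact_iff.1 (locMap_exact E
        (Pullback.map_exact hex f.toLin.surjective_rangeRestrict))).symm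
    · exact LinearMap.ker_eq_bot.2
        (locMap_injective E (Pullback.map_injective (Submodule.injective_subtype _)))
  have h2 : LinearMap.range (locMap E (LinearMap.ker f.toLin).subtype) =
      LinearMap.ker (locMap E f.toLin) :=
    (LinearMap.exact_iff.1 (locMap_exact E (LinearMap.exact_subtype_ker_map f.toLin))).symm
  rw [IsSub, h1, h2]
  ext x
  rw [Submodule.mem_map_equiv, LinearMap.mem_ker, LinearMap.mem_ker,
    ← N.frob.map_eq_zero_iff, f.comm_apply, LinearEquiv.apply_symm_apply]

/-- The morphism to a subobject that contains the range. -/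
noncomputable def Hom.codRestrict (f : Hom X M) (N : Submodule (S p F) M.carrier)
    (hN : M.IsSub N) (h : ∀ x, f.toLin x ∈ N) : Hom X (M.sub N hN) :=
  Hom.ofCompLeft (f.toLin.codRestrict N h) (M.subHom N hN) f N.injective_subtype rfl

/-- The inclusion between two subobjects. -/
noncomputable def inclusion (M : PhiModule.{u, v} E) {A B : Submodule (S p F) M.carrier}
    (hA : M.IsSub A) (hB : M.IsSub B) (h : A ≤ B) : Hom (M.sub A hA) (M.sub B hB) :=
  Hom.codRestrict (M.subHom A hA) B hB fun x => h x.2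

/-- The preimage of a subobject under an arbitrary morphism is a subobject. -/
theorem IsSub.comap' {A : Submodule (S p F) N.carrier} (hA : N.IsSub A) (f : Hom M N) :
    M.IsSub (A.comap f.toLin) := by
  have h : LinearMap.ker ((N.mkQHom A hA).comp f).toLin = A.comap f.toLin :=
    Submodule.ext fun x => Submodule.Quotient.mk_eq_zero A
  exact h ▸ ((N.mkQHom A hA).comp f).isSub_ker

theorem IsSub.map {A : Submodule (S p F) M.carrier} (hA : M.IsSub A) (f : Hom M N) :
    N.IsSub (A.map f.toLin) := by
  have h : LinearMap.range (f.comp (M.subHom A hA)).toLin = A.map f.toLin := by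
    ext x
    exact ⟨fun ⟨y, hy⟩ => ⟨y.1, y.2, hy⟩, fun ⟨y, h, hy⟩ => ⟨⟨y, h⟩, hy⟩⟩
  exact h ▸ (f.comp (M.subHom A hA)).isSub_range

theorem IsSub.sup {A B : Submodule (S p F) M.carrier} (hA : M.IsSub A) (hB : M.IsSub B) :
    M.IsSub (A ⊔ B) := by
  have h : (B.map (M.mkQHom A hA).toLin).comap (M.mkQHom A hA).toLin = A ⊔ B :=
    Submodule.comap_map_mkQ A B
  exact h ▸ (hB.map (M.mkQHom A hA)).comap' (M.mkQHom A hA)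

theorem IsSub.inf {A B : Submodule (S p F) M.carrier} (hA : M.IsSub A) (hB : M.IsSub B) :
    M.IsSub (A ⊓ B) := by
  have h : (B.comap (M.subHom A hA).toLin).map (M.subHom A hA).toLin = A ⊓ B :=
    Submodule.map_comap_subtype A B
  exact h ▸ (hB.comap' (M.subHom A hA)).map (M.subHom A hA)

theorem IsSub.smul {A : Submodule (S p F) M.carrier} (hA : M.IsSub A) (a : ℕ) :
    M.IsSub ((a : S p F) • A) := by
  rw [← map_natMul]; exact hA.map _

end Perfect

end PhiModule
end Kisin

/-! ### Lengths over `𝔖` -/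

namespace Kisin

section Length

variable {p : ℕ} [Fact p.Prime] {F : Type u} [Field F]

theorem X_smul_mem_span_p {f : S p F}
    (h : PowerSeries.X * f ∈ Ideal.span {(p : S p F)}) : f ∈ Ideal.span {(p : S p F)} := by
  rw [Ideal.mem_span_singleton] at h ⊢
  obtain ⟨g, hg⟩ := h
  refine natCast_dvd_of_coeff fun n => ⟨PowerSeries.coeff (n + 1) g, ?_⟩
  rw [← PowerSeries.coeff_succ_X_mul, hg, ← map_natCast (PowerSeries.C (R := WittVector p F)),
    PowerSeries.coeff_C_mul]

theorem uTorsionFree_quot_p :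
    UTorsionFree (p := p) (F := F) (S p F ⧸ Ideal.span {(p : S p F)}) := by
  rintro ⟨f⟩ hf
  exact (Submodule.Quotient.mk_eq_zero _).2
    (X_smul_mem_span_p ((Submodule.Quotient.mk_eq_zero (Ideal.span {(p : S p F)})).1 hf))

theorem relLen_span_pair (n : ℕ) :
    relLen (Ideal.span {(p : S p F), PowerSeries.X ^ n}) ⊤ =
      relLen ((PowerSeries.X : S p F) ^ n • ⊤ :
        Submodule (S p F) (S p F ⧸ Ideal.span {(p : S p F)})) ⊤ := by
  rw [← relLen_map_mkQ (N := Ideal.span {(p : S p F)}) (Ideal.span_mono (by simp)) le_top,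
    Submodule.map_top, Submodule.range_mkQ]
  congr 1
  rw [Ideal.span_insert, Submodule.map_sup, Submodule.mkQ_map_self, bot_sup_eq,
    ← Submodule.range_mkQ (Ideal.span {(p : S p F)}), ← Submodule.map_top,
    ← Submodule.map_pointwise_smul]
  congr 1
  rw [← Submodule.ideal_span_singleton_smul, smul_eq_mul, Ideal.mul_top]

variable [CharP F p] [PerfectRing F p]

variable (p F) in
theorem maximalIdeal_eq :
    IsLocalRing.maximalIdeal (S p F) = Ideal.span {(p : S p F), PowerSeries.X} := by
  apply le_antisymm
  · intro f hf
    have h : (PowerSeries.constantCoeff f).coeff 0 = 0 := by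
      by_contra h
      exact hf (PowerSeries.isUnit_iff_constantCoeff.2
        (WittVector.isUnit_of_coeff_zero_ne_zero _ h))
    obtain ⟨a, ha⟩ := Ideal.mem_span_singleton.1
      ((WittVector.mem_span_p_iff_coeff_zero_eq_zero _).2 h)
    obtain ⟨g, hg⟩ := PowerSeries.X_dvd_iff.2
      (show PowerSeries.constantCoeff (f - PowerSeries.C (PowerSeries.constantCoeff f)) = 0 by simp)
    rw [Ideal.mem_span_pair]
    refine ⟨PowerSeries.C a, g, ?_⟩
    rw [mul_comm g, ← hg, ha, map_mul, map_natCast]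
    ring
  · rw [Ideal.span_le]
    rintro _ (rfl | rfl)
    · intro h
      have h2 := PowerSeries.isUnit_iff_constantCoeff.1 h
      rw [map_natCast] at h2
      exact WittVector.irreducible p |>.not_isUnit h2
    · intro h
      have h2 := PowerSeries.isUnit_iff_constantCoeff.1 h
      simp at h2

variable (p F) in
/-- The length of `𝔖/(p, u^n)` is `n`. -/
theorem length_quot_span_pair (n : ℕ) :
    Module.length (S p F) (S p F ⧸ Ideal.span {(p : S p F), PowerSeries.X ^ n}) = n := by
  rw [← relLen_top, relLen_span_pair, relLen_pow_smul (fun x hx => uTorsionFree_quot_p x hx)]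
  have h := relLen_span_pair (p := p) (F := F) 1
  rw [pow_one] at h
  have : IsSimpleModule (S p F) (S p F ⧸ IsLocalRing.maximalIdeal (S p F)) :=
    isSimpleModule_iff_isCoatom.2 (IsLocalRing.maximalIdeal.isMaximal (S p F)).out
  rw [← h, ← maximalIdeal_eq, relLen_top, Module.length_eq_one, mul_one]

theorem length_ne_top_of_maximalIdeal {M : Type*} [AddCommGroup M] [Module (S p F) M]
    [Module.Finite (S p F) M] (hp : ∀ x : M, (p : S p F) • x = 0)
    (hX : ∀ x : M, (PowerSeries.X : S p F) • x = 0) : Module.length (S p F) M ≠ ⊤ := by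
  have hm : Module.IsTorsionBySet (S p F) M (IsLocalRing.maximalIdeal (S p F) : Set (S p F)) := by
    rintro x ⟨a, ha⟩
    rw [SetLike.mem_coe, maximalIdeal_eq, Ideal.mem_span_pair] at ha
    obtain ⟨b, c, rfl⟩ := ha
    change (_ : S p F) • x = 0
    rw [add_smul, mul_smul, mul_smul, hp, hX, smul_zero, smul_zero, add_zero]
  let _ : Module (IsLocalRing.ResidueField (S p F)) M := hm.module
  have : IsScalarTower (S p F) (IsLocalRing.ResidueField (S p F)) M := hm.isScalarTower
  rw [Module.length_eq_of_surjective (R := IsLocalRing.ResidueField (S p F))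
    IsLocalRing.residue_surjective]
  have := Module.Finite.of_restrictScalars_finite (S p F) (IsLocalRing.ResidueField (S p F)) M
  exact Module.length_ne_top

/-- A finite module killed by `p` has finite rank `length (M/uM)`. -/
theorem relLen_X_smul_ne_top {M : Type*} [AddCommGroup M] [Module (S p F) M]
    [Module.Finite (S p F) M] (hp : ∀ x : M, (p : S p F) • x = 0) :
    relLen ((PowerSeries.X : S p F) • ⊤ : Submodule (S p F) M) ⊤ ≠ ⊤ := by
  rw [relLen_top]
  apply length_ne_top_of_maximalIdeal
  · rintro ⟨x⟩
    exact congrArg Submodule.Quotient.mk (hp x)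
  · rintro ⟨x⟩
    exact (Submodule.Quotient.mk_eq_zero _).2 ((Submodule.mem_smul_pointwise_iff_exists _ _ _).2
      ⟨x, trivial, rfl⟩)

/-- The Frobenius pullback multiplies lengths by `p`, as `𝔖/(p, u ^ p)` has length `p`. -/
theorem length_pullback (M : Type v) [AddCommGroup M] [Module (S p F) M] :
    Module.length (S p F) (Pullback p F M) = Module.length (S p F) M * p := by
  have : IsLocalRing (Tw p F) := inferInstanceAs (IsLocalRing (S p F))
  have hmap : (IsLocalRing.maximalIdeal (S p F)).map (algebraMap (S p F) (Tw p F)) =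
      (Ideal.span {(p : S p F), PowerSeries.X ^ p} : Ideal (S p F)) := by
    rw [maximalIdeal_eq]
    change (Ideal.span {(p : S p F), PowerSeries.X}).map (frobS p F) = _
    rw [Ideal.map_span, Set.image_pair, frobS_X, map_natCast]
  have : IsLocalHom (algebraMap (S p F) (Tw p F)) := by
    refine ((IsLocalRing.local_hom_TFAE _).out 0 2).2 ?_
    rw [hmap]
    change _ ≤ IsLocalRing.maximalIdeal (S p F)
    rw [maximalIdeal_eq, Ideal.span_le]
    rintro _ (rfl | rfl)
    · exact Ideal.subset_span (by simp)
    · exact Ideal.pow_mem_of_mem _ (Ideal.subset_span (by simp)) _ (Fact.out : p.Prime).pos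
  have := IsLocalRing.length_baseChange (S p F) (Tw p F) M
  rw [hmap] at this
  refine this.trans ?_
  congr 1
  exact length_quot_span_pair p F p

end Length
end Kisin

/-! ### Localization at the powers of `E` -/

namespace Kisin

section LocLattice

variable {p : ℕ} [Fact p.Prime] {F : Type u} [Field F] (E : EisensteinPoly p F)
variable {M N P : Type v} [AddCommGroup M] [Module (S p F) M] [AddCommGroup N] [Module (S p F) N]
  [AddCommGroup P] [Module (S p F) P]

theorem toS_pow_smul_injective (M : Type v) [AddCommGroup M] [Module (S p F) M] (k : ℕ) :
    Function.Injective fun x : Loc E M => E.toS ^ k • x :=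
  IsLocalizedModule.smul_injective (S := Submonoid.powers E.toS) (toLoc E M) ⟨E.toS ^ k, k, rfl⟩

theorem exists_pow_smul_eq_toLoc (x : Loc E M) :
    ∃ (k : ℕ) (y : M), E.toS ^ k • x = toLoc E M y := by
  obtain ⟨⟨y, ⟨_, k, rfl⟩⟩, h⟩ := IsLocalizedModule.surj (Submonoid.powers E.toS) (toLoc E M) x
  exact ⟨k, y, h⟩

theorem toLoc_eq_zero_iff {x : M} : toLoc E M x = 0 ↔ ∃ k : ℕ, E.toS ^ k • x = 0 := by
  rw [IsLocalizedModule.eq_zero_iff (Submonoid.powers E.toS)]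
  exact ⟨fun ⟨⟨_, k, rfl⟩, h⟩ => ⟨k, h⟩, fun ⟨k, h⟩ => ⟨⟨_, k, rfl⟩, h⟩⟩

/-- An element belongs to `(f M)[1/E]` if an `E`-power multiple of it comes from `f M`. -/
theorem mem_range_locMap {f : M →ₗ[S p F] N} {v : Loc E N} :
    v ∈ LinearMap.range (locMap E f) ↔ ∃ (k : ℕ) (x : M), E.toS ^ k • v = toLoc E N (f x) := by
  constructor
  · rintro ⟨w, rfl⟩
    obtain ⟨k, x, h⟩ := exists_pow_smul_eq_toLoc E w
    exact ⟨k, x, by rw [← map_smul, h, PhiModule.locMap_toLoc]⟩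
  · rintro ⟨k, x, h⟩
    let w : Loc E M := IsLocalizedModule.mk' (toLoc E M) x
      (⟨E.toS ^ k, k, rfl⟩ : Submonoid.powers E.toS)
    refine ⟨w, toS_pow_smul_injective E N k ?_⟩
    have hw : E.toS ^ k • w = toLoc E M x :=
      IsLocalizedModule.mk'_cancel' (toLoc E M) x (⟨E.toS ^ k, k, rfl⟩ : Submonoid.powers E.toS)
    change E.toS ^ k • locMap E f w = E.toS ^ k • v
    rw [← map_smul, hw, PhiModule.locMap_toLoc, h]

theorem map_locMap_range_toLoc {g : M →ₗ[S p F] N} (hg : Function.Surjective g) :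
    (LinearMap.range (toLoc E M)).map (locMap E g) = LinearMap.range (toLoc E N) := by
  ext v
  constructor
  · rintro ⟨_, ⟨x, rfl⟩, rfl⟩
    exact ⟨g x, (PhiModule.locMap_toLoc g x).symm⟩
  · rintro ⟨y, rfl⟩
    obtain ⟨x, rfl⟩ := hg y
    exact ⟨_, ⟨x, rfl⟩, PhiModule.locMap_toLoc g x⟩

/-- If `P` has no `E`-torsion, then `M` is the intersection of `N` and `M[1/E]` in `N[1/E]`. -/
theorem comap_locMap_range_toLoc {f : M →ₗ[S p F] N} {g : N →ₗ[S p F] P}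
    (hf : Function.Injective f) (h : Function.Exact f g) (hP : Function.Injective (toLoc E P)) :
    (LinearMap.range (toLoc E N)).comap (locMap E f) = LinearMap.range (toLoc E M) := by
  ext v
  constructor
  · rintro ⟨y, hy⟩
    have h1 : toLoc E P (g y) = 0 := by
      rw [← PhiModule.locMap_toLoc, hy]
      exact (locMap_exact E h).apply_apply_eq_zero v
    obtain ⟨x, rfl⟩ := (h y).1 (hP (h1.trans (map_zero _).symm))
    exact ⟨x, locMap_injective E hf (by rw [PhiModule.locMap_toLoc, hy])⟩
  · rintro ⟨x, rfl⟩
    exact ⟨f x, (PhiModule.locMap_toLoc f x).symm⟩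

/-- A finitely generated submodule, some `e`-power multiple of each element of which lies in `A`,
has an `e`-power multiple that lies in `A`. -/
theorem exists_pow_smul_le {V : Type*} [AddCommGroup V] [Module (S p F) V] (e : S p F)
    {N A : Submodule (S p F) V}
    (hN : N.FG) (h : ∀ x ∈ N, ∃ k : ℕ, e ^ k • x ∈ A) : ∃ k : ℕ, e ^ k • N ≤ A := by
  induction N, hN using Submodule.fg_induction with
  | singleton x =>
    obtain ⟨k, hk⟩ := h x (Submodule.mem_span_singleton_self x)
    refine ⟨k, ?_⟩
    rw [Submodule.smul_span, Submodule.span_le]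
    rintro _ ⟨_, rfl, rfl⟩
    exact hk
  | sup N₁ N₂ _ _ h₁ h₂ =>
    obtain ⟨k, hk⟩ := h₁ fun x hx => h x (Submodule.mem_sup_left hx)
    obtain ⟨l, hl⟩ := h₂ fun x hx => h x (Submodule.mem_sup_right hx)
    refine ⟨k + l, ?_⟩
    rw [Submodule.smul_sup', sup_le_iff]
    constructor
    · rw [add_comm, pow_add, mul_smul]
      exact (smul_le_self _ _).trans hk
    · rw [pow_add, mul_smul]
      exact (smul_le_self _ _).trans hl

/-- The subobject condition on elements: `φ_M` carries `φ^*N` into `N[1/E]`, and its inverse carries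
`N` into `(φ^*N)[1/E]`. -/
theorem mem_isSub_iff {M : PhiModule.{u, v} E} {N : Submodule (S p F) M.carrier} :
    M.IsSub N ↔ (∀ t : Pullback p F N, M.frob (toLoc E _ (Pullback.map N.subtype t)) ∈
        LinearMap.range (locMap E N.subtype)) ∧
      ∀ x ∈ N, M.frob.symm (toLoc E _ x) ∈ LinearMap.range (pullLocMap E N.subtype) := by
  rw [PhiModule.IsSub, le_antisymm_iff]
  refine and_congr ⟨fun h t => ?_, fun h => ?_⟩ ⟨fun h x hx => ?_, fun h => ?_⟩
  · exact h ⟨_, (mem_range_locMap E).2 ⟨0, t, by rw [pow_zero, one_smul]⟩, rfl⟩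
  · rintro _ ⟨v, hv, rfl⟩
    obtain ⟨k, t, hkt⟩ := (mem_range_locMap E).1 hv
    obtain ⟨l, x, hlx⟩ := (mem_range_locMap E).1 (h t)
    refine (mem_range_locMap E).2 ⟨l + k, x, ?_⟩
    rw [← hlx, ← hkt, pow_add, mul_smul]
    congr 1
    exact (M.frob.map_smul _ _).symm
  · have h1 := h ((mem_range_locMap E).2 ⟨0, ⟨x, hx⟩, by
      rw [pow_zero, one_smul]; rfl⟩ : toLoc E _ x ∈ _)
    obtain ⟨w, hw, hwx⟩ := h1
    rw [← hwx]
    simpa using hw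
  · intro v hv
    obtain ⟨k, x, hkx⟩ := (mem_range_locMap E).1 hv
    obtain ⟨l, t, hlt⟩ := (mem_range_locMap E).1 (h x.1 x.2)
    refine ⟨M.frob.symm v, (mem_range_locMap E).2 ⟨l + k, t, ?_⟩, by simp⟩
    rw [← hlt, pow_add, mul_smul, ← map_smul, hkx]
    rfl

end LocLattice

/-! ### The lattices `M` and `φ_M(φ^*M)` -/

section Lattices

namespace PhiModule

variable {p : ℕ} [Fact p.Prime] {F : Type u} [Field F] {E : EisensteinPoly p F}

theorem fg_lattice (M : PhiModule.{u, v} E) : M.lattice.FG := by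
  rw [lattice, LinearMap.range_eq_map]
  exact Module.Finite.fg_top.map _

theorem fg_frobLattice (M : PhiModule.{u, v} E) : M.frobLattice.FG := by
  rw [frobLattice, LinearMap.range_eq_map]
  exact (Module.Finite.fg_top.map _).map _

/-- The lattice `φ_M(φ^*M)` contains an `E`-power multiple of `M`. -/
theorem exists_smul_lattice_le (M : PhiModule.{u, v} E) :
    ∃ k : ℕ, E.toS ^ k • M.lattice ≤ M.frobLattice := by
  refine exists_pow_smul_le _ M.fg_lattice fun x _ => ?_
  obtain ⟨k, t, h⟩ := exists_pow_smul_eq_toLoc E (M.frob.symm x)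
  refine ⟨k, _, ⟨t, rfl⟩, ?_⟩
  rw [← h]
  simp

/-- The lattice `M` contains an `E`-power multiple of `φ_M(φ^*M)`. -/
theorem exists_smul_frobLattice_le (M : PhiModule.{u, v} E) :
    ∃ k : ℕ, E.toS ^ k • M.frobLattice ≤ M.lattice := by
  refine exists_pow_smul_le _ M.fg_frobLattice fun x _ => ?_
  obtain ⟨k, t, h⟩ := exists_pow_smul_eq_toLoc E x
  exact ⟨k, t, h.symm⟩

theorem Hom.map_lattice {X Y : PhiModule.{u, v} E} (g : Hom X Y)
    (hg : Function.Surjective g.toLin) : X.lattice.map (locMap E g.toLin) = Y.lattice :=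
  map_locMap_range_toLoc E hg

theorem Hom.map_frobLattice' {X Y : PhiModule.{u, v} E} (g : Hom X Y) :
    X.frobLattice.map (locMap E g.toLin) =
      ((LinearMap.range (toLoc E (Pullback p F X.carrier))).map (pullLocMap E g.toLin)).map
        Y.frob.toLinearMap := by
  rw [frobLattice, ← Submodule.map_comp, ← Submodule.map_comp, g.comm]

theorem Hom.map_frobLattice {X Y : PhiModule.{u, v} E} (g : Hom X Y)
    (hg : Function.Surjective g.toLin) : X.frobLattice.map (locMap E g.toLin) = Y.frobLattice := by
  rw [g.map_frobLattice', pullLocMap, map_locMap_range_toLoc E (Pullback.map_surjective hg)]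
  rfl

end PhiModule

end Lattices

end Kisin

/-! ### Degree and rank of objects killed by `p` -/

namespace Kisin

theorem enat_mul_ne_top {a b : ℕ∞} (ha : a ≠ ⊤) (hb : b ≠ ⊤) : a * b ≠ ⊤ := by
  lift a to ℕ using ha
  lift b to ℕ using hb
  exact_mod_cast ENat.natCast_ne_top (a * b)

theorem enat_add_ne_top {a b : ℕ∞} (ha : a ≠ ⊤) (hb : b ≠ ⊤) : a + b ≠ ⊤ := by
  rw [ne_eq, ENat.add_eq_top, not_or]
  exact ⟨ha, hb⟩

namespace PhiModule

variable {p : ℕ} [Fact p.Prime] {F : Type u} [Field F] {E : EisensteinPoly p F}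

/-- The integer `e * deg X`, for a torsion Kisin module `X`. -/
noncomputable def eDeg (X : PhiModule.{u, v} E) : ℤ := relPos X.lattice X.frobLattice

theorem torsionDeg_eq (X : PhiModule.{u, v} E) :
    X.torsionDeg = (X.eDeg : ℚ) / E.poly.natDegree := rfl

theorem torsionRank_eq (X : PhiModule.{u, v} E) :
    X.torsionRank =
      (relLen ((PowerSeries.X : S p F) • ⊤ : Submodule (S p F) X.carrier) ⊤).toNat := by
  rw [torsionRank, Submodule.ideal_span_singleton_smul, relLen_top]

/-- A torsion Kisin module that is killed by `p`. -/
structure IsModP (X : PhiModule.{u, v} E) : Prop where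
  p_smul : ∀ x : X.carrier, (p : S p F) • x = 0
  uTorsionFree : UTorsionFree (p := p) (F := F) X.carrier

variable {X Y Z : PhiModule.{u, v} E}

theorem IsModP.isTorsionKisin (hX : X.IsModP) : X.IsTorsionKisin :=
  ⟨⟨1, fun x => by rw [pow_one, hX.p_smul]⟩, hX.uTorsionFree⟩

theorem IsModP.of_injective (hY : Y.IsModP) (f : Hom X Y) (hf : Function.Injective f.toLin) :
    X.IsModP where
  p_smul x := hf (by rw [map_smul, hY.p_smul, map_zero])
  uTorsionFree x hx := hf (by
    rw [map_zero]; exact hY.uTorsionFree _ (by rw [← map_smul, hx, map_zero]))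

theorem IsModP.toLoc_injective (hX : X.IsModP) : Function.Injective (toLoc E X.carrier) :=
  Kisin.toLoc_injective E (n := 1) hX.uTorsionFree fun x => by rw [pow_one, hX.p_smul]

/-- As `E` acts on `M` as `u ^ e`, the length of `M/E^k M` is `e k` times that of `M/uM`. -/
theorem relLen_toS_pow_smul {M : Type*} [AddCommGroup M] [Module (S p F) M]
    (hp : ∀ x : M, (p : S p F) • x = 0) (hM : UTorsionFree (p := p) (F := F) M)
    (E : EisensteinPoly p F) (k : ℕ) :
    relLen (E.toS ^ k • ⊤ : Submodule (S p F) M) ⊤ =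
      (E.poly.natDegree * k : ℕ) *
        relLen ((PowerSeries.X : S p F) • ⊤ : Submodule (S p F) M) ⊤ := by
  rw [← relLen_pow_smul fun x hx => hM x hx]
  congr 1
  ext x
  simp only [Submodule.mem_smul_pointwise_iff_exists, toS_pow_smul E (hp _)]

theorem IsModP.relLen_lattice (hX : X.IsModP) (k : ℕ) :
    relLen (E.toS ^ k • X.lattice) X.lattice =
      relLen (E.toS ^ k • ⊤ : Submodule (S p F) X.carrier) ⊤ := by
  rw [lattice, LinearMap.range_eq_map, ← Submodule.map_pointwise_smul,
    relLen_map_of_injective hX.toLoc_injective le_top]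

section Perfect

variable [CharP F p] [PerfectRing F p]

theorem IsModP.toLoc_pullback_injective (hX : X.IsModP) :
    Function.Injective (toLoc E (Pullback p F X.carrier)) :=
  Kisin.toLoc_injective E (n := 1) hX.uTorsionFree.pullback fun x => by
    rw [pow_one, Pullback.natCast_smul_eq_zero hX.p_smul]

theorem relLen_toS_pow_smul_ne_top {M : Type*} [AddCommGroup M] [Module (S p F) M]
    [Module.Finite (S p F) M]
    (hp : ∀ x : M, (p : S p F) • x = 0) (hM : UTorsionFree (p := p) (F := F) M)
    (E : EisensteinPoly p F) (k : ℕ) :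
    relLen (E.toS ^ k • ⊤ : Submodule (S p F) M) ⊤ ≠ ⊤ := by
  rw [relLen_toS_pow_smul hp hM]
  exact enat_mul_ne_top (ENat.natCast_ne_top _) (relLen_X_smul_ne_top hp)

theorem IsModP.relLen_frobLattice (hX : X.IsModP) (k : ℕ) :
    relLen (E.toS ^ k • X.frobLattice) X.frobLattice =
      relLen (E.toS ^ k • ⊤ : Submodule (S p F) (Pullback p F X.carrier)) ⊤ := by
  rw [frobLattice, LinearMap.range_eq_map, ← Submodule.map_pointwise_smul,
    ← Submodule.map_pointwise_smul,
    relLen_map_of_injective X.frob.injective (Submodule.map_mono le_top),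
    relLen_map_of_injective hX.toLoc_pullback_injective le_top]

theorem IsModP.relLen_lattice_ne_top (hX : X.IsModP) (k : ℕ) :
    relLen (E.toS ^ k • X.lattice) X.lattice ≠ ⊤ := by
  rw [hX.relLen_lattice]
  exact relLen_toS_pow_smul_ne_top hX.p_smul hX.uTorsionFree E k

theorem IsModP.relLen_frobLattice_ne_top (hX : X.IsModP) (k : ℕ) :
    relLen (E.toS ^ k • X.frobLattice) X.frobLattice ≠ ⊤ := by
  rw [hX.relLen_frobLattice]
  exact relLen_toS_pow_smul_ne_top (Pullback.natCast_smul_eq_zero hX.p_smul)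
    hX.uTorsionFree.pullback E k

/-- The lattices `X` and `φ_X(φ^*X)` contain a common lattice of finite colength. -/
theorem IsModP.exists_common (hX : X.IsModP) :
    ∃ L, L ≤ X.lattice ∧ L ≤ X.frobLattice ∧ relLen L X.lattice ≠ ⊤ ∧
      relLen L X.frobLattice ≠ ⊤ := by
  obtain ⟨k, hk⟩ := X.exists_smul_lattice_le
  obtain ⟨l, hl⟩ := X.exists_smul_frobLattice_le
  refine ⟨E.toS ^ k • X.lattice, smul_le_self _ _, hk, hX.relLen_lattice_ne_top k, ?_⟩
  refine ne_top_of_le_ne_top (hX.relLen_frobLattice_ne_top (k + l)) (relLen_le_of_le_left ?_)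
  rw [pow_add, mul_smul]
  exact smul_mono _ hl

/-- The degree is additive in short exact sequences. -/
theorem IsModP.eDeg_of_exact (hY : Y.IsModP) (hZ : Z.IsModP) (f : Hom X Y) (g : Hom Y Z)
    (hf : Function.Injective f.toLin) (hg : Function.Surjective g.toLin)
    (h : Function.Exact f.toLin g.toLin) : Y.eDeg = X.eDeg + Z.eDeg := by
  obtain ⟨L, h₁, h₂, f₁, f₂⟩ := hY.exists_common
  rw [eDeg, relPos_of_exact (locMap_exact E h) h₁ h₂ f₁ f₂, g.map_lattice hg,
    g.map_frobLattice hg, eDeg, eDeg, lattice,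
    comap_locMap_range_toLoc E hf h hZ.toLoc_injective]
  have : Y.frobLattice.comap (locMap E f.toLin) = X.frobLattice := by
    have h2 := comap_locMap_range_toLoc E (Pullback.map_injective hf)
      (Pullback.map_exact h hg) hZ.toLoc_pullback_injective
    rw [frobLattice, frobLattice, ← h2]
    ext v
    obtain ⟨v, rfl⟩ := X.frob.surjective v
    rw [Submodule.mem_comap, ← f.comm_apply]
    constructor
    · rintro ⟨w, hw, hwv⟩
      have hwv : w = pullLocMap E f.toLin v := Y.frob.injective hwv
      exact ⟨v, by rw [SetLike.mem_coe, Submodule.mem_comap]; rwa [hwv] at hw, rfl⟩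
    · rintro ⟨w, hw, hwv⟩
      have hwv : w = v := X.frob.injective hwv
      rw [← hwv]
      exact ⟨_, hw, rfl⟩
  rw [this]
  rfl

/-- The rank is additive in short exact sequences. -/
theorem IsModP.torsionRank_of_exact (hY : Y.IsModP) (hZ : Z.IsModP) (f : Hom X Y) (g : Hom Y Z)
    (hf : Function.Injective f.toLin) (hg : Function.Surjective g.toLin)
    (h : Function.Exact f.toLin g.toLin) : Y.torsionRank = X.torsionRank + Z.torsionRank := by
  have e := relLen_of_exact h (A := (PowerSeries.X : S p F) • ⊤) le_top
  have e1 : ((PowerSeries.X : S p F) • ⊤ : Submodule (S p F) Y.carrier).comap f.toLin =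
      (PowerSeries.X : S p F) • ⊤ := by
    ext x
    simp only [Submodule.mem_comap, Submodule.mem_smul_pointwise_iff_exists]
    constructor
    · rintro ⟨y, -, hy⟩
      have hgy : g.toLin y = 0 := hZ.uTorsionFree _ (by
        rw [← map_smul, hy]; exact h.apply_apply_eq_zero x)
      obtain ⟨z, rfl⟩ := (h y).1 hgy
      exact ⟨z, trivial, hf (by rw [map_smul, hy])⟩
    · rintro ⟨y, -, rfl⟩
      exact ⟨f.toLin y, trivial, (map_smul _ _ _).symm⟩
  rw [e1, Submodule.comap_top, Submodule.map_pointwise_smul, Submodule.map_top,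
    LinearMap.range_eq_top.2 hg] at e
  have hne := relLen_X_smul_ne_top hY.p_smul
  rw [e, ne_eq, ENat.add_eq_top, not_or] at hne
  rw [torsionRank_eq, torsionRank_eq, torsionRank_eq, e, ENat.toNat_add hne.1 hne.2]

/-- An object of rank `0` vanishes, by Nakayama's lemma. -/
theorem IsModP.subsingleton_of_torsionRank (hX : X.IsModP) (h : X.torsionRank = 0) :
    Subsingleton X.carrier := by
  rw [torsionRank_eq, ENat.toNat_eq_zero, or_iff_left (relLen_X_smul_ne_top hX.p_smul),
    relLen_eq_zero] at h
  rw [← Submodule.subsingleton_iff (S p F), ← subsingleton_iff_bot_eq_top, eq_comm]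
  refine Submodule.eq_bot_of_le_smul_of_le_jacobson_bot (Ideal.span {(PowerSeries.X : S p F)}) _
    Module.Finite.fg_top (by rwa [Submodule.ideal_span_singleton_smul]) ?_
  rw [IsLocalRing.jacobson_eq_maximalIdeal _ bot_ne_top, maximalIdeal_eq]
  exact Ideal.span_mono (by simp)

theorem relLen_range_pullback {M N : Type v} [AddCommGroup M] [Module (S p F) M] [AddCommGroup N]
    [Module (S p F) N] (f : M →ₗ[S p F] N) :
    relLen (LinearMap.range (Pullback.map f)) ⊤ = relLen (LinearMap.range f) ⊤ * p := by
  let g : N →ₗ[S p F] N ⧸ LinearMap.range f := (LinearMap.range f).mkQ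
  have hg : Function.Surjective g := Submodule.mkQ_surjective _
  have hex : Function.Exact (Pullback.map f) (Pullback.map g) :=
    Pullback.map_exact (LinearMap.exact_map_mkQ_range f) hg
  rw [relLen_top, relLen_top, ← length_pullback, ← LinearMap.exact_iff.1 hex]
  exact (LinearMap.quotKerEquivOfSurjective (Pullback.map g)
    (Pullback.map_surjective hg)).length_eq

/-- Passing to a larger object `Y ⊇ X` with `u`-power torsion quotient keeps the rank and raises the
degree by `(p - 1) * length (Y/X)`: the lattice `Y` grows by `length (Y/X)`, and the lattice
`φ_Y(φ^*Y)` by `p` times that. -/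
theorem IsModP.eDeg_of_isTorsion (hY : Y.IsModP) (f : Hom X Y) (hf : Function.Injective f.toLin)
    {k : ℕ} (hk : ∀ y, (PowerSeries.X : S p F) ^ k • y ∈ LinearMap.range f.toLin) :
    X.torsionRank = Y.torsionRank ∧
      Y.eDeg = X.eDeg + (p - 1) * (relLen (LinearMap.range f.toLin) ⊤).toNat ∧
      relLen (LinearMap.range f.toLin) ⊤ ≠ ⊤ := by
  have hX : X.IsModP := hY.of_injective f hf
  have hfin : relLen (LinearMap.range f.toLin) ⊤ ≠ ⊤ := by
    have h1 : relLen ((PowerSeries.X : S p F) ^ k • ⊤ : Submodule (S p F) Y.carrier) ⊤ ≠ ⊤ := by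
      rw [relLen_pow_smul fun x hx => hY.uTorsionFree x hx]
      exact enat_mul_ne_top (ENat.natCast_ne_top _) (relLen_X_smul_ne_top hY.p_smul)
    refine ne_top_of_le_ne_top h1 (relLen_le_of_le_left ?_)
    rintro _ ⟨y, -, rfl⟩
    exact hk y
  refine ⟨?_, ?_, hfin⟩
  · have e1 := relLen_add (smul_le_self (PowerSeries.X : S p F) (LinearMap.range f.toLin)) le_top
    have e2 := relLen_add (smul_mono (PowerSeries.X : S p F)
      (le_top : LinearMap.range f.toLin ≤ ⊤)) (smul_le_self _ _)
    rw [relLen_smul (fun x hx => hY.uTorsionFree x hx) le_top] at e2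
    have e3 : relLen ((PowerSeries.X : S p F) • LinearMap.range f.toLin)
        (LinearMap.range f.toLin) =
          relLen ((PowerSeries.X : S p F) • ⊤ : Submodule (S p F) X.carrier) ⊤ := by
      rw [LinearMap.range_eq_map, ← Submodule.map_pointwise_smul,
        relLen_map_of_injective hf le_top]
    rw [torsionRank_eq, torsionRank_eq, ← e3]
    congr 1
    rw [e1, add_comm] at e2
    exact ENat.add_right_injective_of_ne_top hfin e2
  · obtain ⟨L, h₁, h₂, f₁, f₂⟩ := hX.exists_common
    have hi := locMap_injective E hf
    set L' := L.map (locMap E f.toLin)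
    set A := X.lattice.map (locMap E f.toLin)
    set B := X.frobLattice.map (locMap E f.toLin)
    have h₁' : L' ≤ A := Submodule.map_mono h₁
    have h₂' : L' ≤ B := Submodule.map_mono h₂
    have f₁' : relLen L' A ≠ ⊤ := by rwa [relLen_map_of_injective hi h₁]
    have f₂' : relLen L' B ≠ ⊤ := by rwa [relLen_map_of_injective hi h₂]
    have eX : X.eDeg = relPos A B := (relPos_map_of_injective hi _ _).symm
    have hA : A = (LinearMap.range f.toLin).map (toLoc E Y.carrier) := by
      rw [← LinearMap.range_comp]
      change (LinearMap.range (toLoc E X.carrier)).map _ = _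
      rw [← LinearMap.range_comp]
      congr 1
      exact LinearMap.ext fun x => locMap_toLoc f.toLin x
    have hB : B = ((LinearMap.range (Pullback.map f.toLin)).map (toLoc E _)).map
        Y.frob.toLinearMap := by
      rw [← LinearMap.range_comp]
      change X.frobLattice.map _ = _
      rw [f.map_frobLattice', ← LinearMap.range_comp]
      congr 2
      exact LinearMap.ext fun x => locMap_toLoc (Pullback.map f.toLin) x
    have hAY : A ≤ Y.lattice := by
      rw [hA, lattice, LinearMap.range_eq_map (toLoc E Y.carrier)]; exact Submodule.map_mono le_top
    have hBY : B ≤ Y.frobLattice := by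
      rw [hB, frobLattice, LinearMap.range_eq_map (toLoc E _)]
      exact Submodule.map_mono (Submodule.map_mono le_top)
    have lA : relLen A Y.lattice = relLen (LinearMap.range f.toLin) ⊤ := by
      rw [hA, lattice, LinearMap.range_eq_map (toLoc E Y.carrier),
        relLen_map_of_injective hY.toLoc_injective le_top]
    have lB : relLen B Y.frobLattice = relLen (LinearMap.range f.toLin) ⊤ * p := by
      rw [hB, frobLattice, LinearMap.range_eq_map (toLoc E _),
        relLen_map_of_injective Y.frob.injective (Submodule.map_mono le_top),
        relLen_map_of_injective hY.toLoc_pullback_injective le_top, relLen_range_pullback]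
    have tA := relLen_add h₁' hAY
    have tB := relLen_add h₂' hBY
    have hfin' : relLen (LinearMap.range f.toLin) ⊤ * p ≠ ⊤ :=
      enat_mul_ne_top hfin (ENat.natCast_ne_top _)
    rw [eX, eDeg, relPos_eq h₁' h₂' f₁' f₂', relPos_eq (h₁'.trans hAY) (h₂'.trans hBY), tA, tB, lA,
      lB, ENat.toNat_add f₁' hfin, ENat.toNat_add f₂' hfin', ENat.toNat_mul]
    · push_cast
      simp only [ENat.toNat_natCast]
      ring
    · rw [tA, lA]; exact enat_add_ne_top f₁' hfin
    · rw [tB, lB]; exact enat_add_ne_top f₂' hfin'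

end Perfect

end PhiModule
end Kisin

/-! ### Subquotients killed by `p` -/

namespace Kisin
namespace PhiModule

variable {p : ℕ} [Fact p.Prime] {F : Type u} [Field F] {E : EisensteinPoly p F}

variable {M W X Y Z : PhiModule.{u, v} E}

/-- Modulo `p`, a power of `E` is divisible by the same power of `u`. -/
theorem toS_pow_mem_span (E : EisensteinPoly p F) (k : ℕ) :
    E.toS ^ k ∈ Ideal.span {(p : S p F), PowerSeries.X ^ k} := by
  obtain ⟨g, hg⟩ := E.toS_eq
  have h1 : E.toS ^ k - ((PowerSeries.X : S p F) ^ E.poly.natDegree) ^ k ∈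
      Ideal.span {(p : S p F), PowerSeries.X ^ k} := by
    refine Ideal.mem_of_dvd _ (sub_dvd_pow_sub_pow _ _ k) ?_
    rw [hg, add_sub_cancel_left]
    exact Ideal.mul_mem_right _ _ (Ideal.subset_span (by simp))
  have h2 : ((PowerSeries.X : S p F) ^ E.poly.natDegree) ^ k ∈
      Ideal.span {(p : S p F), PowerSeries.X ^ k} := by
    rw [← pow_mul, mul_comm, pow_mul]
    exact Ideal.pow_mem_of_mem _ (Ideal.subset_span (by simp)) _ E.natDegree_pos
  simpa using add_mem h1 h2

/-- If `B` contains a subobject `A` and `B/A` is killed by `p` and by a power of `u`, then `B` is a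
subobject: a power of `E` lies in `(p, u ^ k)`, so that `A` and `B` agree after inverting `E`, and
the same holds for their pullbacks. -/
theorem IsSub.of_smul_le {A B : Submodule (S p F) M.carrier} (hA : M.IsSub A) (h : A ≤ B)
    (hp : ∀ x ∈ B, (p : S p F) • x ∈ A) {k : ℕ}
    (hX : ∀ x ∈ B, (PowerSeries.X : S p F) ^ k • x ∈ A) : M.IsSub B := by
  have hAB : A.subtype = B.subtype ∘ₗ Submodule.inclusion h := rfl
  have key : ∀ (a : S p F), (∀ x ∈ B, a • x ∈ A) → ∀ t : Pullback p F B,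
      frobS p F a • Pullback.map B.subtype t ∈ LinearMap.range (Pullback.map A.subtype) := by
    intro a ha t
    let g : B →ₗ[S p F] A := (a • B.subtype).codRestrict A fun x => ha x x.2
    refine ⟨Pullback.map g t, ?_⟩
    have : a • B.subtype = A.subtype ∘ₗ g := rfl
    rw [← LinearMap.smul_apply, ← Pullback.map_smul, this, Pullback.map_comp]
    rfl
  have key2 : ∀ t : Pullback p F B, ∃ s : Pullback p F A,
      Pullback.map A.subtype s = E.toS ^ (p * k) • Pullback.map B.subtype t := by
    intro t
    obtain ⟨a, b, hab⟩ := Ideal.mem_span_pair.1 (toS_pow_mem_span E (p * k))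
    rw [← hab, add_smul, mul_smul, mul_smul]
    refine Submodule.add_mem (LinearMap.range (Pullback.map A.subtype))
      (Submodule.smul_mem _ _ ?_) (Submodule.smul_mem _ _ ?_)
    · have := key (p : S p F) hp t
      rwa [map_natCast] at this
    · have := key ((PowerSeries.X : S p F) ^ k) hX t
      rwa [map_pow, frobS_X, ← pow_mul] at this
  have key3 : ∀ x ∈ B, E.toS ^ k • x ∈ A := by
    intro x hx
    obtain ⟨a, b, hab⟩ := Ideal.mem_span_pair.1 (toS_pow_mem_span E k)
    rw [← hab, add_smul, mul_smul, mul_smul]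
    exact A.add_mem (A.smul_mem _ (hp x hx)) (A.smul_mem _ (hX x hx))
  rw [mem_isSub_iff] at hA ⊢
  constructor
  · intro t
    obtain ⟨s, hs⟩ := key2 t
    obtain ⟨l, x, hx⟩ := (mem_range_locMap E).1 (hA.1 s)
    refine (mem_range_locMap E).2 ⟨l + p * k, Submodule.inclusion h x, ?_⟩
    have hs' : toLoc E _ (Pullback.map A.subtype s) =
        E.toS ^ (p * k) • toLoc E _ (Pullback.map B.subtype t) := by rw [hs, _root_.map_smul]
    rw [pow_add, mul_smul, ← _root_.map_smul M.frob (E.toS ^ (p * k)), ← hs', hx]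
    rfl
  · intro x hx
    obtain ⟨l, s, hs⟩ := (mem_range_locMap E).1 (hA.2 _ (key3 x hx))
    refine (mem_range_locMap E).2 ⟨l + k, Pullback.map (Submodule.inclusion h) s, ?_⟩
    rw [pow_add, mul_smul, ← map_smul (M.frob.symm), ← map_smul (toLoc E M.carrier), hs, hAB,
      Pullback.map_comp]
    rfl

/-- For subobjects `A ⊆ B` of `M`, the quotient `B/A` is killed by `p` and has no `u`-torsion. -/
structure ModPPair (M : PhiModule.{u, v} E) (A B : Submodule (S p F) M.carrier) : Prop where
  left : M.IsSub A
  right : M.IsSub B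
  le : A ≤ B
  p_smul : ∀ x ∈ B, (p : S p F) • x ∈ A
  sat : ∀ x ∈ B, (PowerSeries.X : S p F) • x ∈ A → x ∈ A

variable {A B C D : Submodule (S p F) M.carrier}

theorem ModPPair.mono_left (h : M.ModPPair A C) (hAB : A ≤ B) (hBC : B ≤ C) (hB : M.IsSub B) :
    M.ModPPair A B where
  left := h.left
  right := hB
  le := hAB
  p_smul x hx := h.p_smul x (hBC hx)
  sat x hx := h.sat x (hBC hx)

/-- A presentation of the object `X` as the subquotient `B/A` of `M`: an object `W` with a morphism
onto `X` and an isomorphism onto `B` under which the kernel corresponds to `A`. -/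
structure Presents (M W X : PhiModule.{u, v} E) (A B : Submodule (S p F) M.carrier) where
  i : Hom W M
  g : Hom W X
  inj : Function.Injective i.toLin
  range : LinearMap.range i.toLin = B
  surj : Function.Surjective g.toLin
  ker : ∀ w, g.toLin w = 0 ↔ i.toLin w ∈ A

theorem Presents.mem (P : M.Presents W X A B) (w : W.carrier) : P.i.toLin w ∈ B := by
  exact P.range.le ⟨w, rfl⟩

theorem Presents.isModP (P : M.Presents W X A B) (h : M.ModPPair A B) : X.IsModP where
  p_smul x := by
    obtain ⟨w, rfl⟩ := P.surj x
    rw [← map_smul, P.ker, map_smul]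
    exact h.p_smul _ (P.mem w)
  uTorsionFree x hx := by
    obtain ⟨w, rfl⟩ := P.surj x
    rw [← map_smul, P.ker, map_smul] at hx
    exact (P.ker w).2 (h.sat _ (P.mem w) hx)

section Perfect

variable [CharP F p] [PerfectRing F p]

theorem IsModP.eDeg_of_bijective (hY : Y.IsModP) (f : Hom X Y) (hf : Function.Bijective f.toLin) :
    X.torsionRank = Y.torsionRank ∧ X.eDeg = Y.eDeg := by
  have hr : LinearMap.range f.toLin = ⊤ := LinearMap.range_eq_top.2 hf.2
  obtain ⟨h1, h2, -⟩ := hY.eDeg_of_isTorsion f hf.1 (k := 0) fun y => by rw [hr]; trivial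
  rw [hr, relLen_eq_zero.2 le_rfl] at h2
  exact ⟨h1, by simpa using h2.symm⟩

theorem IsModP.eDeg_of_ker_eq {P : PhiModule.{u, v} E} (hY : Y.IsModP)
    (f : Hom P X) (g : Hom P Y) (hf : Function.Surjective f.toLin)
    (hg : Function.Surjective g.toLin) (h : LinearMap.ker f.toLin = LinearMap.ker g.toLin) :
    X.torsionRank = Y.torsionRank ∧ X.eDeg = Y.eDeg := by
  obtain ⟨i, hi, -⟩ := exists_bijective_of_ker_eq f g hf hg h
  exact hY.eDeg_of_bijective i hi

/-- The projection of the subobject `B` onto the subquotient `B/A`. -/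
noncomputable def subquotProj (M : PhiModule.{u, v} E) {A B : Submodule (S p F) M.carrier}
    (hA : M.IsSub A) (hB : M.IsSub B) (h : A ≤ B) : Hom (M.sub B hB) (M.subquot A B hA hB h) :=
  mkQHom (M.sub B hB) _ _

theorem subquotProj_surjective {A B : Submodule (S p F) M.carrier}
    (hA : M.IsSub A) (hB : M.IsSub B) (h : A ≤ B) :
    Function.Surjective (M.subquotProj hA hB h).toLin :=
  Submodule.mkQ_surjective _

theorem subquotProj_eq_zero {A B : Submodule (S p F) M.carrier}
    (hA : M.IsSub A) (hB : M.IsSub B) (h : A ≤ B) (x : (M.sub B hB).carrier) :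
    (M.subquotProj hA hB h).toLin x = 0 ↔ (M.subHom B hB).toLin x ∈ A :=
  Submodule.Quotient.mk_eq_zero _

open Classical in
/-- The integer `e * deg (B/A)` for subobjects `A ⊆ B` of `M` (with the junk value `0` if `A`, `B`
are not such). -/
noncomputable def pairDeg (M : PhiModule.{u, v} E) (A B : Submodule (S p F) M.carrier) : ℤ :=
  if h : M.IsSub A ∧ M.IsSub B ∧ A ≤ B then (M.subquot A B h.1 h.2.1 h.2.2).eDeg else 0

open Classical in
/-- The rank of `B/A` for subobjects `A ⊆ B` of `M` (with the junk value `0` if `A`, `B` are not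
such). -/
noncomputable def pairRank (M : PhiModule.{u, v} E) (A B : Submodule (S p F) M.carrier) : ℕ :=
  if h : M.IsSub A ∧ M.IsSub B ∧ A ≤ B then (M.subquot A B h.1 h.2.1 h.2.2).torsionRank else 0

theorem ModPPair.pairDeg_eq (h : M.ModPPair A B) :
    M.pairDeg A B = (M.subquot A B h.left h.right h.le).eDeg :=
  dif_pos ⟨h.left, h.right, h.le⟩

theorem ModPPair.pairRank_eq (h : M.ModPPair A B) :
    M.pairRank A B = (M.subquot A B h.left h.right h.le).torsionRank :=
  dif_pos ⟨h.left, h.right, h.le⟩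

/-- The tautological presentation of a subquotient. -/
noncomputable def presentsSubquot (hA : M.IsSub A) (hB : M.IsSub B) (h : A ≤ B) :
    M.Presents (M.sub B hB) (M.subquot A B hA hB h) A B where
  i := M.subHom B hB
  g := M.subquotProj hA hB h
  inj := B.injective_subtype
  range := B.range_subtype
  surj := subquotProj_surjective hA hB h
  ker := subquotProj_eq_zero hA hB h

/-- The rank and degree of `B/A` can be computed from any presentation. -/
theorem Presents.eq_pair (P : M.Presents W X A B) (h : M.ModPPair A B) :
    X.torsionRank = M.pairRank A B ∧ X.eDeg = M.pairDeg A B := by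
  rw [h.pairDeg_eq, h.pairRank_eq]
  let j : Hom W (M.sub B h.right) := Hom.codRestrict P.i B h.right P.mem
  refine ((presentsSubquot h.left h.right h.le).isModP h).eDeg_of_ker_eq P.g
    ((M.subquotProj h.left h.right h.le).comp j) P.surj ?_ ?_
  · refine (subquotProj_surjective h.left h.right h.le).comp ?_
    rintro ⟨x, hx⟩
    rw [← P.range] at hx
    obtain ⟨w, rfl⟩ := hx
    exact ⟨w, rfl⟩
  · ext w
    rw [LinearMap.mem_ker, LinearMap.mem_ker, P.ker]
    exact (subquotProj_eq_zero h.left h.right h.le (j.toLin w)).symm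

theorem ModPPair.isModP (h : M.ModPPair A B) : (M.subquot A B h.left h.right h.le).IsModP :=
  (presentsSubquot h.left h.right h.le).isModP h

/-- The inclusion `B/A → C/A`. -/
noncomputable def subquotInclusion (hA : M.IsSub A) (hB : M.IsSub B) (hC : M.IsSub C)
    (hAB : A ≤ B) (hBC : B ≤ C) :
    Hom (M.subquot A B hA hB hAB) (M.subquot A C hA hC (hAB.trans hBC)) :=
  Hom.liftQ ((M.subquotProj hA hC (hAB.trans hBC)).comp (M.inclusion hB hC hBC)) _ _ fun x hx =>
    (subquotProj_eq_zero hA hC (hAB.trans hBC) ((M.inclusion hB hC hBC).toLin x)).2 hx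

/-- The projection `C/A → C/B`. -/
noncomputable def subquotFactor (hA : M.IsSub A) (hB : M.IsSub B) (hC : M.IsSub C)
    (hAB : A ≤ B) (hBC : B ≤ C) :
    Hom (M.subquot A C hA hC (hAB.trans hBC)) (M.subquot B C hB hC hBC) :=
  Hom.liftQ (M.subquotProj hB hC hBC) _ _ fun x hx =>
    (subquotProj_eq_zero hB hC hBC x).2 (hAB hx)

theorem subquotInclusion_injective (hA : M.IsSub A) (hB : M.IsSub B) (hC : M.IsSub C)
    (hAB : A ≤ B) (hBC : B ≤ C) :
    Function.Injective (M.subquotInclusion hA hB hC hAB hBC).toLin := by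
  rw [injective_iff_map_eq_zero]
  rintro ⟨x⟩ hx
  exact (Submodule.Quotient.mk_eq_zero _).2
    ((subquotProj_eq_zero hA hC (hAB.trans hBC) ((M.inclusion hB hC hBC).toLin x)).1 hx)

theorem subquot_exact (hA : M.IsSub A) (hB : M.IsSub B) (hC : M.IsSub C)
    (hAB : A ≤ B) (hBC : B ≤ C) :
    Function.Exact (M.subquotInclusion hA hB hC hAB hBC).toLin
      (M.subquotFactor hA hB hC hAB hBC).toLin := by
  rintro ⟨x⟩
  constructor
  · intro hx
    have hx : (M.subHom C hC).toLin x ∈ B := (subquotProj_eq_zero hB hC hBC x).1 hx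
    exact ⟨(M.subquotProj hA hB hAB).toLin ⟨_, hx⟩, rfl⟩
  · rintro ⟨⟨y⟩, hy⟩
    rw [← hy]
    exact (subquotProj_eq_zero hB hC hBC _).2 y.2

theorem subquotFactor_surjective (hA : M.IsSub A) (hB : M.IsSub B) (hC : M.IsSub C)
    (hAB : A ≤ B) (hBC : B ≤ C) :
    Function.Surjective (M.subquotFactor hA hB hC hAB hBC).toLin := by
  rintro ⟨x⟩
  exact ⟨(M.subquotProj hA hC (hAB.trans hBC)).toLin x, rfl⟩

/-- Additivity of rank and degree for `A ⊆ B ⊆ C`. -/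
theorem ModPPair.add (hAC : M.ModPPair A C) (hBC : M.ModPPair B C) (h : A ≤ B) :
    M.pairRank A C = M.pairRank A B + M.pairRank B C ∧
      M.pairDeg A C = M.pairDeg A B + M.pairDeg B C := by
  have hAB := hAC.mono_left h hBC.le hBC.left
  rw [hAC.pairDeg_eq, hAC.pairRank_eq, hAB.pairDeg_eq, hAB.pairRank_eq, hBC.pairDeg_eq,
    hBC.pairRank_eq]
  have hi := subquotInclusion_injective hAB.left hAB.right hBC.right h hBC.le
  have hs := subquotFactor_surjective hAB.left hAB.right hBC.right h hBC.le
  have he := subquot_exact hAB.left hAB.right hBC.right h hBC.le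
  exact ⟨hAC.isModP.torsionRank_of_exact hBC.isModP _ _ hi hs he,
    hAC.isModP.eDeg_of_exact hBC.isModP _ _ hi hs he⟩

/-- Invariance under `B / (A ∩ B) ≃ (A + B) / A`. -/
theorem pair_inf_eq_sup (h : M.ModPPair (A ⊓ B) B) (h' : M.ModPPair A (B ⊔ A)) :
    M.pairRank (A ⊓ B) B = M.pairRank A (B ⊔ A) ∧ M.pairDeg (A ⊓ B) B = M.pairDeg A (B ⊔ A) := by
  let P : M.Presents (M.sub B h.right) (M.subquot A (B ⊔ A) h'.left h'.right h'.le) (A ⊓ B) B :=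
    { i := M.subHom B h.right
      g := (M.subquotProj h'.left h'.right h'.le).comp (M.inclusion h.right h'.right le_sup_left)
      inj := B.injective_subtype
      range := B.range_subtype
      surj := by
        rintro ⟨x, hx⟩
        obtain ⟨b, hb, a, ha, rfl⟩ := Submodule.mem_sup.1 hx
        refine ⟨⟨b, hb⟩, (Submodule.Quotient.eq _).2 ?_⟩
        change b - (b + a) ∈ A
        simpa using ha
      ker := fun w => by
        refine (subquotProj_eq_zero h'.left h'.right h'.le _).trans ?_
        exact ⟨fun hw => ⟨hw, w.2⟩, fun hw => hw.1⟩ }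
  have := P.eq_pair h
  rw [← this.1, ← this.2, h'.pairDeg_eq, h'.pairRank_eq]
  exact ⟨rfl, rfl⟩

/-- Invariance under the multiplication by `p`. -/
theorem ModPPair.smul (h : M.ModPPair A B) (hp : ∀ x : M.carrier, (p : S p F) • x = 0 → x = 0) :
    M.ModPPair ((p : S p F) • A) ((p : S p F) • B) ∧
      M.pairRank ((p : S p F) • A) ((p : S p F) • B) = M.pairRank A B ∧
      M.pairDeg ((p : S p F) • A) ((p : S p F) • B) = M.pairDeg A B := by
  have hinj : ∀ {x y : M.carrier}, (p : S p F) • x = (p : S p F) • y → x = y := fun hxy =>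
    sub_eq_zero.1 (hp _ (by rw [smul_sub, hxy, sub_self]))
  have hmem : ∀ (N : Submodule (S p F) M.carrier) (x),
      (p : S p F) • x ∈ (p : S p F) • N → x ∈ N := by
    rintro N x ⟨y, hy, hxy⟩
    rwa [← hinj hxy]
  have hadm : M.ModPPair ((p : S p F) • A) ((p : S p F) • B) :=
    { left := h.left.smul p
      right := h.right.smul p
      le := smul_mono _ h.le
      p_smul := by
        rintro _ ⟨x, hx, rfl⟩
        exact ⟨_, h.p_smul x hx, rfl⟩
      sat := by
        rintro _ ⟨x, hx, rfl⟩ hXx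
        refine ⟨x, h.sat x hx (hmem _ _ ?_), rfl⟩
        rw [smul_comm]
        exact hXx }
  refine ⟨hadm, ?_⟩
  let P : M.Presents (M.sub B h.right) (M.subquot _ _ hadm.left hadm.right hadm.le) A B :=
    { i := M.subHom B h.right
      g := (M.subquotProj hadm.left hadm.right hadm.le).comp
        (Hom.codRestrict ((M.natMul p).comp (M.subHom B h.right)) _ hadm.right fun x => by
          change (M.natMul p).toLin x.1 ∈ _
          rw [natMul_apply]
          exact ⟨x.1, x.2, rfl⟩)
      inj := B.injective_subtype
      range := B.range_subtype
      surj := by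
        rintro ⟨_, x, hx, rfl⟩
        refine ⟨⟨x, hx⟩, (Submodule.Quotient.eq _).2 ?_⟩
        change (M.natMul p).toLin x - (p : S p F) • x ∈ (p : S p F) • A
        rw [natMul_apply, sub_self]
        exact zero_mem _
      ker := fun w => by
        refine (subquotProj_eq_zero hadm.left hadm.right hadm.le _).trans ?_
        change (M.natMul p).toLin w.1 ∈ _ ↔ w.1 ∈ A
        rw [natMul_apply]
        exact ⟨hmem _ _, fun hw => ⟨_, hw, rfl⟩⟩ }
  have := P.eq_pair h
  rw [← this.1, ← this.2, hadm.pairDeg_eq, hadm.pairRank_eq]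
  exact ⟨rfl, rfl⟩

theorem ModPPair.eq_of_pairRank (h : M.ModPPair A B) (hr : M.pairRank A B = 0) : A = B := by
  rw [h.pairRank_eq] at hr
  have := h.isModP.subsingleton_of_torsionRank hr
  refine le_antisymm h.le fun x hx => ?_
  exact (subquotProj_eq_zero h.left h.right h.le ⟨x, hx⟩).1 (Subsingleton.elim _ _)

theorem pair_self (h : M.IsSub A) : M.pairRank A A = 0 ∧ M.pairDeg A A = 0 := by
  have hA : M.ModPPair A A := ⟨h, h, le_rfl, fun x hx => A.smul_mem _ hx, fun x hx _ => hx⟩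
  have := hA.add hA le_rfl
  omega

theorem exists_forall_pow_smul {A : Submodule (S p F) M.carrier} (e : S p F)
    (h : ∀ x ∈ B, ∃ k : ℕ, e ^ k • x ∈ A) : ∃ k : ℕ, ∀ x ∈ B, e ^ k • x ∈ A := by
  obtain ⟨k, hk⟩ := exists_pow_smul_le e (IsNoetherian.noetherian B) h
  exact ⟨k, fun x hx => hk ⟨x, hx, rfl⟩⟩

/-- The comparison of `D/A` and `B/A` when `B/D` is killed by a power of `u`. -/
theorem ModPPair.pair_of_isTorsion (h : M.ModPPair A B) (hD : M.IsSub D) (hAD : A ≤ D) (hDB : D ≤ B)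
    (hk : ∀ x ∈ B, ∃ k : ℕ, (PowerSeries.X : S p F) ^ k • x ∈ D) :
    M.pairRank A D = M.pairRank A B ∧ M.pairDeg A D ≤ M.pairDeg A B ∧
      (M.pairDeg A D = M.pairDeg A B → D = B) := by
  obtain ⟨k, hk⟩ := exists_forall_pow_smul _ hk
  have hAD' := h.mono_left hAD hDB hD
  rw [h.pairDeg_eq, h.pairRank_eq, hAD'.pairDeg_eq, hAD'.pairRank_eq]
  let f := M.subquotInclusion h.left hD h.right hAD hDB
  obtain ⟨h1, h2, h3⟩ := h.isModP.eDeg_of_isTorsion f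
    (subquotInclusion_injective h.left hD h.right hAD hDB) (k := k) (by
      rintro ⟨x⟩
      exact ⟨(M.subquotProj h.left hD hAD).toLin ⟨_, hk x.1 x.2⟩, rfl⟩)
  -- the factor `p - 1` of the length is positive, so equality of degrees forces length zero
  have hp : (1 : ℤ) ≤ (p : ℤ) - 1 := by have := (Fact.out : p.Prime).two_le; omega
  refine ⟨h1, ?_, fun heq => le_antisymm hDB fun x hx => ?_⟩
  · rw [h2]; nlinarith
  · rw [heq] at h2
    have h4 : ((relLen (LinearMap.range f.toLin) ⊤).toNat : ℤ) = 0 := by nlinarith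
    rw [Nat.cast_eq_zero, ENat.toNat_eq_zero, or_iff_left h3, relLen_eq_zero] at h4
    obtain ⟨⟨y⟩, hy⟩ := h4 (x := (M.subquotProj h.left h.right h.le).toLin ⟨x, hx⟩) trivial
    have : y.1 - x ∈ A := (Submodule.Quotient.eq
      (A.comap (M.subHom B h.right).toLin) (x := ⟨y.1, hDB y.2⟩) (y := ⟨x, hx⟩)).1 hy
    rw [← sub_sub_cancel y.1 x]
    exact D.sub_mem y.2 (hAD this)

/-- The saturation of `D` in `B` with respect to `u`, i.e. the preimage of the `u`-power torsion of
`B/D`. -/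
def saturation (M : PhiModule.{u, v} E) (D B : Submodule (S p F) M.carrier) :
    Submodule (S p F) M.carrier where
  carrier := {x | x ∈ B ∧ ∃ k : ℕ, (PowerSeries.X : S p F) ^ k • x ∈ D}
  add_mem' := by
    rintro x y ⟨hx, k, hk⟩ ⟨hy, l, hl⟩
    refine ⟨B.add_mem hx hy, k + l, ?_⟩
    rw [smul_add]
    refine D.add_mem ?_ ?_
    · rw [add_comm, pow_add, mul_smul]; exact D.smul_mem _ hk
    · rw [pow_add, mul_smul]; exact D.smul_mem _ hl
  zero_mem' := ⟨B.zero_mem, 0, by simp⟩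
  smul_mem' := by
    rintro c x ⟨hx, k, hk⟩
    exact ⟨B.smul_mem _ hx, k, by rw [smul_comm]; exact D.smul_mem _ hk⟩

/-- The saturation is a subobject with quotient free of `u`-torsion; it has the same rank, and a
degree that is larger unless `D` is saturated. -/
theorem ModPPair.saturation (h : M.ModPPair A B) (hD : M.IsSub D) (hAD : A ≤ D) (hDB : D ≤ B) :
    D ≤ M.saturation D B ∧ M.ModPPair (M.saturation D B) B ∧
    M.pairRank A D = M.pairRank A (M.saturation D B) ∧
    M.pairDeg A D ≤ M.pairDeg A (M.saturation D B) ∧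
    (M.pairDeg A D = M.pairDeg A (M.saturation D B) → D = M.saturation D B) := by
  have hle : D ≤ M.saturation D B := fun x hx => ⟨hDB hx, 0, by simpa⟩
  have hle' : M.saturation D B ≤ B := fun x hx => hx.1
  obtain ⟨k, hk⟩ := exists_forall_pow_smul (B := M.saturation D B) (A := D) PowerSeries.X
    fun x hx => hx.2
  have hsub : M.IsSub (M.saturation D B) :=
    hD.of_smul_le hle (fun x hx => hAD (h.p_smul x hx.1)) hk
  refine ⟨hle, ⟨hsub, h.right, hle', fun x hx => hle (hAD (h.p_smul x hx)), ?_⟩,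
    (h.mono_left (hAD.trans hle) hle' hsub).pair_of_isTorsion hD hAD hle fun x hx => hx.2⟩
  rintro x hx ⟨-, l, hl⟩
  exact ⟨hx, l + 1, by rwa [pow_succ, mul_smul]⟩

/-- A subobject of full rank has smaller degree, with equality only for the whole object. -/
theorem ModPPair.pair_of_rank_eq (h : M.ModPPair A B) (hD : M.IsSub D) (hAD : A ≤ D) (hDB : D ≤ B)
    (hr : M.pairRank A D = M.pairRank A B) :
    M.pairDeg A D ≤ M.pairDeg A B ∧ (M.pairDeg A D = M.pairDeg A B → D = B) := by
  obtain ⟨h1, h2, h3, -⟩ := h.saturation hD hAD hDB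
  have h4 := (h.add h2 (hAD.trans h1)).1
  have h5 := h2.eq_of_pairRank (by omega)
  refine (h.pair_of_isTorsion hD hAD hDB fun x hx => ?_).2
  rw [← h5] at hx
  exact hx.2

/-- If `E ^ k X ⊆ φ_X(φ^*X)`, then the same holds for each quotient `Y` of `X`, so that the degree
of `Y` is bounded below in terms of its rank. -/
theorem IsModP.le_eDeg (hY : Y.IsModP) (g : Hom X Y) (hg : Function.Surjective g.toLin) {k : ℕ}
    (hk : E.toS ^ k • X.lattice ≤ X.frobLattice) :
    -((E.poly.natDegree * k * Y.torsionRank : ℕ) : ℤ) ≤ Y.eDeg := by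
  have hk' : E.toS ^ k • Y.lattice ≤ Y.frobLattice := by
    rw [← g.map_lattice hg, ← g.map_frobLattice hg, ← Submodule.map_pointwise_smul]
    exact Submodule.map_mono hk
  have h1 : relLen Y.frobLattice Y.lattice ≤ relLen (E.toS ^ k • Y.lattice) Y.lattice :=
    relLen_le_of_le_left hk'
  have h2 := ENat.toNat_le_toNat h1 (hY.relLen_lattice_ne_top k)
  rw [hY.relLen_lattice, relLen_toS_pow_smul hY.p_smul hY.uTorsionFree, ENat.toNat_mul,
    ENat.toNat_natCast, ← torsionRank_eq] at h2
  rw [eDeg, relPos_def]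
  omega

/-- The degrees of the quotients of `B/A` are bounded below in terms of their ranks. -/
theorem ModPPair.exists_le_pairDeg (h : M.ModPPair A B) :
    ∃ c : ℕ, ∀ D, A ≤ D → M.ModPPair D B → -((c * M.pairRank D B : ℕ) : ℤ) ≤ M.pairDeg D B := by
  obtain ⟨k, hk⟩ := (M.subquot A B h.left h.right h.le).exists_smul_lattice_le
  refine ⟨E.poly.natDegree * k, fun D hAD hDB => ?_⟩
  rw [hDB.pairDeg_eq, hDB.pairRank_eq]
  exact hDB.isModP.le_eDeg (M.subquotFactor h.left hDB.left h.right hAD hDB.le)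
    (subquotFactor_surjective h.left hDB.left h.right hAD hDB.le) hk

end Perfect
end PhiModule
end Kisin

/-! ### Maximal destabilizing subobjects and modifications -/

namespace Kisin
namespace PhiModule

variable {p : ℕ} [Fact p.Prime] {F : Type u} [Field F] {E : EisensteinPoly p F}
variable {M : PhiModule.{u, v} E}

/-- `M` has no `p`-torsion, and `M/pM` has no `u`-torsion. Equivalently, `M` is a Kisin module; for
subobjects and quotients this is what can be checked directly. -/
structure IsRegular (M : PhiModule.{u, v} E) : Prop where
  eq_zero : ∀ x : M.carrier, (p : S p F) • x = 0 → x = 0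
  exists_eq : ∀ x y : M.carrier, (PowerSeries.X : S p F) • x = (p : S p F) • y →
    ∃ z, x = (p : S p F) • z

theorem IsRegular.inj (hM : M.IsRegular) {x y : M.carrier}
    (h : (p : S p F) • x = (p : S p F) • y) : x = y :=
  sub_eq_zero.1 (hM.eq_zero _ (by rw [smul_sub, h, sub_self]))

/-- The quotient of `M` by the submodule `A` has no `u`-torsion. -/
def USaturated (M : PhiModule.{u, v} E) (A : Submodule (S p F) M.carrier) : Prop :=
  ∀ x, (PowerSeries.X : S p F) • x ∈ A → x ∈ A

variable {A B C D Z : Submodule (S p F) M.carrier}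

theorem IsRegular.smul_mem_smul (hM : M.IsRegular) {x : M.carrier}
    (h : (p : S p F) • x ∈ (p : S p F) • A) : x ∈ A := by
  obtain ⟨y, hy, hxy⟩ := h
  rwa [← hM.inj hxy]

section Perfect

variable [CharP F p] [PerfectRing F p]

theorem IsRegular.modPPair_smul_self (hM : M.IsRegular) (hA : M.IsSub A) (hs : M.USaturated A) :
    M.ModPPair ((p : S p F) • A) A where
  left := hA.smul p
  right := hA
  le := smul_le_self _ _
  p_smul x hx := ⟨x, hx, rfl⟩
  sat := by
    rintro x hx ⟨y, hy, hxy⟩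
    obtain ⟨z, rfl⟩ := hM.exists_eq x y hxy.symm
    refine ⟨z, hs z ?_, rfl⟩
    rw [smul_comm] at hxy
    rwa [← hM.inj hxy]

/-- The subobject `B/Z` of `A/Z` has slope `μ` and rank `ρ`, and `(μ, ρ)` is the lexicographic
maximum over all nonzero subobjects. The slope is taken with respect to `e * deg`, and inequalities
of slopes are multiplied out. If `A/Z` is semi-stable, then `B = A`. -/
structure IsMaxDest (M : PhiModule.{u, v} E) (Z A B : Submodule (S p F) M.carrier) (μ : ℚ)
    (ρ : ℕ) : Prop where
  isSub : M.IsSub B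
  left_le : Z ≤ B
  modPPair : M.ModPPair B A
  ne : B ≠ Z
  rank_eq : M.pairRank Z B = ρ
  deg_eq : (M.pairDeg Z B : ℚ) = μ * ρ
  max : ∀ D, M.IsSub D → Z ≤ D → D ≤ A → D ≠ Z → (M.pairDeg Z D : ℚ) < μ * M.pairRank Z D ∨
    (M.pairDeg Z D : ℚ) = μ * M.pairRank Z D ∧ M.pairRank Z D ≤ ρ

theorem ModPPair.pairRank_le (h : M.ModPPair Z A) (hD : M.IsSub D) (hZD : Z ≤ D) (hDA : D ≤ A) :
    M.pairRank Z D ≤ M.pairRank Z A := by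
  obtain ⟨h1, h2, h3, -⟩ := h.saturation hD hZD hDA
  have := (h.add h2 (hZD.trans h1)).1
  omega

theorem ModPPair.pairRank_pos (h : M.ModPPair Z A) (hD : M.IsSub D) (hZD : Z ≤ D) (hDA : D ≤ A)
    (hne : D ≠ Z) : 0 < M.pairRank Z D :=
  Nat.pos_of_ne_zero fun h0 => hne ((h.mono_left hZD hDA hD).eq_of_pairRank h0).symm

/-- The degrees of the subobjects of `A/Z` are bounded above: after saturation this is the lower
bound `ModPPair.exists_le_pairDeg` for the degrees of the quotients. -/
theorem ModPPair.exists_pairDeg_le (h : M.ModPPair Z A) :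
    ∃ c : ℕ, ∀ D, M.IsSub D → Z ≤ D → D ≤ A → M.pairDeg Z D ≤ c := by
  obtain ⟨c, hc⟩ := h.exists_le_pairDeg
  refine ⟨(M.pairDeg Z A).toNat + c * M.pairRank Z A, fun D hD hZD hDA => ?_⟩
  obtain ⟨h1, h2, h3, h4, -⟩ := h.saturation hD hZD hDA
  have h5 := h.add h2 (hZD.trans h1)
  have h6 := hc _ (hZD.trans h1) h2
  have h7 : c * M.pairRank (M.saturation D A) A ≤ c * M.pairRank Z A :=
    Nat.mul_le_mul_left _ (by omega)
  have h8 := Int.self_le_toNat (M.pairDeg Z A)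
  push_cast at *
  omega

/-- If `m` is a multiple of the positive numbers `r, s ≤ R`, the comparison of the integers
`(R + 1) * (m * d / r) + r` is the lexicographic comparison of the pairs `(d / r, r)`. -/
theorem lex_of_le {R m r s : ℕ} {d d' : ℤ} (hm : 0 < m) (hr : 0 < r) (hs : 0 < s)
    (hsR : s ≤ R) (hrm : r ∣ m) (hsm : s ∣ m)
    (h : (R + 1) * (d * (m / r : ℕ)) + r ≤ (R + 1) * (d' * (m / s : ℕ)) + s) :
    (d : ℚ) < d' / s * r ∨ (d : ℚ) = d' / s * r ∧ r ≤ s := by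
  obtain ⟨a, ha⟩ := hrm
  obtain ⟨b, hb⟩ := hsm
  have ha' : m / r = a := by rw [ha, Nat.mul_div_cancel_left _ hr]
  have hb' : m / s = b := by rw [hb, Nat.mul_div_cancel_left _ hs]
  rw [ha', hb'] at h
  have hle : d * a ≤ d' * b := by
    by_contra hlt
    push Not at hlt
    nlinarith
  have hapos : 0 < a := Nat.pos_of_ne_zero (by rintro rfl; omega)
  have hr' : (0 : ℚ) < r := by exact_mod_cast hr
  have hs' : (0 : ℚ) < s := by exact_mod_cast hs
  have ha0 : (0 : ℚ) < a := by exact_mod_cast hapos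
  have hab : (r : ℚ) * a = s * b := by exact_mod_cast ha.symm.trans hb
  have key : (d' : ℚ) / s * r * a = d' * b := by
    rw [div_mul_eq_mul_div, div_mul_eq_mul_div, div_eq_iff hs'.ne']
    linear_combination (d' : ℚ) * hab
  rcases hle.lt_or_eq with hlt | heq
  · left
    have hlt' : (d : ℚ) * a < d' * b := by exact_mod_cast hlt
    exact lt_of_mul_lt_mul_right (hlt'.trans_eq key.symm) ha0.le
  · right
    have heq' : (d : ℚ) * a = d' * b := by exact_mod_cast heq
    refine ⟨mul_right_cancel₀ ha0.ne' (heq'.trans key.symm), ?_⟩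
    rw [heq] at h
    omega

/-- The maximal destabilizing subobject exists. The denominators of the slopes divide `R!`, for `R`
the rank of `A/Z`, so the lexicographic order on the pairs (slope, rank) is that of an integer. -/
theorem ModPPair.exists_isMaxDest (h : M.ModPPair Z A) (hne : A ≠ Z) :
    ∃ B μ ρ, M.IsMaxDest Z A B μ ρ := by
  set R := M.pairRank Z A
  obtain ⟨c, hc⟩ := h.exists_pairDeg_le
  let Ω : Submodule (S p F) M.carrier → ℤ := fun D =>
    (R + 1) * (M.pairDeg Z D * (R.factorial / M.pairRank Z D : ℕ)) + M.pairRank Z D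
  have hdvd : ∀ D, M.IsSub D → Z ≤ D → D ≤ A → D ≠ Z → M.pairRank Z D ∣ R.factorial :=
    fun D hD h1 h2 h3 =>
      Nat.dvd_factorial (h.pairRank_pos hD h1 h2 h3) (h.pairRank_le hD h1 h2)
  obtain ⟨_, ⟨B, hB, hZB, hBA, hBZ, rfl⟩, hmax⟩ := Int.exists_greatest_of_bdd
    (P := fun z => ∃ D, M.IsSub D ∧ Z ≤ D ∧ D ≤ A ∧ D ≠ Z ∧ z = Ω D)
    ⟨(R + 1) * (c * R.factorial) + R, by
      rintro _ ⟨D, hD, h1, h2, h3, rfl⟩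
      have e1 := hc D hD h1 h2
      have e2 := h.pairRank_le hD h1 h2
      have e3 : R.factorial / M.pairRank Z D ≤ R.factorial := Nat.div_le_self _ _
      have e4 : M.pairDeg Z D * (R.factorial / M.pairRank Z D : ℕ) ≤ c * R.factorial := by
        calc M.pairDeg Z D * (R.factorial / M.pairRank Z D : ℕ)
            ≤ c * (R.factorial / M.pairRank Z D : ℕ) :=
              mul_le_mul_of_nonneg_right e1 (Int.natCast_nonneg _)
          _ ≤ c * R.factorial :=
              mul_le_mul_of_nonneg_left (by exact_mod_cast e3) (Int.natCast_nonneg _)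
      have e5 : ((R : ℤ) + 1) * (M.pairDeg Z D * (R.factorial / M.pairRank Z D : ℕ)) ≤
          (R + 1) * (c * R.factorial) := mul_le_mul_of_nonneg_left e4 (by positivity)
      have e6 : (M.pairRank Z D : ℤ) ≤ R := by exact_mod_cast e2
      exact add_le_add e5 e6⟩
    ⟨_, A, h.right, h.le, le_rfl, hne, rfl⟩
  have hpos := h.pairRank_pos hB hZB hBA hBZ
  have hpos' : (0 : ℚ) < M.pairRank Z B := by exact_mod_cast hpos
  have hmax' : ∀ D, M.IsSub D → Z ≤ D → D ≤ A → D ≠ Z →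
      (M.pairDeg Z D : ℚ) < M.pairDeg Z B / M.pairRank Z B * M.pairRank Z D ∨
      (M.pairDeg Z D : ℚ) = M.pairDeg Z B / M.pairRank Z B * M.pairRank Z D ∧
        M.pairRank Z D ≤ M.pairRank Z B := fun D hD h1 h2 h3 =>
    lex_of_le (Nat.factorial_pos R) (h.pairRank_pos hD h1 h2 h3) hpos
      (h.pairRank_le hB hZB hBA) (hdvd D hD h1 h2 h3) (hdvd B hB hZB hBA hBZ)
      (hmax _ ⟨D, hD, h1, h2, h3, rfl⟩)
  have hdeg : (M.pairDeg Z B : ℚ) = M.pairDeg Z B / M.pairRank Z B * M.pairRank Z B :=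
    (div_mul_cancel₀ _ hpos'.ne').symm
  refine ⟨B, M.pairDeg Z B / M.pairRank Z B, M.pairRank Z B, hB, hZB, ?_, hBZ, rfl, hdeg, hmax'⟩
  obtain ⟨h1, h2, h3, h4, h5⟩ := h.saturation hB hZB hBA
  -- a maximum is saturated, since saturation would raise the degree
  have h6 : B = M.saturation B A := by
    refine h5 (le_antisymm h4 ?_)
    have hne' : M.saturation B A ≠ Z := fun h0 => hBZ (le_antisymm (h1.trans_eq h0) hZB)
    have h7 := hmax' _ h2.left (hZB.trans h1) h2.le hne'
    rw [← h3, ← hdeg] at h7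
    exact_mod_cast h7.elim le_of_lt fun h8 => h8.1.le
  rw [h6]
  exact h2

variable {μ μ' : ℚ} {ρ ρ' : ℕ}

theorem IsMaxDest.pairDeg_le (h : M.IsMaxDest Z A B μ ρ) (hZ : M.IsSub Z) (hD : M.IsSub D)
    (hZD : Z ≤ D) (hDA : D ≤ A) : (M.pairDeg Z D : ℚ) ≤ μ * M.pairRank Z D := by
  by_cases hDZ : D = Z
  · rw [hDZ, (pair_self hZ).1, (pair_self hZ).2]; simp
  · exact (h.max D hD hZD hDA hDZ).elim le_of_lt fun h8 => h8.1.le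

/-- The subobjects of `A/B` have slope less than `μ`. -/
theorem IsMaxDest.pairDeg_lt (h : M.IsMaxDest Z A B μ ρ) (hZA : M.ModPPair Z A) (hD : M.IsSub D)
    (hBD : B ≤ D) (hDA : D ≤ A) (hne : D ≠ B) :
    (M.pairDeg B D : ℚ) < μ * M.pairRank B D := by
  have hBD' := h.modPPair.mono_left hBD hDA hD
  have hadd := (hZA.mono_left (h.left_le.trans hBD) hDA hD).add hBD' h.left_le
  have hpos := h.modPPair.pairRank_pos hD hBD hDA hne
  have hDZ : D ≠ Z := fun h0 => h.ne (le_antisymm (hBD.trans_eq h0) h.left_le)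
  have hm := h.max D hD (h.left_le.trans hBD) hDA hDZ
  have hd := h.deg_eq
  rw [hadd.1, hadd.2, h.rank_eq] at hm
  push_cast at hm
  rcases hm with hm | ⟨-, hm⟩
  · linarith
  · omega

theorem IsMaxDest.uSaturated (h : M.IsMaxDest Z A B μ ρ) (hA : M.USaturated A) :
    M.USaturated B := fun x hx =>
  h.modPPair.sat x (hA x (h.modPPair.le hx)) hx

section Step

variable (hM : M.IsRegular) (hA : M.USaturated A) (h : M.IsMaxDest ((p : S p F) • A) A B μ ρ)
include hM hA h

/-- The modification `B ⊆ A` preserves the rank and the degree modulo `p`: both sides are built from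
`A/B ≃ pA/pB` and `B/pA`. -/
theorem IsMaxDest.pair_next :
    M.pairRank ((p : S p F) • B) B = M.pairRank ((p : S p F) • A) A ∧
      M.pairDeg ((p : S p F) • B) B = M.pairDeg ((p : S p F) • A) A := by
  have hpA := hM.modPPair_smul_self h.modPPair.right hA
  have hpB := hM.modPPair_smul_self h.isSub (h.uSaturated hA)
  have h1 := hpB.add (hpA.mono_left h.left_le h.modPPair.le h.isSub) (smul_mono _ h.modPPair.le)
  have h2 := hpA.add h.modPPair h.left_le
  have h3 := h.modPPair.smul hM.eq_zero
  omega

/-- The key comparison for the modification `B ⊆ A`: the subobjects of `B/pB` are no more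
destabilizing than `B/pA`, and those that are as destabilizing as `B/pA` split the extension
`0 → A/B → B/pB → B/pA → 0`. -/
theorem IsMaxDest.next (hD : M.IsSub D) (hBD : (p : S p F) • B ≤ D) (hDB : D ≤ B)
    (hne : D ≠ (p : S p F) • B) :
    (M.pairDeg ((p : S p F) • B) D : ℚ) < μ * M.pairRank ((p : S p F) • B) D ∨
    (M.pairDeg ((p : S p F) • B) D : ℚ) = μ * M.pairRank ((p : S p F) • B) D ∧
      M.pairRank ((p : S p F) • B) D ≤ ρ ∧
      (M.pairRank ((p : S p F) • B) D = ρ →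
        D ⊓ (p : S p F) • A = (p : S p F) • B ∧ D ⊔ (p : S p F) • A = B) := by
  have hpA := hM.modPPair_smul_self h.modPPair.right hA
  have hpB := hM.modPPair_smul_self h.isSub (h.uSaturated hA)
  have hAB := hpA.mono_left h.left_le h.modPPair.le h.isSub
  -- the intersection of `D` with the sub `A/B ≃ pA/pB` and its image in the quotient `B/pA`
  let K : Submodule (S p F) M.carrier := (D ⊓ (p : S p F) • A).comap (M.natMul p).toLin
  have hKmem : ∀ x, x ∈ K ↔ (p : S p F) • x ∈ D ∧ (p : S p F) • x ∈ (p : S p F) • A := fun x => by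
    rw [← natMul_apply]; rfl
  have hDA : M.IsSub (D ⊓ (p : S p F) • A) := hD.inf hpA.left
  have hK : M.IsSub K := hDA.comap' _
  have hpK : D ⊓ (p : S p F) • A = (p : S p F) • K := by
    ext x
    constructor
    · rintro ⟨h1, y, hy, rfl⟩
      exact ⟨y, (hKmem y).2 ⟨h1, y, hy, rfl⟩, rfl⟩
    · rintro ⟨y, hy, rfl⟩
      exact (hKmem y).1 hy
  have hBK : B ≤ K := fun x hx => (hKmem x).2 ⟨hBD ⟨x, hx, rfl⟩, x, h.modPPair.le hx, rfl⟩
  have hKA : K ≤ A := fun x hx => hM.smul_mem_smul ((hKmem x).1 hx).2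
  have hsup : M.IsSub (D ⊔ (p : S p F) • A) := hD.sup hpA.left
  have hsupB : D ⊔ (p : S p F) • A ≤ B := sup_le hDB h.left_le
  have hsupA : M.ModPPair ((p : S p F) • A) (D ⊔ (p : S p F) • A) :=
    hAB.mono_left le_sup_right hsupB hsup
  have hDadm := hpB.mono_left hBD hDB hD
  have hinf : M.ModPPair ((p : S p F) • A ⊓ D) D :=
    { left := by rw [inf_comm]; exact hDA
      right := hD
      le := inf_le_right
      p_smul := fun x hx => ⟨⟨x, h.modPPair.le (hDB hx), rfl⟩, D.smul_mem _ hx⟩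
      sat := fun x hx hXx => ⟨hpA.sat x (h.modPPair.le (hDB hx)) hXx.1, hx⟩ }
  have e1 := hDadm.add hinf (le_inf (smul_mono _ h.modPPair.le) hBD)
  have e2 := pair_inf_eq_sup hinf hsupA
  rw [inf_comm, hpK] at e1 e2
  have e3 := (h.modPPair.mono_left hBK hKA hK).smul hM.eq_zero
  have hr : M.pairRank ((p : S p F) • B) D =
      M.pairRank B K + M.pairRank ((p : S p F) • A) (D ⊔ (p : S p F) • A) := by omega
  have hd : M.pairDeg ((p : S p F) • B) D =
      M.pairDeg B K + M.pairDeg ((p : S p F) • A) (D ⊔ (p : S p F) • A) := by omega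
  have hle := h.pairDeg_le hpA.left hsup le_sup_right (hsupB.trans h.modPPair.le)
  -- if `D` does not meet `pA/pB`, it embeds into `B/pA`; otherwise `K/B` has
  -- slope less than `μ`
  by_cases hKB : K = B
  · rw [hKB, (pair_self h.isSub).1, zero_add] at hr
    rw [hKB, (pair_self h.isSub).2, zero_add] at hd
    rw [hKB] at hpK
    have hne' : D ⊔ (p : S p F) • A ≠ (p : S p F) • A := by
      intro h0
      apply hne
      rw [← hpK, eq_comm, inf_eq_left, ← h0]
      exact le_sup_left
    rw [hr, hd]
    refine (h.max _ hsup le_sup_right (hsupB.trans h.modPPair.le) hne').imp_right fun hm =>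
      ⟨hm.1, hm.2, fun hρ => ⟨hpK, ?_⟩⟩
    refine (hAB.pair_of_rank_eq hsup le_sup_right hsupB (by rw [hρ, h.rank_eq])).2 ?_
    have := h.deg_eq
    rw [← hρ, ← hm.1] at this
    exact_mod_cast this.symm
  · left
    have := h.pairDeg_lt hpA hK hBK hKA hKB
    rw [hr, hd]
    push_cast
    linarith

/-- A modification does not increase the pair `(μ, ρ)`. If the pair stays the same, then the maximal
destabilizing subobject of `B/pB` is a complement of `pA/pB`. -/
theorem IsMaxDest.next_lex (h' : M.IsMaxDest ((p : S p F) • B) B C μ' ρ') :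
    μ' < μ ∨ μ' = μ ∧ ρ' ≤ ρ ∧ (ρ' = ρ →
      C ⊓ (p : S p F) • A = (p : S p F) • B ∧ C ⊔ (p : S p F) • A = B) := by
  have hn := h.next hM hA h'.isSub h'.left_le h'.modPPair.le h'.ne
  have hpB := hM.modPPair_smul_self h.isSub (h.uSaturated hA)
  have hpos := hpB.pairRank_pos h'.isSub h'.left_le h'.modPPair.le h'.ne
  rw [h'.deg_eq, h'.rank_eq] at hn
  rw [h'.rank_eq] at hpos
  have hpos' : (0 : ℚ) < ρ' := by exact_mod_cast hpos
  refine hn.imp (fun hn => lt_of_mul_lt_mul_right hn hpos'.le) fun hn =>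
    ⟨mul_right_cancel₀ hpos'.ne' hn.1, hn.2⟩

end Step

end Perfect
end PhiModule
end Kisin

/-! ### Limits of modifications -/

namespace Kisin

section Complete

variable {p : ℕ} [Fact p.Prime] {F : Type u} [Field F] [CharP F p] [PerfectRing F p]

theorem exists_tsum_wittVector (c : ℕ → WittVector p F) :
    ∃ L, ∀ n, (p : WittVector p F) ^ n ∣
      L - ∑ i ∈ Finset.range n, (p : WittVector p F) ^ i * c i := by
  have h := IsPrecomplete.prec
    (inferInstance : IsPrecomplete (Ideal.span {(p : WittVector p F)}) (WittVector p F))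
    (f := fun n => ∑ i ∈ Finset.range n, (p : WittVector p F) ^ i * c i) (by
      intro m n hmn
      rw [SModEq.comm, SModEq.sub_mem, smul_eq_mul, Ideal.mul_top, Ideal.span_singleton_pow,
        Ideal.mem_span_singleton, ← Finset.sum_Ico_eq_sub _ hmn]
      exact Finset.dvd_sum fun i hi =>
        (pow_dvd_pow _ (Finset.mem_Ico.1 hi).1).mul_right _)
  obtain ⟨L, hL⟩ := h
  refine ⟨L, fun n => ?_⟩
  have := (hL n).symm
  rwa [SModEq.sub_mem, smul_eq_mul, Ideal.mul_top, Ideal.span_singleton_pow,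
    Ideal.mem_span_singleton] at this

/-- `𝔖` is `p`-adically complete, coefficient by coefficient. -/
theorem exists_tsum_powerSeries (c : ℕ → S p F) :
    ∃ L, ∀ n, (p : S p F) ^ n ∣ L - ∑ i ∈ Finset.range n, (p : S p F) ^ i * c i := by
  choose L hL using fun m => exists_tsum_wittVector fun i => PowerSeries.coeff m (c i)
  refine ⟨PowerSeries.mk L, fun n => ?_⟩
  rw [← Nat.cast_pow]
  refine natCast_dvd_of_coeff fun m => ?_
  have hc : ∀ (i : ℕ) (f : S p F), PowerSeries.coeff m ((p : S p F) ^ i * f) =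
      (p : WittVector p F) ^ i * PowerSeries.coeff m f := by
    intro i f
    rw [← map_natCast (PowerSeries.C (R := WittVector p F)), ← map_pow, PowerSeries.coeff_C_mul]
  rw [map_sub, map_sum, PowerSeries.coeff_mk, Nat.cast_pow]
  simp only [hc]
  exact hL m n

/-- Finitely generated `𝔖`-modules are `p`-adically complete. -/
theorem exists_tsum {M : Type*} [AddCommGroup M] [Module (S p F) M] [Module.Finite (S p F) M]
    (y : ℕ → M) :
    ∃ L : M, ∀ n, ∃ z : M,
      L - ∑ i ∈ Finset.range n, (p : S p F) ^ i • y i = (p : S p F) ^ n • z := by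
  obtain ⟨k, f, hf⟩ := Module.Finite.exists_fin' (S p F) M
  choose c hc using fun i => hf (y i)
  choose L hL using fun j => exists_tsum_powerSeries fun i => c i j
  choose z hz using fun n j => hL j n
  refine ⟨f L, fun n => ⟨f (z n), ?_⟩⟩
  rw [← map_smul]
  simp only [← hc, ← map_smul]
  rw [← map_sum, ← map_sub]
  congr 1
  funext j
  simp only [Pi.sub_apply, Finset.sum_apply, Pi.smul_apply, smul_eq_mul]
  exact hz n j

/-- Krull's intersection theorem for the `p`-adic topology. -/
theorem eq_zero_of_forall_pow {M : Type*} [AddCommGroup M] [Module (S p F) M]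
    [Module.Finite (S p F) M] {x : M} (h : ∀ n : ℕ, ∃ z : M, x = (p : S p F) ^ n • z) : x = 0 := by
  have hI : Ideal.span {(p : S p F)} ≠ ⊤ := by
    refine ne_top_of_le_ne_top (IsLocalRing.maximalIdeal.isMaximal (S p F)).ne_top ?_
    rw [maximalIdeal_eq]
    exact Ideal.span_mono (by simp)
  rw [← Submodule.mem_bot (S p F), ← Ideal.iInf_pow_smul_eq_bot_of_isLocalRing (M := M) _ hI,
    Submodule.mem_iInf]
  intro n
  obtain ⟨z, rfl⟩ := h n
  exact Submodule.smul_mem_smul (Ideal.pow_mem_pow (Ideal.mem_span_singleton_self _) n) trivial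

end Complete

namespace PhiModule

variable {p : ℕ} [Fact p.Prime] {F : Type u} [Field F] {E : EisensteinPoly p F}
variable {M : PhiModule.{u, v} E}

theorem eq_zero_of_toS_pow_smul {M : Type v} [AddCommGroup M] [Module (S p F) M]
    (E : EisensteinPoly p F) (h : UTorsionFree (p := p) (F := F) M) {n : ℕ}
    (hp : ∀ x : M, (p : S p F) ^ n • x = 0) {k : ℕ} {x : M} (hE : E.toS ^ k • x = 0) : x = 0 :=
  toLoc_injective E h hp (((toLoc_eq_zero_iff E).2 ⟨k, hE⟩).trans (map_zero _).symm)

section Perfect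

variable [CharP F p] [PerfectRing F p]

/-- The intersection `N` of a `p`-adically convergent sequence of saturated subobjects `A n = N + p
^ n M` is a subobject. As `M/A n` has no `E`-torsion, an element of `M` whose `E`-multiple lies in
`A n` lies in `A n`, so a bound for the denominators in `E` that holds in `M` holds for all `n` at
once; for the pullback one uses that `φ^*(M/N)` is `p`-adically separated. -/
theorem isSub_of_forall {N : Submodule (S p F) M.carrier} {A : ℕ → Submodule (S p F) M.carrier}
    (hA : ∀ n, M.IsSub (A n)) (hs : ∀ n, M.USaturated (A n)) (hp : ∀ n x, (p : S p F) ^ n • x ∈ A n)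
    (hle : ∀ n, N ≤ A n) (hinf : ∀ x, (∀ n, x ∈ A n) → x ∈ N)
    (heq : ∀ n, ∀ x ∈ A n, ∃ y ∈ N, ∃ z, x = y + (p : S p F) ^ n • z) : M.IsSub N := by
  have hutf : ∀ n, UTorsionFree (p := p) (F := F) (M.carrier ⧸ A n) := by
    rintro n ⟨x⟩ hx
    exact (Submodule.Quotient.mk_eq_zero _).2 (hs n x ((Submodule.Quotient.mk_eq_zero (A n)).1 hx))
  have hpk : ∀ n, ∀ x : M.carrier ⧸ A n, (p : S p F) ^ n • x = 0 := by
    rintro n ⟨x⟩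
    exact (Submodule.Quotient.mk_eq_zero _).2 (hp n x)
  have hpk' : ∀ n, ∀ x : Pullback p F (M.carrier ⧸ A n), (p : S p F) ^ n • x = 0 := by
    intro n x
    rw [← Nat.cast_pow]
    exact Pullback.natCast_smul_eq_zero (fun y => by rw [Nat.cast_pow, hpk]) x
  rw [mem_isSub_iff]
  constructor
  · intro t
    obtain ⟨k, m, hm⟩ := exists_pow_smul_eq_toLoc E (M.frob (toLoc E _ (Pullback.map N.subtype t)))
    refine (mem_range_locMap E).2 ⟨k, ⟨m, hinf m fun n => ?_⟩, hm⟩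
    have h1 : N.subtype = (A n).subtype ∘ₗ Submodule.inclusion (hle n) := rfl
    obtain ⟨l, a, ha⟩ := (mem_range_locMap E).1
      (((mem_isSub_iff E).1 (hA n)).1 (Pullback.map (Submodule.inclusion (hle n)) t))
    rw [← LinearMap.comp_apply (Pullback.map (A n).subtype), ← Pullback.map_comp, ← h1] at ha
    have h2 : toLoc E _ (E.toS ^ l • m - E.toS ^ k • (a : M.carrier)) = 0 := by
      rw [map_sub, map_smul, map_smul, ← hm]
      change _ - E.toS ^ k • toLoc E _ ((A n).subtype a) = 0
      rw [← ha, smul_comm, sub_self]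
    obtain ⟨j, hj⟩ := (toLoc_eq_zero_iff E).1 h2
    have h3 : E.toS ^ (j + l) • (A n).mkQ m = 0 := by
      have h4 := congrArg (A n).mkQ hj
      rw [map_smul, map_sub, map_smul, map_smul, map_zero,
        show (A n).mkQ (a : M.carrier) = 0 from (Submodule.Quotient.mk_eq_zero _).2 a.2,
        smul_zero, sub_zero, smul_smul, ← pow_add] at h4
      exact h4
    exact (Submodule.Quotient.mk_eq_zero _).1 (eq_zero_of_toS_pow_smul E (hutf n) (hpk n) h3)
  · intro x hx
    obtain ⟨k, t, ht⟩ := exists_pow_smul_eq_toLoc E (M.frob.symm (toLoc E _ x))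
    suffices h : t ∈ LinearMap.range (Pullback.map N.subtype) by
      obtain ⟨s, rfl⟩ := h
      exact (mem_range_locMap E).2 ⟨k, s, ht⟩
    have h1 : ∀ n, ∃ s, Pullback.map (A n).subtype s = t := by
      intro n
      have hex := Pullback.map_exact (LinearMap.exact_subtype_mkQ (A n)) (A n).mkQ_surjective
      refine (hex t).1 ?_
      obtain ⟨l, s, hls⟩ := (mem_range_locMap E).1 (((mem_isSub_iff E).1 (hA n)).2 x (hle n hx))
      have h2 : toLoc E _ (E.toS ^ l • t - E.toS ^ k • Pullback.map (A n).subtype s) = 0 := by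
        rw [map_sub, map_smul, map_smul, ← ht, ← hls, smul_comm, sub_self]
      obtain ⟨j, hj⟩ := (toLoc_eq_zero_iff E).1 h2
      have h4 := congrArg (Pullback.map (A n).mkQ) hj
      rw [map_smul, map_sub, map_smul, map_smul, map_zero, hex.apply_apply_eq_zero,
        smul_zero, sub_zero, smul_smul, ← pow_add] at h4
      exact eq_zero_of_toS_pow_smul E (hutf n).pullback (hpk' n) h4
    refine (Pullback.map_exact (LinearMap.exact_subtype_mkQ N) N.mkQ_surjective t).1 ?_
    refine eq_zero_of_forall_pow (p := p) (F := F) fun n => ?_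
    obtain ⟨s, rfl⟩ := h1 n
    let r : (M.carrier ⧸ N) →ₗ[S p F] M.carrier ⧸ N := (p : S p F) ^ n • LinearMap.id
    have hex := Pullback.map_exact (LinearMap.exact_map_mkQ_range r) (Submodule.mkQ_surjective _)
    have h0 : (LinearMap.range r).mkQ ∘ₗ N.mkQ ∘ₗ (A n).subtype = 0 := by
      ext a
      obtain ⟨y, hy, z, hz⟩ := heq n a a.2
      refine (Submodule.Quotient.mk_eq_zero _).2 ⟨N.mkQ z, ?_⟩
      change (p : S p F) ^ n • N.mkQ z = N.mkQ a
      rw [hz, map_add, map_smul, show N.mkQ y = 0 from (Submodule.Quotient.mk_eq_zero _).2 hy,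
        zero_add]
    obtain ⟨z, hz⟩ := (hex (Pullback.map N.mkQ (Pullback.map (A n).subtype s))).1 (by
      rw [← LinearMap.comp_apply (Pullback.map N.mkQ), ← Pullback.map_comp,
        ← LinearMap.comp_apply (Pullback.map _), ← Pullback.map_comp, h0, Pullback.map_zero]
      rfl)
    refine ⟨z, ?_⟩
    rw [← hz, Pullback.map_smul_id, map_pow, map_natCast]
    rfl

/-- The limit of a chain of modifications `A (n + 1) ⊆ A n` in which each `A (n + 2)` splits the
extension `0 → pA n/pA (n + 1) → A (n + 1)/pA (n + 1) → A (n + 1)/pA n → 0`. The intersection `N` of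
the chain satisfies `A n = N + p ^ n M`, and `M/N` has no `p`-torsion. -/
theorem chain_limit (hM : M.IsRegular) {A : ℕ → Submodule (S p F) M.carrier} (h0 : A 0 = ⊤)
    (hA : ∀ n, M.IsSub (A n)) (hs : ∀ n, M.USaturated (A n))
    (h1 : ∀ n, (p : S p F) • A n ≤ A (n + 1)) (h2 : ∀ n, A (n + 1) ≤ A n)
    (h3 : ∀ n, A (n + 2) ⊓ (p : S p F) • A n = (p : S p F) • A (n + 1))
    (h4 : ∀ n, A (n + 2) ⊔ (p : S p F) • A n = A (n + 1)) :
    ∃ N : Submodule (S p F) M.carrier, M.IsSub N ∧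
      (∀ x, (p : S p F) • x ∈ N → x ∈ N) ∧ N ⊔ (p : S p F) • ⊤ = A 1 := by
  have hp : ∀ n x, (p : S p F) ^ n • x ∈ A n := by
    intro n
    induction n with
    | zero => intro x; rw [h0]; trivial
    | succ n ih => intro x; rw [pow_succ', mul_smul]; exact h1 n ⟨_, ih x, rfl⟩
  have hanti : Antitone A := antitone_nat_of_succ_le h2
  -- consecutive terms differ by `p ^ n M`
  have hstep : ∀ n, ∀ x ∈ A n, ∃ y ∈ A (n + 1), ∃ w, x = y + (p : S p F) ^ n • w := by
    intro n
    induction n with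
    | zero => exact fun x _ => ⟨0, zero_mem _, x, by simp⟩
    | succ n ih =>
      intro x hx
      rw [← h4 n] at hx
      obtain ⟨y, hy, _, ⟨a, ha, rfl⟩, rfl⟩ := Submodule.mem_sup.1 hx
      obtain ⟨b, hb, w, rfl⟩ := ih a ha
      refine ⟨y + (p : S p F) • b, add_mem hy (h1 _ ⟨b, hb, rfl⟩), w, ?_⟩
      change y + (p : S p F) • (b + (p : S p F) ^ n • w) = _
      rw [smul_add, smul_smul, ← pow_succ', add_assoc]
  have hinfp : ∀ n x, (p : S p F) • x ∈ A (n + 1) → x ∈ A n := by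
    intro n
    induction n with
    | zero => intro x _; rw [h0]; trivial
    | succ n ih =>
      intro x hx
      have hx' : (p : S p F) • x ∈ A (n + 2) ⊓ (p : S p F) • A n :=
        ⟨hx, x, ih x (h2 _ hx), rfl⟩
      rw [h3] at hx'
      exact hM.smul_mem_smul hx'
  let N : Submodule (S p F) M.carrier := ⨅ n, A n
  have hN : ∀ x, x ∈ N ↔ ∀ n, x ∈ A n := fun x => Submodule.mem_iInf _
  -- summing the corrections of `hstep` from `n` on gives an element of the intersection
  have heq : ∀ n, ∀ x ∈ A n, ∃ y ∈ N, ∃ z, x = y + (p : S p F) ^ n • z := by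
    intro n x hx
    choose! f hf w hw using hstep
    let s : ℕ → M.carrier := fun i => Nat.rec x (fun i y => f (n + i) y) i
    have hs : ∀ i, s i ∈ A (n + i) := by
      intro i
      induction i with
      | zero => exact hx
      | succ i ih => exact hf (n + i) (s i) ih
    obtain ⟨L, hL⟩ := exists_tsum (p := p) (F := F) fun i => w (n + i) (s i)
    have hx' : ∀ i, x = s i +
        (p : S p F) ^ n • ∑ j ∈ Finset.range i, (p : S p F) ^ j • w (n + j) (s j) := by
      intro i
      induction i with
      | zero => simp [s]
      | succ i ih =>
        rw [Finset.sum_range_succ, smul_add, smul_smul, ← pow_add]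
        calc x = s i + _ := ih
          _ = (s (i + 1) + (p : S p F) ^ (n + i) • w (n + i) (s i)) + _ := by
            congr 1
            exact hw (n + i) (s i) (hs i)
          _ = _ := by abel
    refine ⟨x - (p : S p F) ^ n • L, (hN _).2 fun i => ?_, L, by simp⟩
    obtain ⟨z, hz⟩ := hL i
    refine hanti (Nat.le_add_left i n) ?_
    have : x - (p : S p F) ^ n • L = s i - (p : S p F) ^ (n + i) • z := by
      rw [pow_add, mul_smul, ← hz, smul_sub]
      nth_rewrite 1 [hx' i]
      abel
    rw [this]
    exact sub_mem (hs i) (hp _ z)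
  refine ⟨N, isSub_of_forall hA hs hp (fun n => iInf_le _ n) (fun x => (hN x).2) heq, ?_, ?_⟩
  · exact fun x hx => (hN x).2 fun n => hinfp n x ((hN _).1 hx _)
  · apply le_antisymm
    · refine sup_le (iInf_le _ 1) ?_
      rintro _ ⟨x, -, rfl⟩
      have := hp 1 x
      rwa [pow_one] at this
    · intro x hx
      obtain ⟨y, hy, z, rfl⟩ := heq 1 x hx
      rw [pow_one]
      exact Submodule.add_mem_sup hy ⟨z, trivial, rfl⟩

end Perfect
end PhiModule
end Kisin

/-! ### Freeness -/

namespace Kisin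

section FreeLocal

theorem maximalIdeal_eq_map {R R' : Type*} [CommRing R] [IsLocalRing R] [CommRing R']
    [IsLocalRing R']
    {f : R →+* R'} (hf : Function.Surjective f) :
    IsLocalRing.maximalIdeal R' = (IsLocalRing.maximalIdeal R).map f := by
  have := IsLocalHom.of_surjective f hf
  refine le_antisymm (fun y hy => ?_) (IsLocalRing.map_maximalIdeal_le f)
  obtain ⟨x, rfl⟩ := hf y
  exact Ideal.mem_map_of_mem f fun hx => hy (hx.map f)

/-- A finite module on which a generator of the maximal ideal acts injectively is free: it is so
modulo the maximal ideal, and freeness lifts along a regular element. -/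
theorem free_of_maximalIdeal_eq_span {R : Type*} [CommRing R] [IsLocalRing R] [IsNoetherianRing R]
    {a : R} (hm : IsLocalRing.maximalIdeal R = Ideal.span {a}) {M : Type*} [AddCommGroup M]
    [Module R M] [Module.Finite R M] (ha : ∀ x : M, a • x = 0 → x = 0) : Module.Free R M := by
  have := Module.finitePresentation_of_finite R M
  refine (Module.free_quotSMulTop_iff_free (R := R) (M := M) (x := a) ?_
    (isSMulRegular_iff_right_eq_zero_of_smul.2 ha)).1 ?_
  · rw [IsLocalRing.jacobson_eq_maximalIdeal _ bot_ne_top, hm]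
    exact Ideal.mem_span_singleton_self a
  · have : (Ideal.span {a}).IsMaximal := by
      rw [← hm]; exact IsLocalRing.maximalIdeal.isMaximal R
    let _ : Field (R ⧸ Ideal.span {a}) := Ideal.Quotient.field _
    exact Module.Free.of_divisionRing _ _

/-- If `a, b` generate the maximal ideal of a Noetherian local ring and form a regular sequence on
the finite module `M`, then `M` is free. -/
theorem free_of_maximalIdeal_eq_span_pair {R : Type*} [CommRing R] [IsLocalRing R]
    [IsNoetherianRing R] {a b : R} (hm : IsLocalRing.maximalIdeal R = Ideal.span {a, b})
    {M : Type*} [AddCommGroup M] [Module R M] [Module.Finite R M]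
    (ha : ∀ x : M, a • x = 0 → x = 0) (hb : ∀ x y : M, b • x = a • y → ∃ z, x = a • z) :
    Module.Free R M := by
  have ha' : a ∈ IsLocalRing.maximalIdeal R := hm ▸ Ideal.subset_span (by simp)
  have : Nontrivial (R ⧸ Ideal.span {a}) := by
    refine Ideal.Quotient.nontrivial_iff.2 fun h => ?_
    rw [Ideal.span_singleton_eq_top] at h
    exact ha' h
  have hfin : Module.FinitePresentation R M := Module.finitePresentation_of_finite R M
  refine (Module.free_quotSMulTop_iff_free (R := R) (M := M) (x := a)
    (by rwa [IsLocalRing.jacobson_eq_maximalIdeal _ bot_ne_top])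
    (isSMulRegular_iff_right_eq_zero_of_smul.2 ha)).1 ?_
  have : IsLocalRing (R ⧸ Ideal.span {a}) :=
    IsLocalRing.of_surjective' (Ideal.Quotient.mk _) Ideal.Quotient.mk_surjective
  have hfin' : Module.Finite (R ⧸ Ideal.span {a}) (QuotSMulTop a M) :=
    Module.Finite.of_restrictScalars_finite R _ _
  have hmax : IsLocalRing.maximalIdeal (R ⧸ Ideal.span {a}) =
      Ideal.span {Ideal.Quotient.mk (Ideal.span {a}) b} := by
    rw [maximalIdeal_eq_map (Ideal.Quotient.mk_surjective (I := Ideal.span {a})), hm,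
      Ideal.map_span, Set.image_pair, Ideal.Quotient.mk_singleton_self, Ideal.span_insert_zero]
  refine free_of_maximalIdeal_eq_span hmax ?_
  rintro ⟨x⟩ hx
  obtain ⟨y, -, hy⟩ := (Submodule.Quotient.mk_eq_zero (a • ⊤ : Submodule R M)).1
    (show Submodule.Quotient.mk (b • x) = 0 from hx)
  obtain ⟨z, rfl⟩ := hb x y hy.symm
  exact (Submodule.Quotient.mk_eq_zero _).2 ⟨z, trivial, rfl⟩

theorem exists_eq_smul_of_free {R M : Type*} [CommRing R] [AddCommGroup M] [Module R M]
    [Module.Free R M] {a b : R} (h : ∀ f, a ∣ b * f → a ∣ f) {x y : M} (hxy : b • x = a • y) :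
    ∃ z, x = a • z := by
  let B := Module.Free.chooseBasis R M
  have h1 : ∀ i, ∃ c, B.repr x i = a * c := fun i => h _ ⟨B.repr y i, by
    have := congrArg (fun v => B.repr v i) hxy
    simpa using this⟩
  choose c hc using h1
  refine ⟨∑ i ∈ (B.repr x).support, c i • B i, ?_⟩
  rw [Finset.smul_sum]
  conv_lhs => rw [← B.linearCombination_repr x, Finsupp.linearCombination_apply, Finsupp.sum]
  exact Finset.sum_congr rfl fun i _ => by rw [hc, mul_smul]

end FreeLocal

section Ring

variable {p : ℕ} [Fact p.Prime] {F : Type u} [Field F]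

theorem p_dvd_of_dvd_toS_mul (E : EisensteinPoly p F) {f : S p F} (h : (p : S p F) ∣ E.toS * f) :
    (p : S p F) ∣ f := by
  obtain ⟨g, hg⟩ := E.toS_eq
  have hX : ∀ n : ℕ, ∀ f : S p F, (p : S p F) ∣ PowerSeries.X ^ n * f → (p : S p F) ∣ f := by
    intro n
    induction n with
    | zero => intro f hf; simpa using hf
    | succ n ih =>
      intro f hf
      refine ih f ?_
      rw [← Ideal.mem_span_singleton] at hf ⊢
      refine X_smul_mem_span_p ?_
      rwa [← mul_assoc, ← pow_succ']
  refine hX E.poly.natDegree f ?_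
  have : PowerSeries.X ^ E.poly.natDegree * f = E.toS * f - (p : S p F) * (g * f) := by
    rw [hg]; ring
  rw [this]
  exact dvd_sub h (dvd_mul_right _ _)

variable [CharP F p]

theorem natCast_p_ne_zero : (p : S p F) ≠ 0 := by
  rw [← map_natCast (PowerSeries.C (R := WittVector p F)), ne_eq,
    map_eq_zero_iff _ (PowerSeries.C_injective)]
  exact WittVector.p_nonzero p F

variable [PerfectRing F p]

/-- As `E` is an Eisenstein polynomial, `p` is, up to a unit, the `e`-th power of `u` modulo `E`. -/
theorem exists_unit_toS_eq (E : EisensteinPoly p F) :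
    ∃ g : S p F, IsUnit g ∧ E.toS = PowerSeries.X ^ E.poly.natDegree + (p : S p F) * g := by
  obtain ⟨g, hg⟩ := E.toS_eq
  refine ⟨g, ?_, hg⟩
  by_contra hu
  have h0 : PowerSeries.constantCoeff g ∈ Ideal.span {(p : WittVector p F)} := by
    rw [WittVector.mem_span_p_iff_coeff_zero_eq_zero]
    by_contra h
    exact hu (PowerSeries.isUnit_iff_constantCoeff.2
      (WittVector.isUnit_of_coeff_zero_ne_zero _ h))
  refine E.isEisensteinAt.notMem ?_
  have h1 : E.poly.coeff 0 = PowerSeries.constantCoeff E.toS := by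
    rw [EisensteinPoly.toS, Polynomial.constantCoeff_coe]
  rw [h1, hg, map_add, map_pow, PowerSeries.constantCoeff_X, zero_pow E.natDegree_pos.ne', zero_add,
    map_mul, map_natCast, pow_two]
  exact Ideal.mul_mem_mul (Ideal.mem_span_singleton_self _) h0

end Ring

namespace PhiModule

variable {p : ℕ} [Fact p.Prime] {F : Type u} [Field F] {E : EisensteinPoly p F}
variable {M : PhiModule.{u, v} E}

theorem IsKisin.isRegular (hM : M.IsKisin) [CharP F p] : M.IsRegular := by
  have : Module.Free (S p F) M.carrier := hM
  refine ⟨fun x hx => (smul_eq_zero.1 hx).resolve_left natCast_p_ne_zero, fun x y hxy =>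
    exists_eq_smul_of_free (fun f hf => ?_) hxy⟩
  rw [← Ideal.mem_span_singleton] at hf ⊢
  exact X_smul_mem_span_p hf

variable [CharP F p] [PerfectRing F p]

/-- The maximal ideal of `𝔖` is `(p, u)`, so a finite module with regular sequence `p, u` is free.
-/
theorem IsRegular.isKisin (hM : M.IsRegular) : M.IsKisin :=
  free_of_maximalIdeal_eq_span_pair (maximalIdeal_eq p F) hM.eq_zero hM.exists_eq

end PhiModule
end Kisin

/-! ### Reduction modulo `p` and localization at `(E)` -/

namespace Kisin

section LocLength

variable {p : ℕ} [Fact p.Prime] {F : Type u} [Field F] [CharP F p] [PerfectRing F p]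
variable (E : EisensteinPoly p F)
variable {K Q Q' V V' : Type*} [AddCommGroup K] [Module (S p F) K] [AddCommGroup Q]
  [Module (S p F) Q] [AddCommGroup Q'] [Module (S p F) Q'] [AddCommGroup V] [Module (S p F) V]
  [AddCommGroup V'] [Module (S p F) V']

/-- The complement of the prime ideal `(E)` of `𝔖`. -/
noncomputable abbrev EisensteinPoly.compl : Submonoid (S p F) := (Ideal.span {E.toS}).primeCompl

variable (Q) in
/-- The length of the localization of `Q` at the prime ideal `(E)`. -/
noncomputable def locLength : ℕ∞ :=
  Module.length (Localization E.compl) (LocalizedModule E.compl Q)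

theorem locLength_of_exact {f : K →ₗ[S p F] Q} {g : Q →ₗ[S p F] Q'} (hf : Function.Injective f)
    (hg : Function.Surjective g) (h : Function.Exact f g) :
    locLength E Q = locLength E K + locLength E Q' :=
  Module.length_eq_add_of_exact (LocalizedModule.map E.compl f) (LocalizedModule.map E.compl g)
    (LocalizedModule.map_injective _ f hf) (LocalizedModule.map_surjective _ g hg)
    (LocalizedModule.map_exact _ f g h)

theorem locLength_of_subsingleton [Subsingleton Q] : locLength E Q = 0 :=
  Module.length_eq_zero

theorem locLength_congr (e : Q ≃ₗ[S p F] Q') : locLength E Q = locLength E Q' :=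
  le_antisymm
    (Module.length_le_of_injective (LocalizedModule.map E.compl e.toLinearMap)
      (LocalizedModule.map_injective _ _ e.injective))
    (Module.length_le_of_injective (LocalizedModule.map E.compl e.symm.toLinearMap)
      (LocalizedModule.map_injective _ _ e.symm.injective))

/-- The localization of `𝔖/(E)` at `(E)` is the residue field of `𝔖_(E)`. -/
theorem locLength_quot : locLength E (S p F ⧸ Ideal.span {E.toS}) = 1 := by
  rw [locLength, Module.length_eq_one_iff, isSimpleModule_iff_toSpanSingleton_surjective]
  constructor
  · rw [← not_subsingleton_iff_nontrivial, LocalizedModule.subsingleton_iff]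
    intro h
    obtain ⟨r, hr, h1⟩ := h (Submodule.Quotient.mk 1)
    refine hr ((Submodule.Quotient.mk_eq_zero (Ideal.span {E.toS})).1 ?_)
    rwa [← Submodule.Quotient.mk_smul, smul_eq_mul, mul_one] at h1
  · intro x hx y
    induction x using LocalizedModule.induction_on with | _ a s
    induction y using LocalizedModule.induction_on with | _ b t
    obtain ⟨a, rfl⟩ := Submodule.Quotient.mk_surjective _ a
    obtain ⟨b, rfl⟩ := Submodule.Quotient.mk_surjective _ b
    have ha : a ∈ E.compl := fun ha => hx (by
      rw [(Submodule.Quotient.mk_eq_zero (Ideal.span {E.toS})).2 ha, LocalizedModule.zero_mk])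
    refine ⟨Localization.mk (b * s) (⟨a, ha⟩ * t), ?_⟩
    rw [LinearMap.toSpanSingleton_apply, LocalizedModule.mk_smul_mk, LocalizedModule.mk_eq]
    refine ⟨1, ?_⟩
    rw [one_smul, one_smul]
    change Submodule.Quotient.mk ((t : S p F) * ((b * s) * a)) =
      Submodule.Quotient.mk ((a * t * s : S p F) * b)
    congr 1
    ring

/-- The length of `Q/pQ` is `e` times the length of the localization of `Q` at `(E)`, and the latter
is finite. -/
structure LengthFormula (Q : Type*) [AddCommGroup Q] [Module (S p F) Q] : Prop where
  eq : relLen ((p : S p F) • ⊤ : Submodule (S p F) Q) ⊤ = E.poly.natDegree * locLength E Q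
  ne_top : locLength E Q ≠ ⊤

variable {E}

/-- The formula is additive in short exact sequences, provided that the reduction modulo `p` remains
exact. -/
theorem LengthFormula.of_exact {f : K →ₗ[S p F] Q} {g : Q →ₗ[S p F] Q'}
    (hK : LengthFormula E K) (hQ' : LengthFormula E Q')
    (hf : Function.Injective f) (hg : Function.Surjective g) (h : Function.Exact f g)
    (hp : ∀ x : Q', (p : S p F) • x = 0 → x = 0) : LengthFormula E Q := by
  constructor
  · have hc : ((p : S p F) • ⊤ : Submodule (S p F) Q).comap f = (p : S p F) • ⊤ := by
      ext x
      constructor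
      · rintro ⟨y, -, hy⟩
        have hy' : (p : S p F) • y = f x := hy
        obtain ⟨z, rfl⟩ := (h y).1 (hp _ (by rw [← map_smul, hy', h.apply_apply_eq_zero]))
        exact ⟨z, trivial, hf (by rw [← hy', ← map_smul]; rfl)⟩
      · rintro ⟨y, -, rfl⟩
        exact ⟨f y, trivial, (map_smul f _ _).symm⟩
    rw [relLen_of_exact h le_top, hc, Submodule.map_pointwise_smul, Submodule.map_top,
      LinearMap.range_eq_top.2 hg, Submodule.comap_top, hK.eq, hQ'.eq, locLength_of_exact E hf hg h,
      mul_add]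
  · rw [locLength_of_exact E hf hg h]
    exact enat_add_ne_top hK.ne_top hQ'.ne_top

theorem LengthFormula.of_subsingleton [Subsingleton Q] : LengthFormula E Q where
  eq := by
    rw [locLength_of_subsingleton, relLen_eq_zero.2, mul_zero]
    intro x _
    rw [Subsingleton.elim x 0]
    exact zero_mem _
  ne_top := by rw [locLength_of_subsingleton]; simp

theorem LengthFormula.congr (hK : LengthFormula E K) (e : K ≃ₗ[S p F] Q) : LengthFormula E Q :=
  hK.of_exact (.of_subsingleton (Q := PUnit.{1})) (f := e.toLinearMap) (g := 0) e.injective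
    (fun _ => ⟨0, rfl⟩) (fun y => ⟨fun _ => ⟨e.symm y, by simp⟩, fun _ => rfl⟩) fun _ _ => rfl

variable (E) in
/-- Both lengths are known for `𝔖/(E)`: `𝔖/(E, p) = 𝔖/(p, u ^ e)` has length `e`. -/
theorem lengthFormula_quot : LengthFormula E (S p F ⧸ Ideal.span {E.toS}) where
  eq := by
    have h1 : Submodule.map (Ideal.span {E.toS}).mkQ
        (Ideal.span {(p : S p F), PowerSeries.X ^ E.poly.natDegree}) = (p : S p F) • ⊤ := by
      obtain ⟨g, hg⟩ := E.toS_eq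
      have h0 : Ideal.span {(p : S p F), PowerSeries.X ^ E.poly.natDegree} =
          Ideal.span {E.toS, (p : S p F)} := by
        apply le_antisymm <;> rw [Ideal.span_le]
        · rintro _ (rfl | rfl)
          · exact Ideal.subset_span (by simp)
          · exact Ideal.mem_span_pair.2 ⟨1, -g, by rw [hg]; ring⟩
        · rintro _ (rfl | rfl)
          · exact Ideal.mem_span_pair.2 ⟨g, 1, by rw [hg]; ring⟩
          · exact Ideal.subset_span (by simp)
      rw [h0, Ideal.span_insert, Submodule.map_sup, Submodule.mkQ_map_self, bot_sup_eq,
        ← Submodule.range_mkQ (Ideal.span {E.toS}), ← Submodule.map_top,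
        ← Submodule.map_pointwise_smul]
      congr 1
      rw [← Submodule.ideal_span_singleton_smul, smul_eq_mul, Ideal.mul_top]
    have h2 : Ideal.span {E.toS} ≤ Ideal.span {(p : S p F), PowerSeries.X ^ E.poly.natDegree} := by
      obtain ⟨g, hg⟩ := E.toS_eq
      rw [Ideal.span_singleton_le_iff_mem, hg, Ideal.mem_span_pair]
      exact ⟨g, 1, by ring⟩
    have h3 := relLen_map_mkQ h2 le_top
    rw [h1, Submodule.map_top, Submodule.range_mkQ] at h3
    rw [h3, relLen_top, length_quot_span_pair, locLength_quot, mul_one]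
  ne_top := by rw [locLength_quot]; simp

theorem LengthFormula.pi (hK : LengthFormula E K) (hp : ∀ x : K, (p : S p F) • x = 0 → x = 0)
    (n : ℕ) : LengthFormula E (Fin n → K) := by
  induction n with
  | zero => exact .of_subsingleton
  | succ n ih =>
    refine hK.of_exact ih (f := LinearMap.single _ _ 0) (g := LinearMap.funLeft _ _ Fin.succ)
      (LinearMap.ker_eq_bot.1 (LinearMap.ker_single _ _ 0))
      (LinearMap.funLeft_surjective_of_injective _ _ _ (Fin.succ_injective n)) ?_ ?_
    · intro x
      constructor
      · intro hx
        refine ⟨x 0, ?_⟩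
        ext i
        refine Fin.cases ?_ (fun i => ?_) i
        · simp
        · have := congrFun hx i
          simpa using this.symm
      · rintro ⟨y, rfl⟩
        ext i
        simp
    · intro x hx
      ext i
      exact hp _ (congrFun hx i)

/-- A finite module over `𝔖/(E)`, a discrete valuation ring with uniformizer `u`, is free if it has
no `p`-torsion, since `p` is a unit times `u ^ e` there. -/
theorem lengthFormula_of_smul [Module.Finite (S p F) K] (hE : ∀ x : K, E.toS • x = 0)
    (hp : ∀ x : K, (p : S p F) • x = 0 → x = 0) : LengthFormula E K := by
  let O := S p F ⧸ Ideal.span {E.toS}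
  have hm : Module.IsTorsionBySet (S p F) K (Ideal.span {E.toS} : Set (S p F)) := by
    rintro x ⟨a, ha⟩
    obtain ⟨b, rfl⟩ := Ideal.mem_span_singleton'.1 ha
    change (b * E.toS) • x = 0
    rw [mul_smul, hE, smul_zero]
  let _ : Module O K := hm.module
  have : IsScalarTower (S p F) O K := hm.isScalarTower
  have : Module.Finite O K := Module.Finite.of_restrictScalars_finite (S p F) _ _
  obtain ⟨g, hg, hgE⟩ := exists_unit_toS_eq E
  have hX : UTorsionFree (p := p) (F := F) K := by
    intro x hx
    have h1 := hE x
    rw [hgE, add_smul, ← Nat.succ_pred_eq_of_pos E.natDegree_pos, pow_succ, mul_smul, hx,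
      smul_zero, zero_add, mul_smul] at h1
    exact hg.smul_eq_zero.1 (hp _ h1)
  have : IsLocalRing O :=
    IsLocalRing.of_surjective' (Ideal.Quotient.mk _) Ideal.Quotient.mk_surjective
  have hmax : IsLocalRing.maximalIdeal O = Ideal.span {Ideal.Quotient.mk _ PowerSeries.X} := by
    rw [maximalIdeal_eq_map (Ideal.Quotient.mk_surjective (I := Ideal.span {E.toS})),
      maximalIdeal_eq, Ideal.map_span, Set.image_pair]
    refine Submodule.span_insert_eq_span (R := O) (M := O) ?_
    have h1 : Ideal.Quotient.mk (Ideal.span {E.toS}) (PowerSeries.X ^ E.poly.natDegree) +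
        Ideal.Quotient.mk (Ideal.span {E.toS}) p *
          Ideal.Quotient.mk (Ideal.span {E.toS}) g = 0 := by
      rw [← map_mul, ← map_add, ← hgE]
      exact Ideal.Quotient.eq_zero_iff_mem.2 (Ideal.mem_span_singleton_self _)
    have h2 : PowerSeries.X ∣ PowerSeries.X ^ E.poly.natDegree :=
      dvd_pow_self (PowerSeries.X : S p F) E.natDegree_pos.ne'
    refine Ideal.mem_span_singleton.2
      ((hg.map (Ideal.Quotient.mk (Ideal.span {E.toS}))).dvd_mul_right.1 ?_)
    rw [eq_neg_of_add_eq_zero_right h1]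
    exact (map_dvd (Ideal.Quotient.mk (Ideal.span {E.toS})) h2).neg_right
  have : Module.Free O K := free_of_maximalIdeal_eq_span hmax fun x hx => hX x hx
  refine ((lengthFormula_quot E).pi ?_ _).congr
    ((Module.finBasis O K).equivFun.symm.restrictScalars (S p F))
  rintro ⟨x⟩ hx
  obtain ⟨y, hy⟩ := Ideal.mem_span_singleton.1
    ((Submodule.Quotient.mk_eq_zero (Ideal.span {E.toS})).1 hx)
  obtain ⟨z, rfl⟩ := p_dvd_of_dvd_toS_mul E ⟨x, hy.symm⟩
  refine (Submodule.Quotient.mk_eq_zero _).2 (Ideal.mem_span_singleton.2 ⟨z, ?_⟩)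
  refine mul_left_cancel₀ natCast_p_ne_zero ?_
  rw [mul_left_comm]
  exact hy

/-- Dévissage along the multiplication by `E`. -/
theorem lengthFormula_of_pow_smul (k : ℕ) : ∀ {Q : Type v} [AddCommGroup Q] [Module (S p F) Q]
    [Module.Finite (S p F) Q], (∀ x : Q, E.toS ^ k • x = 0) →
    (∀ x : Q, (p : S p F) • x = 0 → x = 0) → LengthFormula E Q := by
  induction k with
  | zero =>
    intro Q _ _ _ hE _
    have : Subsingleton Q := subsingleton_of_forall_eq 0 fun x => by simpa using hE x
    exact .of_subsingleton
  | succ k ih =>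
    intro Q _ _ _ hE hp
    let f : Q →ₗ[S p F] Q := E.toS • LinearMap.id
    refine LengthFormula.of_exact (f := (LinearMap.ker f).subtype) (g := f.rangeRestrict)
      (lengthFormula_of_smul ?_ ?_) (ih ?_ ?_) (Submodule.injective_subtype _)
      f.surjective_rangeRestrict ?_ ?_
    · rintro ⟨x, hx⟩
      exact Subtype.ext hx
    · rintro ⟨x, hx⟩ h
      exact Subtype.ext (hp x (congrArg Subtype.val h))
    · rintro ⟨_, x, rfl⟩
      refine Subtype.ext ?_
      change E.toS ^ k • E.toS • x = 0
      rw [smul_smul, ← pow_succ]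
      exact hE x
    · rintro ⟨x, hx⟩ h
      exact Subtype.ext (hp x (congrArg Subtype.val h))
    · rw [LinearMap.exact_iff, LinearMap.ker_rangeRestrict, Submodule.range_subtype]
    · rintro ⟨x, hx⟩ h
      exact Subtype.ext (hp x (congrArg Subtype.val h))

theorem relLen_ker {R V V' : Type*} [CommRing R] [AddCommGroup V] [Module R V] [AddCommGroup V']
    [Module R V'] (g : V →ₗ[R] V') (B : Submodule R V) :
    relLen (LinearMap.ker g) B = Module.length R (B.map g) := by
  have hk : LinearMap.ker (g ∘ₗ B.subtype) = (LinearMap.ker g).submoduleOf B :=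
    LinearMap.ker_comp _ _
  have hr : LinearMap.range (g ∘ₗ B.subtype) = B.map g := by
    rw [LinearMap.range_comp, Submodule.range_subtype]
  rw [relLen, ← hk, ← hr]
  exact (g ∘ₗ B.subtype).quotKerEquivRange.length_eq

/-- Localization at `(E)` turns the relative length of submodules into the length of the localized
subquotient. -/
theorem relLen_localized (A B : Submodule (S p F) V) :
    relLen (A.localized E.compl) (B.localized E.compl) = locLength E (B ⧸ A.submoduleOf B) := by
  let f : B →ₗ[S p F] V ⧸ A := A.mkQ ∘ₗ B.subtype
  have hk : LinearMap.ker f = A.submoduleOf B := by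
    rw [LinearMap.ker_comp, Submodule.ker_mkQ]; rfl
  have h1 := LinearMap.localized'_ker_eq_ker_localizedMap (Localization E.compl) E.compl
    (LocalizedModule.mkLinearMap E.compl V) (LocalizedModule.mkLinearMap E.compl _) A.mkQ
  have h2 := LinearMap.localized'_range_eq_range_localizedMap (Localization E.compl) E.compl
    (LocalizedModule.mkLinearMap E.compl B) (LocalizedModule.mkLinearMap E.compl V) B.subtype
  have h3 := LinearMap.localized'_range_eq_range_localizedMap (Localization E.compl) E.compl
    (LocalizedModule.mkLinearMap E.compl B) (LocalizedModule.mkLinearMap E.compl _) f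
  rw [Submodule.ker_mkQ] at h1
  rw [Submodule.range_subtype] at h2
  refine (congrArg₂ relLen h1 h2).trans ?_
  rw [relLen_ker, ← LinearMap.range_comp]
  have h5 : LocalizedModule.map E.compl f =
      LocalizedModule.map E.compl A.mkQ ∘ₗ LocalizedModule.map E.compl B.subtype := by
    refine LinearMap.ext fun x => ?_
    exact LinearMap.congr_fun (IsLocalizedModule.map_comp' E.compl
      (LocalizedModule.mkLinearMap E.compl B) (LocalizedModule.mkLinearMap E.compl V)
      (LocalizedModule.mkLinearMap E.compl _) B.subtype A.mkQ) x
  have h6 : (LinearMap.range f).localized E.compl =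
      LinearMap.range (LocalizedModule.map E.compl A.mkQ ∘ₗ
        LocalizedModule.map E.compl B.subtype) := h5 ▸ h3
  have h7 : Module.length (Localization E.compl) ((LinearMap.range f).localized E.compl) =
      locLength E (LinearMap.range f) :=
    LinearEquiv.length_eq (R := Localization E.compl)
      (M := (LinearMap.range f).localized E.compl)
      (N := LocalizedModule E.compl (LinearMap.range f))
      (Submodule.localizedEquiv E.compl (LinearMap.range f))
  rw [h6] at h7
  rw [← hk]
  exact h7.trans (locLength_congr E f.quotKerEquivRange.symm)

/-- Comparison of a relative length after reduction modulo `p` and after localization at `(E)`. The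
hypotheses on `A` and `B` say that `A/pA` and `B/pB` have no `E`-torsion; hence `B/A` has no
`p`-torsion, and reduction modulo `p` maps it onto `(B/A)/p`. -/
theorem relLen_map_eq_mul_relLen_localized {q : V →ₗ[S p F] V'}
    (hq : LinearMap.ker q = (p : S p F) • ⊤) {A B : Submodule (S p F) V} (hfg : B.FG) (hAB : A ≤ B)
    {k : ℕ} (hk : E.toS ^ k • B ≤ A)
    (hp : ∀ x : V, (p : S p F) • x = 0 → x = 0)
    (hA : ∀ x ∈ A, E.toS • x ∈ (p : S p F) • A → x ∈ (p : S p F) • A)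
    (hB : ∀ x ∈ B, E.toS • x ∈ (p : S p F) • B → x ∈ (p : S p F) • B)
    (hV : ∀ x : V, ∃ l : ℕ, E.toS ^ l • x ∈ B) :
    relLen (A.map q) (B.map q) =
        E.poly.natDegree * relLen (A.localized E.compl) (B.localized E.compl) ∧
      relLen (A.localized E.compl) (B.localized E.compl) ≠ ⊤ := by
  have hpow : ∀ {N : Submodule (S p F) V},
      (∀ x ∈ N, E.toS • x ∈ (p : S p F) • N → x ∈ (p : S p F) • N) → ∀ (n : ℕ), ∀ x ∈ N,
      E.toS ^ n • x ∈ (p : S p F) • N → x ∈ (p : S p F) • N := by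
    intro N hN n
    induction n with
    | zero => intro x _ h; simpa using h
    | succ n ih =>
      intro x hx h
      refine hN x hx (ih _ (N.smul_mem _ hx) ?_)
      rwa [smul_smul, ← pow_succ]
  have : Module.Finite (S p F) B := Module.Finite.iff_fg.2 hfg
  have hD : LengthFormula E (B ⧸ A.submoduleOf B) := by
    refine lengthFormula_of_pow_smul k ?_ ?_
    · rintro ⟨x⟩
      exact (Submodule.Quotient.mk_eq_zero _).2 (hk ⟨x.1, x.2, rfl⟩)
    · rintro ⟨x⟩ hx
      have hx' : (p : S p F) • x.1 ∈ A := (Submodule.Quotient.mk_eq_zero (A.submoduleOf B)).1 hx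
      obtain ⟨y, hy, hxy⟩ := hpow hA k _ hx'
        ⟨E.toS ^ k • x.1, hk ⟨x.1, x.2, rfl⟩, smul_comm (p : S p F) (E.toS ^ k) x.1⟩
      refine (Submodule.Quotient.mk_eq_zero _).2 ?_
      have : x.1 = y := sub_eq_zero.1 (hp _ (by
        rw [smul_sub, sub_eq_zero]; exact hxy.symm))
      change x.1 ∈ A
      rwa [this]
  rw [relLen_localized]
  refine ⟨?_, hD.ne_top⟩
  rw [← hD.eq, relLen_top, relLen_eq_length_map_mkQ]
  let f : B →ₗ[S p F] V' ⧸ A.map q := (A.map q).mkQ ∘ₗ q ∘ₗ B.subtype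
  let g := ((p : S p F) • ⊤ : Submodule (S p F) (B ⧸ A.submoduleOf B)).mkQ ∘ₗ
    (A.submoduleOf B).mkQ
  have hg : Function.Surjective g :=
    (Submodule.mkQ_surjective _).comp (Submodule.mkQ_surjective _)
  have hf : LinearMap.range f = (B.map q).map (A.map q).mkQ := by
    rw [LinearMap.range_comp, LinearMap.range_comp, Submodule.range_subtype]
  have hfg : LinearMap.ker f = LinearMap.ker g := by
    ext x
    have h1 : x ∈ LinearMap.ker f ↔ q x ∈ A.map q := Submodule.Quotient.mk_eq_zero _
    have h2 : x ∈ LinearMap.ker g ↔ (A.submoduleOf B).mkQ x ∈ (p : S p F) • ⊤ :=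
      Submodule.Quotient.mk_eq_zero _
    rw [h1, h2]
    constructor
    · rintro ⟨a, ha, hax⟩
      obtain ⟨v, -, hv⟩ : x.1 - a ∈ (p : S p F) • ⊤ := by
        rw [← hq, LinearMap.mem_ker, map_sub, hax, sub_self]
      have hv : (p : S p F) • v = x.1 - a := hv
      obtain ⟨l, hl⟩ := hV v
      obtain ⟨y, hy, hxy⟩ := hpow hB l (x.1 - a) (sub_mem x.2 (hAB ha))
        ⟨_, hl, by rw [← hv, smul_comm]; rfl⟩
      refine ⟨Submodule.Quotient.mk ⟨y, hy⟩, trivial, (Submodule.Quotient.eq _).2 ?_⟩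
      have hxy : (p : S p F) • y = x.1 - a := hxy
      change (p : S p F) • y - x.1 ∈ A
      rw [hxy, sub_sub_cancel_left]
      exact neg_mem ha
    · rintro ⟨⟨y⟩, -, hy⟩
      have hy : (p : S p F) • y.1 - x.1 ∈ A :=
        (Submodule.Quotient.eq (A.submoduleOf B)).1 hy
      refine ⟨_, neg_mem hy, ?_⟩
      have h0 : q ((p : S p F) • y.1) = 0 := by
        rw [← LinearMap.mem_ker, hq]
        exact ⟨_, trivial, rfl⟩
      rw [neg_sub, map_sub, h0, sub_zero]
  rw [← hf, ← f.quotKerEquivRange.length_eq, hfg]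
  exact (g.quotKerEquivOfSurjective hg).length_eq

end LocLength
end Kisin

/-! ### Slopes of Kisin modules -/

namespace Kisin

section Free

variable {p : ℕ} [Fact p.Prime] {F : Type u} [Field F] (E : EisensteinPoly p F)

theorem toS_ne_zero : E.toS ≠ 0 := by
  rw [EisensteinPoly.toS, ne_eq, Polynomial.coe_eq_zero_iff]
  exact E.monic.ne_zero

/-- If `N` is a free lattice, then `N/pN` has no `E`-torsion. -/
theorem mem_smul_of_toS_smul_mem {Y V : Type*} [AddCommGroup Y] [Module (S p F) Y]
    [Module.Free (S p F) Y] [AddCommGroup V] [Module (S p F) V] {j : Y →ₗ[S p F] V}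
    (hj : Function.Injective j) {N : Submodule (S p F) V} (hN : LinearMap.range j = N) :
    ∀ x ∈ N, E.toS • x ∈ (p : S p F) • N → x ∈ (p : S p F) • N := by
  subst hN
  rintro _ ⟨y, rfl⟩ ⟨_, ⟨z, rfl⟩, hz⟩
  have hz : (p : S p F) • j z = E.toS • j y := hz
  obtain ⟨w, rfl⟩ := exists_eq_smul_of_free (fun f hf => p_dvd_of_dvd_toS_mul E hf)
    (hj (by rw [map_smul, map_smul, hz]) : E.toS • y = (p : S p F) • z)
  exact ⟨j w, ⟨w, rfl⟩, (map_smul j _ _).symm⟩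

variable [CharP F p]

theorem toLoc_injective_of_free (M : Type v) [AddCommGroup M] [Module (S p F) M]
    [Module.Free (S p F) M] : Function.Injective (toLoc E M) := by
  rw [injective_iff_map_eq_zero]
  intro x hx
  obtain ⟨k, hk⟩ := (toLoc_eq_zero_iff E).1 hx
  exact (smul_eq_zero.1 hk).resolve_left (pow_ne_zero k (toS_ne_zero E))

end Free

namespace PhiModule

variable {p : ℕ} [Fact p.Prime] {F : Type u} [Field F] {E : EisensteinPoly p F}
variable (X : PhiModule.{u, v} E)

theorem locMap_natMul (a : ℕ) (x : Loc E X.carrier) :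
    locMap E (X.natMul a).toLin x = (a : S p F) • x := by
  have h : locMap E (a • (LinearMap.id : X.carrier →ₗ[S p F] X.carrier)) = a • LinearMap.id := by
    rw [locMap, map_nsmul, IsLocalizedModule.map_id]
  rw [Nat.cast_smul_eq_nsmul]
  exact LinearMap.congr_fun h x

/-- The projection `M → M/aM`. -/
noncomputable def modNatProj (a : ℕ) : Hom X (X.modNat a) :=
  X.mkQHom _ (X.natMul a).isSub_range

theorem modNatProj_surjective (a : ℕ) : Function.Surjective (X.modNatProj a).toLin :=
  Submodule.mkQ_surjective _

theorem ker_modNatProj (a : ℕ) : LinearMap.ker (X.modNatProj a).toLin = (a : S p F) • ⊤ :=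
  (Submodule.ker_mkQ _).trans (X.range_natMul a)

theorem ker_locMap_modNatProj (a : ℕ) :
    LinearMap.ker (locMap E (X.modNatProj a).toLin) = (a : S p F) • ⊤ := by
  have h : Function.Exact (X.natMul a).toLin (X.modNatProj a).toLin :=
    LinearMap.exact_iff.2 (Submodule.ker_mkQ _)
  rw [LinearMap.exact_iff.1 (locMap_exact E h)]
  ext x
  constructor
  · rintro ⟨y, rfl⟩
    exact ⟨y, trivial, (X.locMap_natMul a y).symm⟩
  · rintro ⟨y, -, rfl⟩
    exact ⟨y, X.locMap_natMul a y⟩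

variable [CharP F p] [PerfectRing F p] {X}

theorem localized_mono {R V : Type*} [CommRing R] [AddCommGroup V] [Module R V] (T : Submonoid R)
    {A B : Submodule R V} (h : A ≤ B) : A.localized T ≤ B.localized T :=
  (Submodule.localized'gi (Localization T) T (LocalizedModule.mkLinearMap T V)).gc.monotone_l h

/-- The degree of a Kisin module is the degree of its reduction modulo `p`. Both relative positions
are computed from the common sublattice `E ^ l φ_M(φ^*M)`. -/
theorem IsKisin.eDeg_modNat (hX : X.IsKisin) :
    (X.modNat p).eDeg = E.poly.natDegree * X.deg := by
  have : Module.Free (S p F) X.carrier := hX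
  obtain ⟨k, hk⟩ := X.exists_smul_lattice_le
  obtain ⟨l, hl⟩ := X.exists_smul_frobLattice_le
  let j : Pullback p F X.carrier →ₗ[S p F] Loc E X.carrier :=
    X.frob.toLinearMap ∘ₗ toLoc E (Pullback p F X.carrier)
  have hj : Function.Injective j := X.frob.injective.comp (toLoc_injective_of_free E _)
  have hjr : LinearMap.range j = X.frobLattice := LinearMap.range_comp _ _
  have hEinj := toS_pow_smul_injective E X.carrier l
  let j' : Pullback p F X.carrier →ₗ[S p F] Loc E X.carrier := E.toS ^ l • j
  have hj' : Function.Injective j' := hEinj.comp hj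
  have hjr' : LinearMap.range j' = E.toS ^ l • X.frobLattice := by
    rw [← hjr]
    exact LinearMap.range_comp j (DistribSMul.toLinearMap (S p F) (Loc E X.carrier) (E.toS ^ l))
  have hp : ∀ x : Loc E X.carrier, (p : S p F) • x = 0 → x = 0 := by
    intro x hx
    refine (injective_iff_map_eq_zero _).1 (locMap_injective E (f := (X.natMul p).toLin) ?_) x
      ((X.locMap_natMul p x).trans hx)
    rw [injective_iff_map_eq_zero]
    intro y hy
    rw [natMul_apply] at hy
    exact hX.isRegular.eq_zero y hy
  have hV : ∀ x : Loc E X.carrier, ∃ l : ℕ, E.toS ^ l • x ∈ X.lattice := fun x => by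
    obtain ⟨k, y, h⟩ := exists_pow_smul_eq_toLoc E x
    exact ⟨k, y, h.symm⟩
  have hV' : ∀ x : Loc E X.carrier, ∃ l : ℕ, E.toS ^ l • x ∈ X.frobLattice := fun x => by
    obtain ⟨m, hm⟩ := hV x
    exact ⟨k + m, hk ⟨_, hm, by rw [pow_add, mul_smul]; rfl⟩⟩
  have hΨ := mem_smul_of_toS_smul_mem E hj' hjr'
  have hle : E.toS ^ l • X.frobLattice ≤ X.frobLattice := smul_le_self _ _
  obtain ⟨e₁, f₁⟩ := relLen_map_eq_mul_relLen_localized (X.ker_locMap_modNatProj p) X.fg_lattice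
    hl (k := l + k) (by rw [pow_add, mul_smul]; exact smul_mono _ hk) hp hΨ
    (mem_smul_of_toS_smul_mem E (toLoc_injective_of_free E _) rfl) hV
  obtain ⟨e₂, f₂⟩ := relLen_map_eq_mul_relLen_localized (X.ker_locMap_modNatProj p)
    X.fg_frobLattice hle (k := l) le_rfl hp hΨ (mem_smul_of_toS_smul_mem E hj hjr) hV'
  have h1 := relPos_eq (localized_mono _ hl) (localized_mono _ hle) f₁ f₂
  have hfin : ∀ {a : ℕ∞}, a ≠ ⊤ → (E.poly.natDegree : ℕ∞) * a ≠ ⊤ := fun ha =>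
    enat_mul_ne_top (ENat.natCast_ne_top _) ha
  have h2 := relPos_eq (Submodule.map_mono hl) (Submodule.map_mono hle)
    (e₁ ▸ hfin f₁) (e₂ ▸ hfin f₂)
  rw [(X.modNatProj p).map_lattice (X.modNatProj_surjective p)] at h2 e₁
  rw [(X.modNatProj p).map_frobLattice (X.modNatProj_surjective p)] at h2 e₂
  rw [eDeg, h2, e₁, e₂, deg, h1, ENat.toNat_mul, ENat.toNat_mul, ENat.toNat_natCast]
  push_cast
  ring

/-- The quotient of `M/pM` by `u` is the fibre of `M` over the residue field of `𝔖`. -/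
theorem IsKisin.torsionRank_modNat (hX : X.IsKisin) : (X.modNat p).torsionRank = X.rank := by
  have : Module.Free (S p F) X.carrier := hX
  let m := IsLocalRing.maximalIdeal (S p F)
  let f : X.carrier →ₗ[S p F] _ := (Ideal.span {(PowerSeries.X : S p F)} •
    (⊤ : Submodule (S p F) (X.modNat p).carrier)).mkQ ∘ₗ (X.modNatProj p).toLin
  have hf : Function.Surjective f := (Submodule.mkQ_surjective _).comp (X.modNatProj_surjective p)
  have hk : LinearMap.ker f = m • (⊤ : Submodule (S p F) X.carrier) := by
    change LinearMap.ker (_ ∘ₗ _) = _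
    rw [LinearMap.ker_comp, Submodule.ker_mkQ,
      ← LinearMap.range_eq_top.2 (X.modNatProj_surjective p),
      LinearMap.range_eq_map, ← Submodule.map_smul'', Submodule.comap_map_eq, ker_modNatProj,
      ← Submodule.ideal_span_singleton_smul, ← Submodule.sup_smul, ← Ideal.span_union]
    rw [Set.singleton_union, Set.pair_comm, ← maximalIdeal_eq]
  have h1 := (f.quotKerEquivOfSurjective hf).length_eq
  rw [hk] at h1
  rw [torsionRank, ← h1, ← (TensorProduct.quotTensorEquivQuotSMul X.carrier m).length_eq]
  let _ : Field (S p F ⧸ m) := Ideal.Quotient.field m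
  rw [Module.length_eq_of_surjective (R := S p F ⧸ m) Ideal.Quotient.mk_surjective,
    Module.length_eq_finrank, Module.finrank_baseChange, ENat.toNat_natCast, rank]

theorem IsKisin.slope_eq (hX : X.IsKisin) : X.slope = (X.modNat p).torsionSlope := by
  rw [torsionSlope, torsionDeg_eq, hX.eDeg_modNat, hX.torsionRank_modNat, slope]
  have := E.natDegree_pos
  push_cast
  rw [mul_div_cancel_left₀]
  exact_mod_cast this.ne'

end PhiModule
end Kisin

/-! ### Semi-stable subquotients -/

namespace Kisin
namespace PhiModule

variable {p : ℕ} [Fact p.Prime] {F : Type u} [Field F] {E : EisensteinPoly p F}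
variable {M W X Y Q : PhiModule.{u, v} E}

theorem map_sup_smul (f : W.carrier →ₗ[S p F] M.carrier) (a : S p F)
    (C D : Submodule (S p F) W.carrier) :
    (C ⊔ a • D).map f = C.map f ⊔ a • D.map f := by
  rw [Submodule.map_sup, Submodule.map_pointwise_smul]

theorem comap_sup_smul {f : M.carrier →ₗ[S p F] Q.carrier} (hf : Function.Surjective f) (a : S p F)
    (C D : Submodule (S p F) Q.carrier) :
    (C ⊔ a • D).comap f = C.comap f ⊔ a • D.comap f := by
  have hk : LinearMap.ker f ≤ C.comap f ⊔ a • D.comap f :=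
    le_sup_of_le_left (LinearMap.ker_le_comap f)
  rw [← Submodule.comap_map_eq_self hk, map_sup_smul, Submodule.map_comap_eq_of_surjective hf,
    Submodule.map_comap_eq_of_surjective hf]

theorem torsionSlope_eq (X : PhiModule.{u, v} E) :
    X.torsionSlope = X.eDeg / E.poly.natDegree / X.torsionRank := by
  rw [torsionSlope, torsionDeg_eq]

variable [CharP F p] [PerfectRing F p]

section Transfer

/-- Invariance of rank and degree under an injective morphism. -/
theorem ModPPair.map {C D : Submodule (S p F) W.carrier} (h : W.ModPPair C D) (i : Hom W M)
    (hi : Function.Injective i.toLin) : M.ModPPair (C.map i.toLin) (D.map i.toLin) ∧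
      M.pairRank (C.map i.toLin) (D.map i.toLin) = W.pairRank C D ∧
      M.pairDeg (C.map i.toLin) (D.map i.toLin) = W.pairDeg C D := by
  have hadm : M.ModPPair (C.map i.toLin) (D.map i.toLin) :=
    { left := h.left.map i
      right := h.right.map i
      le := Submodule.map_mono h.le
      p_smul := by
        rintro _ ⟨x, hx, rfl⟩
        exact ⟨_, h.p_smul x hx, map_smul i.toLin _ _⟩
      sat := by
        rintro _ ⟨x, hx, rfl⟩ ⟨y, hy, hxy⟩
        rw [← map_smul] at hxy
        exact ⟨x, h.sat x hx (hi hxy ▸ hy), rfl⟩ }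
  let P : M.Presents (W.sub D h.right) (W.subquot C D h.left h.right h.le)
      (C.map i.toLin) (D.map i.toLin) :=
    { i := i.comp (W.subHom D h.right)
      g := W.subquotProj h.left h.right h.le
      inj := hi.comp D.injective_subtype
      range := (LinearMap.range_comp _ _).trans (congrArg _ D.range_subtype)
      surj := subquotProj_surjective h.left h.right h.le
      ker := fun w => (subquotProj_eq_zero h.left h.right h.le w).trans
        ⟨fun hw => ⟨_, hw, rfl⟩, fun ⟨y, hy, hyw⟩ => hi hyw ▸ hy⟩ }
  have := P.eq_pair hadm
  rw [h.pairRank_eq, h.pairDeg_eq]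
  exact ⟨hadm, this.1.symm, this.2.symm⟩

/-- Invariance of rank and degree under preimages along a surjective morphism. -/
theorem ModPPair.comap {C D : Submodule (S p F) Q.carrier} (h : Q.ModPPair C D) (f : Hom M Q)
    (hf : Function.Surjective f.toLin) : M.ModPPair (C.comap f.toLin) (D.comap f.toLin) ∧
      M.pairRank (C.comap f.toLin) (D.comap f.toLin) = Q.pairRank C D ∧
      M.pairDeg (C.comap f.toLin) (D.comap f.toLin) = Q.pairDeg C D := by
  have hadm : M.ModPPair (C.comap f.toLin) (D.comap f.toLin) :=
    { left := h.left.comap' f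
      right := h.right.comap' f
      le := Submodule.comap_mono h.le
      p_smul := fun x hx => by
        rw [Submodule.mem_comap, map_smul]
        exact h.p_smul _ hx
      sat := fun x hx hXx => by
        rw [Submodule.mem_comap, map_smul] at hXx
        exact h.sat _ hx hXx }
  let P : M.Presents (M.sub (D.comap f.toLin) hadm.right) (Q.subquot C D h.left h.right h.le)
      (C.comap f.toLin) (D.comap f.toLin) :=
    { i := M.subHom _ hadm.right
      g := (Q.subquotProj h.left h.right h.le).comp
        (Hom.codRestrict (f.comp (M.subHom _ hadm.right)) D h.right fun x => x.2)
      inj := (D.comap f.toLin).injective_subtype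
      range := (D.comap f.toLin).range_subtype
      surj := by
        refine (subquotProj_surjective h.left h.right h.le).comp ?_
        rintro ⟨y, hy⟩
        obtain ⟨x, rfl⟩ := hf y
        exact ⟨⟨x, hy⟩, rfl⟩
      ker := fun w => subquotProj_eq_zero h.left h.right h.le _ }
  have := P.eq_pair hadm
  rw [h.pairRank_eq, h.pairDeg_eq]
  exact ⟨hadm, this.1.symm, this.2.symm⟩

/-- For subobjects `A ⊆ B` of `M`, the quotient `B/A` is a semi-stable Kisin module, of slope `μ`
with respect to `e * deg`. The conditions are phrased inside `M`: by `tf` and `sat` the sequence `p,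
u` is regular on `B/A`, so that `B/A` is free, and the reduction of `B/A` modulo `p` is `B/(A +
pB)`. In `deg_le` the subobjects need not be saturated. -/
structure SemistablePair (M : PhiModule.{u, v} E) (A B : Submodule (S p F) M.carrier) (μ : ℚ) :
    Prop where
  left : M.IsSub A
  right : M.IsSub B
  le : A ≤ B
  ne : A ⊔ (p : S p F) • B ≠ B
  tf : ∀ x ∈ B, (p : S p F) • x ∈ A → x ∈ A
  sat : ∀ x ∈ B, (PowerSeries.X : S p F) • x ∈ A ⊔ (p : S p F) • B → x ∈ A ⊔ (p : S p F) • B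
  deg_eq : (M.pairDeg (A ⊔ (p : S p F) • B) B : ℚ) = μ * M.pairRank (A ⊔ (p : S p F) • B) B
  deg_le : ∀ D, M.IsSub D → A ⊔ (p : S p F) • B ≤ D → D ≤ B →
    (M.pairDeg (A ⊔ (p : S p F) • B) D : ℚ) ≤ μ * M.pairRank (A ⊔ (p : S p F) • B) D

variable {A B : Submodule (S p F) M.carrier} {μ : ℚ}

theorem SemistablePair.modPPair (h : M.SemistablePair A B μ) :
    M.ModPPair (A ⊔ (p : S p F) • B) B where
  left := h.left.sup (h.right.smul p)
  right := h.right
  le := sup_le h.le (smul_le_self _ _)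
  p_smul x hx := Submodule.mem_sup_right ⟨x, hx, rfl⟩
  sat := h.sat

theorem SemistablePair.comap {C D : Submodule (S p F) Q.carrier} (h : Q.SemistablePair C D μ)
    (f : Hom M Q) (hf : Function.Surjective f.toLin) :
    M.SemistablePair (C.comap f.toLin) (D.comap f.toLin) μ := by
  obtain ⟨h1, h2, h3⟩ := h.modPPair.comap f hf
  have hZ := comap_sup_smul hf (p : S p F) C D
  rw [hZ] at h1 h2 h3
  exact {
    left := h.left.comap' f
    right := h.right.comap' f
    le := Submodule.comap_mono h.le
    ne := fun heq => h.ne (Submodule.comap_injective_of_surjective hf (hZ.trans heq))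
    tf := fun x hx hpx => by
      rw [Submodule.mem_comap, map_smul] at hpx
      exact h.tf _ hx hpx
    sat := h1.sat
    deg_eq := by rw [h2, h3, h.deg_eq]
    deg_le := fun D' hD' h4 h5 => by
      have h6 : (D'.map f.toLin).comap f.toLin = D' := Submodule.comap_map_eq_self
        ((LinearMap.ker_le_comap f.toLin).trans (le_sup_left.trans h4))
      have h7 : C ⊔ (p : S p F) • D ≤ D'.map f.toLin := by
        rw [← Submodule.comap_le_comap_iff_of_surjective hf, hZ, h6]
        exact h4
      have h8 : D'.map f.toLin ≤ D := by
        rw [← Submodule.comap_le_comap_iff_of_surjective hf, h6]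
        exact h5
      have h9 := (h.modPPair.mono_left h7 h8 (hD'.map f)).comap f hf
      rw [hZ, h6] at h9
      rw [h9.2.1, h9.2.2]
      exact h.deg_le _ (hD'.map f) h7 h8 }

theorem SemistablePair.map {C D : Submodule (S p F) W.carrier} (h : W.SemistablePair C D μ)
    (i : Hom W M) (hi : Function.Injective i.toLin) :
    M.SemistablePair (C.map i.toLin) (D.map i.toLin) μ := by
  obtain ⟨h1, h2, h3⟩ := h.modPPair.map i hi
  have hZ := map_sup_smul i.toLin (p : S p F) C D
  rw [hZ] at h1 h2 h3
  exact {
    left := h.left.map i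
    right := h.right.map i
    le := Submodule.map_mono h.le
    ne := fun heq => h.ne (Submodule.map_injective_of_injective hi (hZ.trans heq))
    tf := by
      rintro _ ⟨x, hx, rfl⟩ ⟨y, hy, hxy⟩
      rw [← map_smul] at hxy
      exact ⟨x, h.tf x hx (hi hxy ▸ hy), rfl⟩
    sat := h1.sat
    deg_eq := by rw [h2, h3, h.deg_eq]
    deg_le := fun D' hD' h4 h5 => by
      have h6 : (D'.comap i.toLin).map i.toLin = D' := Submodule.map_comap_eq_self
        (h5.trans LinearMap.map_le_range)
      have h7 : C ⊔ (p : S p F) • D ≤ D'.comap i.toLin := by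
        rw [← Submodule.map_le_iff_le_comap, hZ]
        exact h4
      have h8 : D'.comap i.toLin ≤ D := by
        rw [← Submodule.map_le_map_iff_of_injective hi, h6]
        exact h5
      have h9 := (h.modPPair.mono_left h7 h8 (hD'.comap' i)).map i hi
      rw [hZ, h6] at h9
      rw [h9.2.1, h9.2.2]
      exact h.deg_le _ (hD'.comap' i) h7 h8 }

theorem IsSub.of_map {C : Submodule (S p F) W.carrier} {i : Hom W M}
    (hi : Function.Injective i.toLin) (h : M.IsSub (C.map i.toLin)) : W.IsSub C := by
  have := h.comap' i
  rwa [Submodule.comap_map_eq_of_injective hi] at this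

theorem ModPPair.of_map {C D : Submodule (S p F) W.carrier} {i : Hom W M}
    (hi : Function.Injective i.toLin) (h : M.ModPPair (C.map i.toLin) (D.map i.toLin)) :
    W.ModPPair C D where
  left := h.left.of_map hi
  right := h.right.of_map hi
  le := (Submodule.map_le_map_iff_of_injective hi _ _).1 h.le
  p_smul x hx := by
    obtain ⟨y, hy, hxy⟩ := h.p_smul _ (Submodule.mem_map_of_mem hx)
    rw [← map_smul] at hxy
    exact hi hxy ▸ hy
  sat x hx hXx := by
    obtain ⟨y, hy, hxy⟩ := h.sat _ (Submodule.mem_map_of_mem hx) ⟨_, hXx, map_smul i.toLin _ _⟩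
    exact hi hxy ▸ hy

theorem SemistablePair.of_map {C D : Submodule (S p F) W.carrier} {i : Hom W M}
    (hi : Function.Injective i.toLin) (h : M.SemistablePair (C.map i.toLin) (D.map i.toLin) μ) :
    W.SemistablePair C D μ := by
  have hZ := map_sup_smul i.toLin (p : S p F) C D
  have hadm := h.modPPair
  rw [← hZ] at hadm
  have h1 := ModPPair.of_map hi hadm
  obtain ⟨-, h2, h3⟩ := h1.map i hi
  rw [hZ] at h2 h3
  exact {
    left := h.left.of_map hi
    right := h.right.of_map hi
    le := (Submodule.map_le_map_iff_of_injective hi _ _).1 h.le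
    ne := fun heq => h.ne (by rw [← hZ, heq])
    tf := fun x hx hpx => by
      obtain ⟨y, hy, hxy⟩ := h.tf _ (Submodule.mem_map_of_mem hx) ⟨_, hpx, map_smul i.toLin _ _⟩
      exact hi hxy ▸ hy
    sat := h1.sat
    deg_eq := by rw [← h2, ← h3, h.deg_eq]
    deg_le := fun D' hD' h4 h5 => by
      have h9 := (h1.mono_left h4 h5 hD').map i hi
      rw [← h9.2.1, ← h9.2.2, hZ]
      exact h.deg_le _ (hD'.map i) (hZ ▸ Submodule.map_mono h4) (Submodule.map_mono h5) }

end Transfer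

section Semistable

variable {A B : Submodule (S p F) M.carrier} {μ : ℚ}

/-- The presentation of a subobject of a subquotient. -/
noncomputable def Presents.sub (P : M.Presents W X A B) {N : Submodule (S p F) X.carrier}
    (hN : X.IsSub N) : M.Presents (W.sub (N.comap P.g.toLin) (hN.comap' P.g)) (X.sub N hN) A
      ((N.comap P.g.toLin).map P.i.toLin) where
  i := P.i.comp (W.subHom _ _)
  g := Hom.codRestrict (P.g.comp (W.subHom _ _)) N hN fun x => x.2
  inj := P.inj.comp (Submodule.injective_subtype _)
  range := (LinearMap.range_comp _ _).trans (congrArg _ (Submodule.range_subtype _))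
  surj := by
    rintro ⟨y, hy⟩
    obtain ⟨x, rfl⟩ := P.surj y
    exact ⟨⟨x, hy⟩, rfl⟩
  ker w := Iff.trans ⟨fun h => congrArg Subtype.val h, fun h => Subtype.ext h⟩ (P.ker w.1)

/-- The presentation of the reduction of a subquotient modulo `p`. -/
noncomputable def presentsModNat (hA : M.IsSub A) (hB : M.IsSub B) (h : A ≤ B) :
    M.Presents (M.sub B hB) ((M.subquot A B hA hB h).modNat p) (A ⊔ (p : S p F) • B) B where
  i := M.subHom B hB
  g := ((M.subquot A B hA hB h).modNatProj p).comp (M.subquotProj hA hB h)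
  inj := B.injective_subtype
  range := B.range_subtype
  surj := (modNatProj_surjective _ p).comp (subquotProj_surjective hA hB h)
  ker w := by
    have h1 : (((M.subquot A B hA hB h).modNatProj p).comp (M.subquotProj hA hB h)).toLin w = 0 ↔
        (M.subquotProj hA hB h).toLin w ∈
          LinearMap.ker ((M.subquot A B hA hB h).modNatProj p).toLin :=
      Iff.rfl
    rw [h1, ker_modNatProj, Submodule.mem_sup]
    constructor
    · rintro ⟨y, -, hy⟩
      obtain ⟨y, rfl⟩ := subquotProj_surjective hA hB h y
      have hy : (p : S p F) • (M.subquotProj hA hB h).toLin y =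
          (M.subquotProj hA hB h).toLin w := hy
      rw [← map_smul, ← sub_eq_zero, ← map_sub, subquotProj_eq_zero] at hy
      refine ⟨_, neg_mem hy, (p : S p F) • (M.subHom B hB).toLin y, ⟨_, y.2, rfl⟩, ?_⟩
      rw [map_sub, map_smul, neg_sub]
      exact sub_add_cancel _ _
    · rintro ⟨a, ha, _, ⟨y, hy, rfl⟩, hw⟩
      obtain ⟨y, rfl⟩ : ∃ y' : (M.sub B hB).carrier, (M.subHom B hB).toLin y' = y :=
        ⟨⟨y, hy⟩, rfl⟩
      have hw : a + (p : S p F) • (M.subHom B hB).toLin y = (M.subHom B hB).toLin w := hw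
      refine ⟨(M.subquotProj hA hB h).toLin y, trivial, ?_⟩
      change (p : S p F) • (M.subquotProj hA hB h).toLin y = _
      rw [← map_smul, ← sub_eq_zero, ← map_sub, subquotProj_eq_zero, map_sub, ← hw, map_smul,
        sub_add_cancel_right]
      exact neg_mem ha

theorem SemistablePair.isKisin (h : M.SemistablePair A B μ) :
    (M.subquot A B h.left h.right h.le).IsKisin := by
  refine IsRegular.isKisin ⟨?_, ?_⟩
  · intro x hx
    obtain ⟨x, rfl⟩ := subquotProj_surjective h.left h.right h.le x
    rw [← map_smul, subquotProj_eq_zero] at hx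
    exact (subquotProj_eq_zero h.left h.right h.le x).2 (h.tf _ x.2 hx)
  · intro x y hxy
    obtain ⟨x, rfl⟩ := subquotProj_surjective h.left h.right h.le x
    obtain ⟨y, rfl⟩ := subquotProj_surjective h.left h.right h.le y
    rw [← map_smul, ← map_smul, ← sub_eq_zero, ← map_sub, subquotProj_eq_zero] at hxy
    have h1 : (PowerSeries.X : S p F) • x.1 ∈ A ⊔ (p : S p F) • B := by
      have h2 : (PowerSeries.X : S p F) • x.1 =
          ((PowerSeries.X : S p F) • x.1 - (p : S p F) • y.1) + (p : S p F) • y.1 := by abel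
      rw [h2]
      exact Submodule.add_mem_sup hxy ⟨y.1, y.2, rfl⟩
    obtain ⟨a, ha, _, ⟨z, hz, rfl⟩, hx⟩ := Submodule.mem_sup.1 (h.sat _ x.2 h1)
    obtain ⟨z, rfl⟩ : ∃ z' : (M.sub B h.right).carrier, (M.subHom B h.right).toLin z' = z :=
      ⟨⟨z, hz⟩, rfl⟩
    have hx : a + (p : S p F) • (M.subHom B h.right).toLin z = (M.subHom B h.right).toLin x := hx
    refine ⟨(M.subquotProj h.left h.right h.le).toLin z, ?_⟩
    rw [← map_smul, ← sub_eq_zero, ← map_sub, subquotProj_eq_zero, map_sub, map_smul, ← hx,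
      add_sub_cancel_right]
    exact ha

theorem SemistablePair.isSemistable (h : M.SemistablePair A B μ) :
    (M.subquot A B h.left h.right h.le).IsSemistable ∧
      (M.subquot A B h.left h.right h.le).slope = μ / E.poly.natDegree := by
  let P := presentsModNat h.left h.right h.le
  have hX := P.isModP h.modPPair
  obtain ⟨h1, h2⟩ := P.eq_pair h.modPPair
  have he : (0 : ℚ) < E.poly.natDegree := by exact_mod_cast E.natDegree_pos
  have hr : 0 < M.pairRank (A ⊔ (p : S p F) • B) B :=
    h.modPPair.pairRank_pos h.right h.modPPair.le le_rfl h.ne.symm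
  have hr' : (0 : ℚ) < M.pairRank (A ⊔ (p : S p F) • B) B := by exact_mod_cast hr
  have hs : ((M.subquot A B h.left h.right h.le).modNat p).torsionSlope = μ / E.poly.natDegree := by
    rw [torsionSlope_eq, h1, h2, h.deg_eq, div_right_comm, mul_div_cancel_right₀ _ hr'.ne']
  refine ⟨⟨h.isKisin, hX.isTorsionKisin, ?_, fun N hN hNs hNne => ?_⟩, h.isKisin.slope_eq.trans hs⟩
  · by_contra hn
    rw [not_nontrivial_iff_subsingleton] at hn
    apply h.ne
    refine le_antisymm h.modPPair.le fun x hx => ?_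
    exact (P.ker ⟨x, hx⟩).1 (Subsingleton.elim _ _)
  · rw [hs, torsionSlope_eq]
    set D := (N.comap P.g.toLin).map P.i.toLin with hD
    have hDB : D ≤ B := LinearMap.map_le_range.trans P.range.le
    have hZD : A ⊔ (p : S p F) • B ≤ D := fun x hx => by
      obtain ⟨y, rfl⟩ : x ∈ LinearMap.range P.i.toLin := P.range.ge (h.modPPair.le hx)
      refine ⟨y, ?_, rfl⟩
      change P.g.toLin y ∈ N
      rw [(P.ker y).2 hx]
      exact zero_mem N
    have hDs : M.IsSub D := (hN.comap' P.g).map P.i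
    have hadm := h.modPPair.mono_left hZD hDB hDs
    obtain ⟨h3, h4⟩ := (P.sub hN).eq_pair hadm
    have hDne : D ≠ A ⊔ (p : S p F) • B := fun heq => hNne (by
      rw [eq_bot_iff]
      intro y hy
      obtain ⟨x, rfl⟩ := P.surj y
      exact (P.ker x).2 (heq.le ⟨x, hy, rfl⟩))
    have hr2 : (0 : ℚ) < M.pairRank (A ⊔ (p : S p F) • B) D := by
      exact_mod_cast h.modPPair.pairRank_pos hDs hZD hDB hDne
    rw [h3, h4, div_right_comm]
    refine div_le_div_of_nonneg_right ?_ he.le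
    rw [div_le_iff₀ hr2]
    exact h.deg_le D hDs hZD hDB

end Semistable

end PhiModule
end Kisin

/-! ### Flags with semi-stable quotients -/

namespace Kisin
namespace PhiModule

variable {p : ℕ} [Fact p.Prime] {F : Type u} [Field F] {E : EisensteinPoly p F}
variable {M W Q : PhiModule.{u, v} E}

/-- The quotient of `A` by `p` has no `u`-torsion. For a subobject `A` of a Kisin module this means
that `A` is a Kisin module. -/
def SubRegular (M : PhiModule.{u, v} E) (A : Submodule (S p F) M.carrier) : Prop :=
  ∀ x ∈ A, ∀ y ∈ A, (PowerSeries.X : S p F) • x = (p : S p F) • y → ∃ z ∈ A, x = (p : S p F) • z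

theorem subRegular_bot (M : PhiModule.{u, v} E) : M.SubRegular ⊥ := fun x hx _ _ _ =>
  ⟨0, zero_mem _, by rw [(Submodule.mem_bot _).1 hx, smul_zero]⟩

theorem uSaturated_top (M : PhiModule.{u, v} E) : M.USaturated ⊤ := fun _ _ => trivial

variable [CharP F p] [PerfectRing F p]

/-- A flag of subobjects of `M` from `A` to `N` whose successive quotients are semi-stable Kisin
modules, of strictly decreasing slopes less than `c` with respect to `e * deg`. The bound `c` is
what allows a step to be put below a flag of a quotient. -/
inductive HNFlag (M : PhiModule.{u, v} E) :
    Submodule (S p F) M.carrier → Submodule (S p F) M.carrier → ℚ → Prop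
  | refl {A : Submodule (S p F) M.carrier} (c : ℚ) (h : M.IsSub A) : HNFlag M A A c
  | cons {A B N : Submodule (S p F) M.carrier} {μ c : ℚ} (h : M.SemistablePair A B μ) (hμ : μ < c)
      (h' : HNFlag M B N μ) : HNFlag M A N c

theorem HNFlag.comap {C D : Submodule (S p F) Q.carrier} {c : ℚ} (h : Q.HNFlag C D c)
    (f : Hom M Q) (hf : Function.Surjective f.toLin) :
    M.HNFlag (C.comap f.toLin) (D.comap f.toLin) c := by
  induction h with
  | refl c h => exact .refl c (h.comap' f)
  | cons h hμ _ ih => exact .cons (h.comap f hf) hμ ih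

theorem HNFlag.map {C D : Submodule (S p F) W.carrier} {c : ℚ} (h : W.HNFlag C D c)
    (i : Hom W M) (hi : Function.Injective i.toLin) :
    M.HNFlag (C.map i.toLin) (D.map i.toLin) c := by
  induction h with
  | refl c h => exact .refl c (h.map i)
  | cons h hμ _ ih => exact .cons (h.map i hi) hμ ih

theorem HNFlag.le {A N : Submodule (S p F) M.carrier} {c : ℚ} (h : M.HNFlag A N c) : A ≤ N := by
  induction h with
  | refl c h => exact le_rfl
  | cons h _ _ ih => exact h.le.trans ih

theorem HNFlag.isSub {A N : Submodule (S p F) M.carrier} {c : ℚ} (h : M.HNFlag A N c) :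
    M.IsSub N := by
  induction h with
  | refl c h => exact h
  | cons _ _ _ ih => exact ih

theorem HNFlag.of_map {i : Hom W M} (hi : Function.Injective i.toLin)
    {A N : Submodule (S p F) M.carrier} {c : ℚ} (h : M.HNFlag A N c)
    (hN : N ≤ LinearMap.range i.toLin) :
    W.HNFlag (A.comap i.toLin) (N.comap i.toLin) c := by
  induction h with
  | refl c h => exact .refl c (h.comap' i)
  | cons h hμ h' ih =>
    refine .cons (SemistablePair.of_map hi ?_) hμ (ih hN)
    have hB := h'.le.trans hN
    rw [Submodule.map_comap_eq_self hB, Submodule.map_comap_eq_self (h.le.trans hB)]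
    exact h

variable {A B N Z : Submodule (S p F) M.carrier} {μ c : ℚ} {ρ : ℕ}

/-- An extension of a Kisin module by a Kisin module is a Kisin module. -/
theorem SemistablePair.subRegular (h : M.SemistablePair A B μ) (hA : M.SubRegular A) :
    M.SubRegular B := by
  intro x hx y hy hxy
  obtain ⟨a, ha, _, ⟨z, hz, rfl⟩, rfl⟩ := Submodule.mem_sup.1
    (h.sat x hx (Submodule.mem_sup_right ⟨y, hy, hxy.symm⟩))
  have hxy : (PowerSeries.X : S p F) • (a + (p : S p F) • z) = (p : S p F) • y := hxy
  rw [smul_add, smul_comm (PowerSeries.X : S p F), ← eq_sub_iff_add_eq, ← smul_sub] at hxy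
  obtain ⟨a', ha', rfl⟩ := hA a ha _ (h.tf _ (sub_mem hy (B.smul_mem _ hz))
    (hxy ▸ A.smul_mem _ ha)) hxy
  exact ⟨a' + z, add_mem (h.le ha') hz, (smul_add _ _ _).symm⟩

theorem HNFlag.subRegular (h : M.HNFlag A N c) (hA : M.SubRegular A) : M.SubRegular N := by
  induction h with
  | refl c h => exact hA
  | cons h _ _ ih => exact ih (h.subRegular hA)

theorem SubRegular.isKisin (hM : M.IsRegular) (hA : M.SubRegular A) (hs : M.IsSub A) :
    (M.sub A hs).IsKisin := by
  refine IsRegular.isKisin ⟨fun x hx => Subtype.ext (hM.eq_zero _ (congrArg Subtype.val hx)), ?_⟩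
  intro x y hxy
  obtain ⟨z, hz, hxz⟩ := hA x.1 x.2 y.1 y.2 (congrArg Subtype.val hxy)
  exact ⟨⟨z, hz⟩, Subtype.ext hxz⟩

/-- The terms of a flag, listed in increasing order. -/
theorem HNFlag.exists_fil (h : M.HNFlag A N c) (hA : M.SubRegular A) :
    ∃ (r : ℕ) (fil : Fin (r + 1) → Submodule (S p F) M.carrier) (μ : Fin r → ℚ),
      fil 0 = A ∧ fil (Fin.last r) = N ∧ (∀ i, M.IsSub (fil i) ∧ M.SubRegular (fil i)) ∧
      (∀ i : Fin r, M.SemistablePair (fil i.castSucc) (fil i.succ) (μ i)) ∧ StrictAnti μ ∧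
      ∀ i, μ i < c := by
  induction h with
  | @refl A c h =>
    exact ⟨0, fun _ => A, Fin.elim0, rfl, rfl, fun _ => ⟨h, hA⟩, fun i => i.elim0,
      fun i => i.elim0, fun i => i.elim0⟩
  | @cons A B N μ c h hμ h' ih =>
    obtain ⟨r, fil, ν, h0, hl, hs, hss, hν, hc⟩ := ih (h.subRegular hA)
    refine ⟨r + 1, Fin.cons A fil, Fin.cons μ ν, rfl, ?_, ?_, ?_, ?_, ?_⟩
    · rw [← Fin.succ_last, Fin.cons_succ, hl]
    · exact Fin.cases ⟨h.left, hA⟩ hs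
    · refine Fin.cases ?_ fun i => ?_
      · rw [Fin.castSucc_zero, Fin.cons_zero, Fin.cons_succ, Fin.cons_zero, h0]
        exact h
      · rw [Fin.castSucc_succ, Fin.cons_succ, Fin.cons_succ, Fin.cons_succ]
        exact hss i
    · intro i j
      refine Fin.cases ?_ (fun i => ?_) i <;> refine Fin.cases ?_ (fun j => ?_) j
      · intro h; exact absurd h (lt_irrefl _)
      · intro _
        exact hc j
      · intro h
        exact absurd h (Fin.not_lt_zero _)
      · intro h
        exact hν (Fin.succ_lt_succ_iff.1 h)
    · exact Fin.cases hμ fun i => (hc i).trans hμ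

theorem HNFlag.isHNType (hM : M.IsRegular) (h : M.HNFlag ⊥ ⊤ c) : M.IsHNType := by
  obtain ⟨r, fil, μ, h0, hl, hs, hss, hμ, -⟩ := h.exists_fil M.subRegular_bot
  have he : (0 : ℚ) < E.poly.natDegree := by exact_mod_cast E.natDegree_pos
  exact ⟨hM.isKisin, r, fil, fun i => (hs i).1, fun i => μ i / E.poly.natDegree, h0, hl,
    fun i => (hs i).2.isKisin hM (hs i).1,
    fun i => ⟨(hss i).le, (hss i).isKisin, (hss i).isSemistable⟩,
    fun i j hij => div_lt_div_of_pos_right (hμ hij) he⟩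

/-- Transfer of a maximal destabilizing subobject to a subobject of `M`. -/
theorem IsMaxDest.comap (i : Hom W M) (hi : Function.Injective i.toLin)
    {C D : Submodule (S p F) W.carrier} (hCD : W.ModPPair C D)
    (h : M.IsMaxDest (C.map i.toLin) (D.map i.toLin) B μ ρ) :
    W.IsMaxDest C D (B.comap i.toLin) μ ρ := by
  have hB : (B.comap i.toLin).map i.toLin = B :=
    Submodule.map_comap_eq_self (h.modPPair.le.trans LinearMap.map_le_range)
  have hsub : W.IsSub (B.comap i.toLin) := h.isSub.comap' i
  have hCB : C ≤ B.comap i.toLin := Submodule.map_le_iff_le_comap.1 h.left_le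
  have hadm : W.ModPPair (B.comap i.toLin) D := ModPPair.of_map hi (by rw [hB]; exact h.modPPair)
  obtain ⟨-, h1, h2⟩ := (hCD.mono_left hCB hadm.le hsub).map i hi
  rw [hB] at h1 h2
  exact {
    isSub := hsub
    left_le := hCB
    modPPair := hadm
    ne := fun heq => h.ne (by rw [← hB, heq])
    rank_eq := by rw [← h1, h.rank_eq]
    deg_eq := by rw [← h2, h.deg_eq]
    max := fun D' hD' h3 h4 h5 => by
      obtain ⟨-, h6, h7⟩ := (hCD.mono_left h3 h4 hD').map i hi
      rw [← h6, ← h7]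
      exact h.max _ (hD'.map i) (Submodule.map_mono h3) (Submodule.map_mono h4)
        fun heq => h5 (Submodule.map_injective_of_injective hi heq) }

theorem IsRegular.modPPair_top (hM : M.IsRegular) : M.ModPPair ((p : S p F) • ⊤) ⊤ :=
  hM.modPPair_smul_self M.isSub_top M.uSaturated_top

/-- A subobject `N` that is saturated with respect to `p` and whose image modulo `p` is the maximal
destabilizing subobject is semi-stable, as `N/pN ≃ B/pM`. -/
theorem IsMaxDest.semistablePair (h : M.IsMaxDest ((p : S p F) • ⊤) ⊤ B μ ρ) (hM : M.IsRegular)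
    (hN : M.IsSub N) (hs : ∀ x, (p : S p F) • x ∈ N → x ∈ N) (hNB : N ⊔ (p : S p F) • ⊤ = B) :
    M.SemistablePair ⊥ N μ := by
  have hinf : (p : S p F) • ⊤ ⊓ N = (p : S p F) • N := by
    apply le_antisymm
    · rintro _ ⟨⟨x, -, rfl⟩, hx⟩
      exact ⟨x, hs x hx, rfl⟩
    · exact le_inf (smul_mono _ le_top) (smul_le_self _ _)
  have hadm : M.ModPPair ((p : S p F) • N) N :=
    { left := hN.smul p
      right := hN
      le := smul_le_self _ _
      p_smul := fun x hx => ⟨x, hx, rfl⟩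
      sat := by
        rintro x hx ⟨y, hy, hxy⟩
        obtain ⟨z, rfl⟩ := hM.exists_eq x y hxy.symm
        exact ⟨z, hs z hx, rfl⟩ }
  have hZ := hM.modPPair_top
  have key : ∀ D, M.IsSub D → (p : S p F) • N ≤ D → D ≤ N →
      D ⊔ (p : S p F) • ⊤ ≤ B ∧ M.IsSub (D ⊔ (p : S p F) • ⊤) ∧
      M.pairRank ((p : S p F) • N) D = M.pairRank ((p : S p F) • ⊤) (D ⊔ (p : S p F) • ⊤) ∧
      M.pairDeg ((p : S p F) • N) D = M.pairDeg ((p : S p F) • ⊤) (D ⊔ (p : S p F) • ⊤) := by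
    intro D hD h1 h2
    have h3 : (p : S p F) • ⊤ ⊓ D = (p : S p F) • N := by
      apply le_antisymm
      · rw [← hinf]
        exact inf_le_inf_left _ h2
      · exact le_inf (smul_mono _ le_top) h1
    have h4 : M.IsSub (D ⊔ (p : S p F) • ⊤) := hD.sup hZ.left
    refine ⟨hNB ▸ sup_le_sup_right h2 _, h4, ?_⟩
    rw [← h3]
    exact pair_inf_eq_sup (by rw [h3]; exact hadm.mono_left h1 h2 hD)
      (hZ.mono_left le_sup_right le_top h4)
  obtain ⟨-, -, h1, h2⟩ := key N hN (smul_le_self _ _) le_rfl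
  rw [hNB] at h1 h2
  refine { left := M.isSub_bot, right := hN, le := bot_le, ne := ?_, tf := ?_, sat := ?_,
           deg_eq := ?_, deg_le := ?_ }
  · rw [bot_sup_eq]
    intro heq
    apply h.ne
    rw [← hNB, sup_eq_right, ← heq]
    exact smul_mono _ le_top
  · intro x _ hx
    exact (Submodule.mem_bot _).2 (hM.eq_zero x ((Submodule.mem_bot _).1 hx))
  · rw [bot_sup_eq]
    exact hadm.sat
  · rw [bot_sup_eq, h1, h2, h.deg_eq, h.rank_eq]
  · rw [bot_sup_eq]
    intro D hD h3 h4
    obtain ⟨-, h6, h7, h8⟩ := key D hD h3 h4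
    rw [h7, h8]
    exact h.pairDeg_le hZ.left h6 le_sup_right le_top

/-- For such an `N`, the quotient `M/N` is a Kisin module, since its reduction modulo `p` is `M/B`.
-/
theorem IsMaxDest.isRegular_quot (h : M.IsMaxDest ((p : S p F) • ⊤) ⊤ B μ ρ)
    (hN : M.IsSub N) (hs : ∀ x, (p : S p F) • x ∈ N → x ∈ N) (hNB : N ⊔ (p : S p F) • ⊤ = B) :
    (M.quot N hN).IsRegular := by
  constructor
  · rintro ⟨x⟩ hx
    exact (Submodule.Quotient.mk_eq_zero N).2 (hs x ((Submodule.Quotient.mk_eq_zero N).1 hx))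
  · rintro ⟨x⟩ ⟨y⟩ hxy
    have h1 : (PowerSeries.X : S p F) • x - (p : S p F) • y ∈ N := (Submodule.Quotient.eq N).1 hxy
    have h2 : (PowerSeries.X : S p F) • x ∈ B := by
      rw [← hNB, ← sub_add_cancel ((PowerSeries.X : S p F) • x) ((p : S p F) • y)]
      exact Submodule.add_mem_sup h1 ⟨y, trivial, rfl⟩
    have h3 := h.modPPair.sat x trivial h2
    rw [← hNB] at h3
    obtain ⟨n, hn, _, ⟨z, -, rfl⟩, rfl⟩ := Submodule.mem_sup.1 h3
    refine ⟨Submodule.Quotient.mk z, (Submodule.Quotient.eq N).2 ?_⟩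
    change n + (p : S p F) • z - (p : S p F) • z ∈ N
    rwa [add_sub_cancel_right]

end PhiModule
end Kisin

/-! ### Existence of Harder–Narasimhan flags up to isogeny -/

namespace Kisin
namespace PhiModule

variable {p : ℕ} [Fact p.Prime] {F : Type u} [Field F] {E : EisensteinPoly p F}
variable [CharP F p] [PerfectRing F p]
variable {M W Q : PhiModule.{u, v} E}
variable {A B C N Z : Submodule (S p F) M.carrier} {μ μ' c : ℚ} {ρ ρ' : ℕ}

/-- If `(μ, ρ)` cannot be lowered on a saturated subobject isogenous to `M` of the same rank and
degree, then the maximal destabilizing subobject `B/pM` lifts to a subobject `N` of `M` with `M/N`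
without `p`-torsion: the modifications of `M` form a chain to which `chain_limit` applies. -/
theorem IsMaxDest.exists_limit (hM : M.IsRegular) (h : M.IsMaxDest ((p : S p F) • ⊤) ⊤ B μ ρ)
    (hmin : ∀ A : Submodule (S p F) M.carrier, M.IsSub A → M.USaturated A →
      M.pairRank ((p : S p F) • A) A = M.pairRank ((p : S p F) • ⊤) ⊤ →
      M.pairDeg ((p : S p F) • A) A = M.pairDeg ((p : S p F) • ⊤) ⊤ →
      (∃ k : ℕ, ∀ x, (p : S p F) ^ k • x ∈ A) →
      ∀ C μ' ρ', M.IsMaxDest ((p : S p F) • A) A C μ' ρ' → ¬ (μ' < μ ∨ μ' = μ ∧ ρ' < ρ)) :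
    ∃ N : Submodule (S p F) M.carrier, M.IsSub N ∧ (∀ x, (p : S p F) • x ∈ N → x ∈ N) ∧
      N ⊔ (p : S p F) • ⊤ = B := by
  -- the saturated subobjects of the kind considered in `hmin`, with a maximal destabilizing
  -- subobject of the same pair `(μ, ρ)`
  let T := {AB : Submodule (S p F) M.carrier × Submodule (S p F) M.carrier //
    M.IsSub AB.1 ∧ M.USaturated AB.1 ∧
      M.pairRank ((p : S p F) • AB.1) AB.1 = M.pairRank ((p : S p F) • ⊤) ⊤ ∧
      M.pairDeg ((p : S p F) • AB.1) AB.1 = M.pairDeg ((p : S p F) • ⊤) ⊤ ∧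
      (∃ k : ℕ, ∀ x, (p : S p F) ^ k • x ∈ AB.1) ∧
      M.IsMaxDest ((p : S p F) • AB.1) AB.1 AB.2 μ ρ}
  have hstep : ∀ t : T, ∃ t' : T, t'.1.1 = t.1.2 ∧
      t'.1.2 ⊓ (p : S p F) • t.1.1 = (p : S p F) • t.1.2 ∧
      t'.1.2 ⊔ (p : S p F) • t.1.1 = t.1.2 := by
    rintro ⟨⟨A, B⟩, hA, hs, hr, hd, ⟨k, hk⟩, hAB⟩
    dsimp only at hA hs hr hd hk hAB ⊢
    obtain ⟨hr', hd'⟩ := hAB.pair_next hM hs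
    have hBs := hAB.uSaturated hs
    have hk' : ∃ k : ℕ, ∀ x, (p : S p F) ^ k • x ∈ B := ⟨k + 1, fun x => by
      rw [pow_succ', mul_smul]
      exact hAB.left_le ⟨_, hk x, rfl⟩⟩
    have hadm := hM.modPPair_smul_self hAB.isSub hBs
    -- the rank of `B/pB` is that of `M/pM`, hence positive
    have hne : B ≠ (p : S p F) • B := by
      intro heq
      have h0 : M.pairRank ((p : S p F) • B) B = 0 := by
        rw [← heq]
        exact (pair_self hAB.isSub).1
      have h1 := hM.modPPair_top.pairRank_pos h.isSub h.left_le le_top h.ne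
      have h2 := hM.modPPair_top.pairRank_le h.isSub h.left_le le_top
      omega
    obtain ⟨C, μ', ρ', hC⟩ := hadm.exists_isMaxDest hne
    have hnot := hmin B hAB.isSub hBs (hr'.trans hr) (hd'.trans hd) hk' C μ' ρ' hC
    rcases hAB.next_lex hM hs hC with h1 | ⟨rfl, h1, h2⟩
    · exact absurd (Or.inl h1) hnot
    · obtain rfl : ρ' = ρ := by
        by_contra hρ
        exact hnot (Or.inr ⟨rfl, by omega⟩)
      exact ⟨⟨(B, C), hAB.isSub, hBs, hr'.trans hr, hd'.trans hd, hk', hC⟩, rfl, h2 rfl⟩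
  choose next hnext using hstep
  let t₀ : T := ⟨(⊤, B), M.isSub_top, M.uSaturated_top, rfl, rfl, ⟨0, fun _ => trivial⟩, h⟩
  let t : ℕ → T := fun n => Nat.rec t₀ (fun _ => next) n
  have ht : ∀ n, (t (n + 1)).1.1 = (t n).1.2 := fun n => (hnext (t n)).1
  obtain ⟨N, hN, hs, hNB⟩ := chain_limit hM (A := fun n => (t n).1.1) rfl
    (fun n => (t n).2.1) (fun n => (t n).2.2.1)
    (fun n => by rw [ht]; exact (t n).2.2.2.2.2.2.left_le)
    (fun n => by rw [ht]; exact (t n).2.2.2.2.2.2.modPPair.le)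
    (fun n => by rw [ht (n + 1), ht n]; exact (hnext (t n)).2.1)
    (fun n => by rw [ht (n + 1), ht n]; exact (hnext (t n)).2.2)
  exact ⟨N, hN, hs, hNB.trans (ht 0)⟩

/-- The denominator of `μ` divides the rank of a subobject, hence the factorial of the rank of
`A/Z`. -/
theorem IsMaxDest.exists_int (hadm : M.ModPPair Z A) (h : M.IsMaxDest Z A B μ ρ) :
    ∃ z : ℤ, μ * (M.pairRank Z A).factorial = z := by
  have h1 : 0 < ρ := h.rank_eq ▸ hadm.pairRank_pos h.isSub h.left_le h.modPPair.le h.ne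
  have h2 : ρ ≤ M.pairRank Z A := h.rank_eq ▸ hadm.pairRank_le h.isSub h.left_le h.modPPair.le
  obtain ⟨t, ht⟩ := Nat.dvd_factorial h1 h2
  refine ⟨M.pairDeg Z B * t, ?_⟩
  rw [ht]
  push_cast
  rw [← mul_assoc, ← h.deg_eq]

/-- `M` contains an isogenous subobject with a Harder--Narasimhan flag of slopes less than `c`. -/
def HasHNFlag (M : PhiModule.{u, v} E) (c : ℚ) : Prop :=
  ∃ N : Submodule (S p F) M.carrier, (∃ k : ℕ, ∀ x, (p : S p F) ^ k • x ∈ N) ∧ M.HNFlag ⊥ N c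

theorem HasHNFlag.of_sub (hA : M.IsSub A) (h : (M.sub A hA).HasHNFlag c)
    (hk : ∃ k : ℕ, ∀ x, (p : S p F) ^ k • x ∈ A) : M.HasHNFlag c := by
  obtain ⟨N, ⟨l, hl⟩, hN⟩ := h
  obtain ⟨k, hk⟩ := hk
  have h1 := hN.map (M.subHom A hA) A.injective_subtype
  rw [Submodule.map_bot] at h1
  refine ⟨_, ⟨l + k, fun x => Submodule.mem_map.2 ⟨_, hl ⟨_, hk x⟩, ?_⟩⟩, h1⟩
  rw [pow_add, mul_smul]
  rfl

/-- A flag of `M/N` with slopes less than `μ`, pulled back to `M` and preceded by `N`. -/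
theorem IsMaxDest.hasHNFlag_of_quot (hM : M.IsRegular)
    (h : M.IsMaxDest ((p : S p F) • ⊤) ⊤ B μ ρ) (hN : M.IsSub N)
    (hs : ∀ x, (p : S p F) • x ∈ N → x ∈ N) (hNB : N ⊔ (p : S p F) • ⊤ = B) (hμ : μ < c)
    (hQ : (M.quot N hN).HasHNFlag μ) : M.HasHNFlag c := by
  obtain ⟨N', ⟨k, hk⟩, hN'⟩ := hQ
  have h1 := hN'.comap (M.mkQHom N hN) N.mkQ_surjective
  have h2 : (⊥ : Submodule (S p F) (M.quot N hN).carrier).comap (M.mkQHom N hN).toLin = N :=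
    N.ker_mkQ
  rw [h2] at h1
  refine ⟨_, ⟨k, fun x => ?_⟩, .cons (h.semistablePair hM hN hs hNB) hμ h1⟩
  rw [Submodule.mem_comap, map_smul]
  exact hk _

/-- The reduction of `M/N` modulo `p` is `M/B`: its rank is smaller than that of `M`, and its
subobjects have slopes less than `μ`. -/
theorem IsMaxDest.quot_pair (hM : M.IsRegular)
    (h : M.IsMaxDest ((p : S p F) • ⊤) ⊤ B μ ρ) (hN : M.IsSub N)
    (hs : ∀ x, (p : S p F) • x ∈ N → x ∈ N) (hNB : N ⊔ (p : S p F) • ⊤ = B) :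
    (M.quot N hN).pairRank ((p : S p F) • ⊤) ⊤ < M.pairRank ((p : S p F) • ⊤) ⊤ ∧
    ∀ D, (M.quot N hN).IsSub D → (p : S p F) • ⊤ ≤ D → D ≠ (p : S p F) • ⊤ →
      ((M.quot N hN).pairDeg ((p : S p F) • ⊤) D : ℚ) <
        μ * (M.quot N hN).pairRank ((p : S p F) • ⊤) D := by
  have hadm := (h.isRegular_quot hN hs hNB).modPPair_top
  have hsurj : Function.Surjective (M.mkQHom N hN).toLin := N.mkQ_surjective
  have hB : ((p : S p F) • ⊤ : Submodule (S p F) (M.quot N hN).carrier).comap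
      (M.mkQHom N hN).toLin = B := by
    rw [← hNB, ← bot_sup_eq ((p : S p F) • ⊤ : Submodule (S p F) (M.quot N hN).carrier),
      comap_sup_smul hsurj, Submodule.comap_top]
    congr 1
    exact N.ker_mkQ
  constructor
  · have h1 := (hadm.comap (M.mkQHom N hN) hsurj).2.1
    rw [hB, Submodule.comap_top] at h1
    have h2 := (hM.modPPair_top.add h.modPPair h.left_le).1
    have h3 := hM.modPPair_top.pairRank_pos h.isSub h.left_le le_top h.ne
    omega
  · intro D hD h1 h2
    obtain ⟨-, h3, h4⟩ := (hadm.mono_left h1 le_top hD).comap (M.mkQHom N hN) hsurj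
    rw [hB] at h3 h4
    rw [← h3, ← h4]
    refine h.pairDeg_lt hM.modPPair_top (hD.comap' _) (hB ▸ Submodule.comap_mono h1) le_top
      fun heq => ?_
    exact h2 (Submodule.comap_injective_of_surjective hsurj (heq.trans hB.symm))

theorem IsRegular.sub (hM : M.IsRegular) (hA : M.IsSub A) (hs : M.USaturated A) :
    (M.sub A hA).IsRegular := by
  refine ⟨fun x hx => Subtype.ext (hM.eq_zero _ (congrArg Subtype.val hx)), fun x y hxy => ?_⟩
  obtain ⟨z, hz, hxz⟩ := (hM.modPPair_smul_self hA hs).sat x.1 x.2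
    ⟨y.1, y.2, (congrArg Subtype.val hxy).symm⟩
  exact ⟨⟨z, hz⟩, Subtype.ext hxz.symm⟩

/-- The existence of flags in rank `R` from that in smaller ranks, by induction on a bound `m` for
`(R + 1) * (μ * R! - δ * R! / R) + ρ`, with `δ` the degree. This is a positive integer, since `δ / R
≤ μ`, and as `ρ ≤ R` it decreases whenever the pair `(μ, ρ)` decreases lexicographically. -/
theorem hasHNFlag_of_lt {R : ℕ} {δ : ℤ}
    (ih : ∀ (M : PhiModule.{u, v} E), M.IsRegular → M.pairRank ((p : S p F) • ⊤) ⊤ < R → ∀ c : ℚ,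
      (∀ D, M.IsSub D → (p : S p F) • ⊤ ≤ D → D ≠ (p : S p F) • ⊤ →
        (M.pairDeg ((p : S p F) • ⊤) D : ℚ) < c * M.pairRank ((p : S p F) • ⊤) D) → M.HasHNFlag c)
    (m : ℕ) : ∀ (M : PhiModule.{u, v} E), M.IsRegular → M.pairRank ((p : S p F) • ⊤) ⊤ = R →
      M.pairDeg ((p : S p F) • ⊤) ⊤ = δ → ∀ B μ ρ c, M.IsMaxDest ((p : S p F) • ⊤) ⊤ B μ ρ →
      μ < c → (R + 1) * ((μ * R - δ) * (R.factorial / R)) + ρ ≤ m → M.HasHNFlag c := by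
  induction m with
  | zero =>
    intro M hM hR hδ B μ ρ c h hμ hm
    have h1 := h.pairDeg_le hM.modPPair_top.left hM.modPPair_top.right hM.modPPair_top.le le_rfl
    have h2 : 0 < ρ := h.rank_eq ▸ hM.modPPair_top.pairRank_pos h.isSub h.left_le h.modPPair.le h.ne
    have h2' : (0 : ℚ) < ρ := by exact_mod_cast h2
    rw [hR, hδ] at h1
    have h3 : (0 : ℚ) ≤ (R + 1) * ((μ * R - δ) * (R.factorial / R)) :=
      mul_nonneg (by positivity) (mul_nonneg (sub_nonneg.2 h1) (by positivity))
    rw [Nat.cast_zero] at hm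
    linarith
  | succ m ihm =>
    intro M hM hR hδ B μ ρ c h hμ hm
    by_cases hmin : ∃ A : Submodule (S p F) M.carrier, ∃ hA : M.IsSub A, M.USaturated A ∧
      M.pairRank ((p : S p F) • A) A = M.pairRank ((p : S p F) • ⊤) ⊤ ∧
      M.pairDeg ((p : S p F) • A) A = M.pairDeg ((p : S p F) • ⊤) ⊤ ∧
      (∃ k : ℕ, ∀ x, (p : S p F) ^ k • x ∈ A) ∧
      ∃ C μ' ρ', M.IsMaxDest ((p : S p F) • A) A C μ' ρ' ∧ (μ' < μ ∨ μ' = μ ∧ ρ' < ρ)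
    · obtain ⟨A, hA, hs, hAr, hAd, hk, C, μ', ρ', hC, hlt⟩ := hmin
      refine HasHNFlag.of_sub hA ?_ hk
      have hW := hM.sub hA hs
      have htop : (⊤ : Submodule (S p F) (M.sub A hA).carrier).map (M.subHom A hA).toLin = A :=
        A.map_subtype_top
      obtain ⟨-, h1, h2⟩ := hW.modPPair_top.map (M.subHom A hA) A.injective_subtype
      rw [Submodule.map_pointwise_smul, htop] at h1 h2
      have hC' := IsMaxDest.comap (M.subHom A hA) A.injective_subtype hW.modPPair_top (B := C)
        (μ := μ') (ρ := ρ') (by rw [Submodule.map_pointwise_smul, htop]; exact hC)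
      refine ihm _ hW (by rw [← h1, hAr, hR]) (by rw [← h2, hAd, hδ]) _ μ' ρ' c hC' ?_ ?_
      · exact (hlt.elim le_of_lt fun h => h.1.le).trans_lt hμ
      · obtain ⟨z, hz⟩ := h.exists_int hM.modPPair_top
        obtain ⟨z', hz'⟩ := hC.exists_int (hM.modPPair_smul_self hA hs)
        have hρ : 0 < ρ := h.rank_eq ▸
          hM.modPPair_top.pairRank_pos h.isSub h.left_le h.modPPair.le h.ne
        have hρ' : ρ' ≤ R := hR ▸ hAr ▸ hC.rank_eq ▸
          (hM.modPPair_smul_self hA hs).pairRank_le hC.isSub hC.left_le hC.modPPair.le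
        have hρR : ρ ≤ R := hR ▸ h.rank_eq ▸
          hM.modPPair_top.pairRank_le h.isSub h.left_le h.modPPair.le
        have hRpos : 0 < R := hρ.trans_le hρR
        have hR0 : (R : ℚ) ≠ 0 := by exact_mod_cast hRpos.ne'
        rw [hR] at hz
        rw [hAr, hR] at hz'
        have key : ∀ μ : ℚ, (μ * R - δ) * (R.factorial / R) =
            μ * R.factorial - δ * (R.factorial / R) := by
          intro μ
          field_simp
        rw [key, hz] at hm
        rw [key, hz']
        push_cast at hm
        -- `μ' R!` is at least `1` less than `μ R!`, which outweighs `ρ' - ρ < R + 1`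
        rcases hlt with hlt | ⟨rfl, hlt⟩
        · have h3 : z' + 1 ≤ z := by
            have : (z' : ℚ) < z := by
              rw [← hz, ← hz']
              exact mul_lt_mul_of_pos_right hlt (by exact_mod_cast R.factorial_pos)
            exact_mod_cast this
          have h3' : (z' : ℚ) + 1 ≤ z := by exact_mod_cast h3
          have h4 : (ρ' : ℚ) ≤ R := by exact_mod_cast hρ'
          have h5 : (1 : ℚ) ≤ ρ := by exact_mod_cast hρ
          have h6 : ((R : ℚ) + 1) * (z' + 1) ≤ (R + 1) * z :=
            mul_le_mul_of_nonneg_left h3' (by positivity)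
          linarith
        · have h3 : (ρ' : ℚ) + 1 ≤ ρ := by exact_mod_cast hlt
          rw [← hz', hz]
          linarith
    · obtain ⟨N, hN, hs, hNB⟩ := h.exists_limit hM fun A h1 h2 h3 h4 h5 C μ' ρ' hC hlt =>
        hmin ⟨A, h1, h2, h3, h4, h5, C, μ', ρ', hC, hlt⟩
      obtain ⟨h1, h2⟩ := h.quot_pair hM hN hs hNB
      exact h.hasHNFlag_of_quot hM hN hs hNB hμ
        (ih _ (h.isRegular_quot hN hs hNB) (hR ▸ h1) μ h2)

/-- Every Kisin module all of whose slopes modulo `p` are less than `c` contains an isogenous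
subobject with a flag of slopes less than `c`. The bound on the slopes is what the induction on the
rank needs. -/
theorem IsRegular.hasHNFlag {R : ℕ} : ∀ (M : PhiModule.{u, v} E), M.IsRegular →
    M.pairRank ((p : S p F) • ⊤) ⊤ = R → ∀ c : ℚ,
      (∀ D, M.IsSub D → (p : S p F) • ⊤ ≤ D → D ≠ (p : S p F) • ⊤ →
        (M.pairDeg ((p : S p F) • ⊤) D : ℚ) < c * M.pairRank ((p : S p F) • ⊤) D) →
      M.HasHNFlag c := by
  induction R using Nat.strong_induction_on with
  | _ R ih =>
    intro M hM hR c hc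
    by_cases htop : (⊤ : Submodule (S p F) M.carrier) = (p : S p F) • ⊤
    -- then `M` vanishes, and the empty flag will do
    · have h0 : (⊤ : Submodule (S p F) M.carrier) = ⊥ := by
        refine (Submodule.eq_bot_iff _).2 fun x _ =>
          eq_zero_of_forall_pow (p := p) (F := F) fun n => ?_
        induction n with
        | zero => exact ⟨x, by simp⟩
        | succ n ihn =>
          obtain ⟨z, rfl⟩ := ihn
          obtain ⟨w, -, rfl⟩ : z ∈ (p : S p F) • (⊤ : Submodule (S p F) M.carrier) :=
            htop ▸ trivial
          exact ⟨w, by rw [pow_succ, mul_smul]; rfl⟩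
      exact ⟨⊥, ⟨0, fun x => h0 ▸ trivial⟩, .refl c M.isSub_bot⟩
    · obtain ⟨B, μ, ρ, h⟩ := hM.modPPair_top.exists_isMaxDest htop
      have hμ : μ < c := by
        have h1 := hc B h.isSub h.left_le h.ne
        have h2 := hM.modPPair_top.pairRank_pos h.isSub h.left_le le_top h.ne
        rw [h.deg_eq, h.rank_eq] at h1
        rw [h.rank_eq] at h2
        exact lt_of_mul_lt_mul_right h1 (Nat.cast_nonneg _)
      obtain ⟨m, hm⟩ := exists_nat_ge
        ((R + 1) * ((μ * R - M.pairDeg ((p : S p F) • ⊤) ⊤) * (R.factorial / R)) + ρ)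
      exact hasHNFlag_of_lt (fun M' hM' hlt => ih _ hlt M' hM' rfl) m M hM hR rfl B μ ρ c h hμ hm

end PhiModule

end Kisin

theorem theorem3p26 (p : ℕ) [Fact p.Prime] (F : Type u) [Field F] [CharP F p] [PerfectRing F p]
    (E : Kisin.EisensteinPoly p F) (M : Kisin.PhiModule.{u, v} E) (hM : M.IsKisin) :
    ∃ N : Kisin.PhiModule.{u, v} E, N.IsKisin ∧ N.IsHNType ∧ M.IsIsogenous N := by
  have hreg := hM.isRegular
  -- `a` bounds the degrees of the subobjects of `M/pM`, so `a + 1` exceeds their slopes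
  obtain ⟨a, ha⟩ := hreg.modPPair_top.exists_pairDeg_le
  obtain ⟨N, ⟨k, hk⟩, hN⟩ := hreg.hasHNFlag M rfl (a + 1) fun D hD h1 h2 => by
    have h3 := hreg.modPPair_top.pairRank_pos hD h1 le_top h2
    have h4 : (M.pairDeg ((p : Kisin.S p F) • ⊤) D : ℚ) ≤ a := by exact_mod_cast ha D hD h1 le_top
    have h5 : (1 : ℚ) ≤ M.pairRank ((p : Kisin.S p F) • ⊤) D := by exact_mod_cast h3
    nlinarith [(Nat.cast_nonneg a : (0 : ℚ) ≤ a)]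
  have hK := (hN.subRegular M.subRegular_bot).isKisin hreg hN.isSub
  have hN' := hN.of_map (i := M.subHom N hN.isSub) N.injective_subtype N.range_subtype.ge
  have h1 : N.comap (M.subHom N hN.isSub).toLin = ⊤ := N.comap_subtype_self
  have h2 : (⊥ : Submodule (Kisin.S p F) M.carrier).comap (M.subHom N hN.isSub).toLin = ⊥ :=
    N.ker_subtype
  rw [h1, h2] at hN'
  have hap : ∀ x, (M.natMul (p ^ k)).toLin x = (p : Kisin.S p F) ^ k • x := fun x => by
    rw [M.natMul_apply, Nat.cast_pow]
  refine ⟨M.sub N hN.isSub, hK, hN'.isHNType hK.isRegular,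
    (M.natMul (p ^ k)).codRestrict N hN.isSub fun x => (hap x).symm ▸ hk x, k, ?_, ?_⟩
  · intro x hx
    rw [← hap]
    exact congrArg Subtype.val hx
  · intro y
    exact ⟨y.1, Subtype.ext (hap y.1)⟩
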